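/- **Setting.** Let $\mathcal T$ be a conforming simplicial triangulation of a bounded polyhedral domain $\Omega\subset\mathbb R^3$: a nonempty finite set of nondegenerate tetrahedra, any two of which meet in a common (possibly empty) face, with $\overline\Omega$ their union. Let $V,E,F,T$ be the numbers of vertices, edges, faces and tetrahedra of $\mathcal T$, and let $V_b,E_b,F_b$ be the numbers of boundary vertices, edges and faces. Put $\chi=V-E+F-T$, $\chi_b=V_b-E_b+F_b$, and let $\overline e=\frac1V\sum_i e_i=2E/V$ be the average number of edges emanating from a vertex. A *Worsey–Farin split* $\mathcal T_W$ of $\mathcal T$ is obtained by choosing an interior point $z_K$ of every tetrahedron $K$ and a point $m_f$ in the relative interior of every face $f$, where for a face shared by two tetrahedra $K,L$ the point $m_f$ lies on the line through $z_K$ and $z_L$. Each $K$ is then replaced by the 12 tetrahedra spanned by $z_K$, the point $m_f$ of a face $f$ of $K$, and an edge of $f$. Let $\mathbf V_k(\mathcal T_W)$ be the space of continuous vector fields $\overline\Omega\to\mathbb R^3$ that are polynomial of degree at most $k$ on each tetrahedron of $\mathcal T_W$, let $\mathbf Z_2(\mathcal T_W)=\{v\in\mathbf V_2(\mathcal T_W):\nabla\cdot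 v=0\}$, and let $\mathbf S_3(\mathcal T_W)=\mathbf V_3(\mathcal T_W)\cap C^1(\overline\Omega)^3$. **Theorem.** Every statement below holds for every Worsey–Farin split $\mathcal T_W$ of the mesh in question. 1. Suppose that the boundary of $\mathcal T$ is a closed surface, in the sense that every boundary edge lies in exactly two boundary faces. Then $\mathbf Z_2(\mathcal T_W)$ is finite-dimensional, $\operatorname{curl}\mathbf S_3(\mathcal T_W)\subseteq\mathbf Z_2(\mathcal T_W)$, and $$\dim\mathbf Z_2(\mathcal T_W)-\dim\operatorname{curl}\mathbf S_3(\mathcal T_W)\;\ge\;(5\overline e-22)V-6V_b+13\chi+6\chi_b .$$ 2. Consequently, for large meshes for which $V_b,\chi,\chi_b$ are negligible compared with $V$, the dimension gap is at least about $(5\overline e-22)V$, and the inclusion is strict when $\overline e>4.4$. Precisely, for every $\delta>0$ there is $\eta>0$ such that for every $\mathcal T$ as in 1 with $V_b\le\eta V$, $|\chi|\le\eta V$ and $|\chi_b|\le\eta V$, $$\dim\mathbf Z_2(\mathcal T_W)-\dim\operatorname{curl}\mathbf S_3(\mathcal T_W)\ge(5\overline e-22-\delta)V,$$ and if $\overline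 e\ge 4.4+\delta$, then $\operatorname{curl}\mathbf S_3(\mathcal T_W)\subsetneq\mathbf Z_2(\mathcal T_W)$. 3. (Freudenthal meshes.) For every $\delta>0$ there is $n_0$ such that for every Freudenthal mesh of a rectangular box made of $n\times m\times\ell$ Kuhn cells (translates of one box with arbitrary side lengths, each cut into six tetrahedra around its main diagonal) with $n,m,\ell\ge n_0$, one has $\operatorname{curl}\mathbf S_3(\mathcal T_W)\subsetneq\mathbf Z_2(\mathcal T_W)$, and the gap is at least $(5\overline e-22-\delta)V$. 4. (Uniform refinement.) Let $\mathcal T_0,\mathcal T_1,\mathcal T_2,\dots$ be conforming simplicial triangulations such that each $\mathcal T_{n+1}$ is a refinement of $\mathcal T_n$ in which every tetrahedron is split into 8 tetrahedra, every face into 4 faces and every edge into 2 edges, and whose vertices are exactly the vertices of $\mathcal T_n$ and the midpoints of the edges of $\mathcal T_n$. Then for every $\delta>0$ there is $n_0$ such that for all $n\ge n_0$ and every Worsey–Farin split $\mathcal T_W$ of $\mathcal T_n$, one has $\operatorname{curl}\mathbf S_3(\mathcal T_W)\subsetneq\mathbf Z_2(\mathcal T_W)$, and the gap is at least $(5\overline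 e-22-\delta)V$, with $\overline e$ and $V$ those of $\mathcal T_n$. -/

import Mathlib

open scoped Classical

/-- Euclidean space `ℝ³`. -/
abbrev E3 : Type := EuclideanSpace ℝ (Fin 3)

namespace TetMesh

/-! ## Simplicial meshes in `ℝ³` -/

/-- The closed simplex spanned by a finite set of points. -/
def hull (s : Finset E3) : Set E3 := convexHull ℝ (s : Set E3)

/-- A conforming simplicial triangulation: a nonempty finite set of nondegenerate tetrahedra, given by
their vertex sets, any two of which meet in a common (possibly empty) face. -/
structure IsTetMesh (𝒯 : Finset (Finset E3)) : Prop where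
  nonempty : 𝒯.Nonempty
  card_eq : ∀ K ∈ 𝒯, K.card = 4
  indep : ∀ K ∈ 𝒯, AffineIndependent ℝ ((↑) : K → E3)
  conforming : ∀ K ∈ 𝒯, ∀ L ∈ 𝒯, hull K ∩ hull L ⊆ hull (K ∩ L)

/-- The set of all `k`-element vertex sets of simplices of the mesh:
`k = 2` gives the edges, `k = 3` the faces. -/
noncomputable def simplices (𝒯 : Finset (Finset E3)) (k : ℕ) : Finset (Finset E3) :=
  𝒯.biUnion fun K => K.powersetCard k

noncomputable def vertices (𝒯 : Finset (Finset E3)) : Finset E3 := 𝒯.biUnion id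

noncomputable def edges (𝒯 : Finset (Finset E3)) : Finset (Finset E3) := simplices 𝒯 2

noncomputable def faces (𝒯 : Finset (Finset E3)) : Finset (Finset E3) := simplices 𝒯 3

/-- The boundary faces: those that belong to exactly one tetrahedron. -/
noncomputable def bdryFaces (𝒯 : Finset (Finset E3)) : Finset (Finset E3) :=
  (faces 𝒯).filter fun F => (𝒯.filter fun K => F ⊆ K).card = 1

noncomputable def bdryEdges (𝒯 : Finset (Finset E3)) : Finset (Finset E3) :=
  simplices (bdryFaces 𝒯) 2

noncomputable def bdryVertices (𝒯 : Finset (Finset E3)) : Finset E3 := vertices (bdryFaces 𝒯)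

/-- The boundary is a closed surface: every boundary edge lies in exactly two boundary faces. -/
def HasClosedSurfaceBoundary (𝒯 : Finset (Finset E3)) : Prop :=
  ∀ e ∈ bdryEdges 𝒯, ((bdryFaces 𝒯).filter fun F => e ⊆ F).card = 2

/-- The Euler characteristic `χ = V - E + F - T`. -/
noncomputable def eulerChar (𝒯 : Finset (Finset E3)) : ℤ :=
  (vertices 𝒯).card - (edges 𝒯).card + (faces 𝒯).card - 𝒯.card

/-- The Euler characteristic of the boundary, `χ_b = V_b - E_b + F_b`. -/
noncomputable def bdryEulerChar (𝒯 : Finset (Finset E3)) : ℤ :=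
  (bdryVertices 𝒯).card - (bdryEdges 𝒯).card + (bdryFaces 𝒯).card

/-- The average number `ē` of edges emanating from a vertex. -/
noncomputable def avgEdges (𝒯 : Finset (Finset E3)) : ℝ :=
  (1 / ((vertices 𝒯).card : ℝ)) *
    ∑ v ∈ vertices 𝒯, (((edges 𝒯).filter fun e => v ∈ e).card : ℝ)

/-- The closed polyhedral domain `Ω̄` covered by the tetrahedra; the open domain is its interior. -/
def domain (𝒯 : Finset (Finset E3)) : Set E3 := ⋃ K ∈ 𝒯, hull K

/-! ## The Worsey--Farin split -/

/-- The data of a Worsey--Farin split: an interior point of every tetrahedron and a point in the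
relative interior of every face, where for a face shared by two tetrahedra the face point lies on
the line through the interior points of these two tetrahedra. -/
structure WorseyFarin (𝒯 : Finset (Finset E3)) where
  center : Finset E3 → E3
  facePoint : Finset E3 → E3
  center_mem : ∀ K ∈ 𝒯, center K ∈ interior (hull K)
  facePoint_mem : ∀ F ∈ faces 𝒯, facePoint F ∈ intrinsicInterior ℝ (hull F)
  facePoint_line : ∀ F ∈ faces 𝒯, ∀ K ∈ 𝒯, ∀ L ∈ 𝒯, K ≠ L → F ⊆ K → F ⊆ L →
    facePoint F ∈ line[ℝ, center K, center L]

/-- The split mesh: every tetrahedron `K` is replaced by the twelve tetrahedra spanned by the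
interior point of `K`, the face point of a face `F` of `K`, and an edge `e` of `F`. -/
noncomputable def WorseyFarin.split {𝒯 : Finset (Finset E3)} (W : WorseyFarin 𝒯) :
    Finset (Finset E3) :=
  𝒯.biUnion fun K => (K.powersetCard 3).biUnion fun F => (F.powersetCard 2).image fun e =>
    insert (W.center K) (insert (W.facePoint F) e)

/-! ## Function spaces -/

/-- Extension of a function on `Ω̄` by zero. Only its derivatives at interior points of `Ω̄` are
used, and these do not depend on the extension. -/
noncomputable def ext {A : Set E3} (f : C(A, E3)) : E3 → E3 := Function.extend Subtype.val f 0

/-- The divergence of a vector field with derivative `L`. -/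
noncomputable def divOf (L : E3 →L[ℝ] E3) : ℝ := ∑ i, L (EuclideanSpace.single i 1) i

/-- The curl of a vector field with derivative `L`. -/
noncomputable def curlOf (L : E3 →L[ℝ] E3) : E3 :=
  !₂[L (EuclideanSpace.single 1 1) 2 - L (EuclideanSpace.single 2 1) 1,
     L (EuclideanSpace.single 2 1) 0 - L (EuclideanSpace.single 0 1) 2,
     L (EuclideanSpace.single 0 1) 1 - L (EuclideanSpace.single 1 1) 0]

lemma divOf_add (L M : E3 →L[ℝ] E3) : divOf (L + M) = divOf L + divOf M := by
  simp [divOf, Finset.sum_add_distrib]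

lemma divOf_smul (c : ℝ) (L : E3 →L[ℝ] E3) : divOf (c • L) = c * divOf L := by
  simp [divOf, Finset.mul_sum]

lemma curlOf_add (L M : E3 →L[ℝ] E3) : curlOf (L + M) = curlOf L + curlOf M := by
  ext i; fin_cases i <;> simp [curlOf] <;> ring

lemma curlOf_smul (c : ℝ) (L : E3 →L[ℝ] E3) : curlOf (c • L) = c • curlOf L := by
  ext i; fin_cases i <;> simp [curlOf] <;> ring

lemma ext_zero {A : Set E3} : ext (0 : C(A, E3)) = 0 := by
  funext x; by_cases h : ∃ a : A, a.1 = x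
  · obtain ⟨a, rfl⟩ := h; simp [ext]
  · simp [ext, Function.extend_apply' _ _ _ h]

lemma ext_add {A : Set E3} (f g : C(A, E3)) : ext (f + g) = ext f + ext g := by
  funext x; by_cases h : ∃ a : A, a.1 = x
  · obtain ⟨a, rfl⟩ := h; simp [ext]
  · simp [ext, Function.extend_apply' _ _ _ h]

lemma ext_smul {A : Set E3} (c : ℝ) (f : C(A, E3)) : ext (c • f) = c • ext f := by
  funext x; by_cases h : ∃ a : A, a.1 = x
  · obtain ⟨a, rfl⟩ := h; simp [ext]
  · simp [ext, Function.extend_apply' _ _ _ h]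

/-- `V_k(𝒯)`: continuous vector fields on `Ω̄` whose components are polynomials of degree at most
`k` on each tetrahedron. -/
noncomputable def V (𝒯 : Finset (Finset E3)) (k : ℕ) : Submodule ℝ C(domain 𝒯, E3) where
  carrier := {f | ∀ K ∈ 𝒯, ∀ i : Fin 3, ∃ p : MvPolynomial (Fin 3) ℝ, p.totalDegree ≤ k ∧
    ∀ x : domain 𝒯, x.1 ∈ hull K → f x i = MvPolynomial.eval x.1 p}
  zero_mem' := fun K _ i => ⟨0, by simp, by simp⟩
  add_mem' := by
    intro f g hf hg K hK i
    obtain ⟨p, hp, hfp⟩ := hf K hK i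
    obtain ⟨q, hq, hgq⟩ := hg K hK i
    exact ⟨p + q, (MvPolynomial.totalDegree_add p q).trans (max_le hp hq), fun x hx => by
      simp [hfp x hx, hgq x hx]⟩
  smul_mem' := by
    intro c f hf K hK i
    obtain ⟨p, hp, hfp⟩ := hf K hK i
    exact ⟨c • p, (MvPolynomial.totalDegree_smul_le c p).trans hp, fun x hx => by
      simp [hfp x hx]⟩

/-- `Z_k(𝒯)`: the divergence-free fields in `V_k(𝒯)`. The divergence is taken inside each
tetrahedron. -/
noncomputable def Z (𝒯 : Finset (Finset E3)) (k : ℕ) : Submodule ℝ C(domain 𝒯, E3) where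
  carrier := {f | f ∈ V 𝒯 k ∧ ∀ K ∈ 𝒯, ∀ x ∈ interior (hull K),
    ∃ L : E3 →L[ℝ] E3, HasFDerivAt (ext f) L x ∧ divOf L = 0}
  zero_mem' := ⟨zero_mem _, fun K _ x _ => ⟨0, by
    rw [ext_zero]; exact hasFDerivAt_const (0 : E3) x, by simp [divOf]⟩⟩
  add_mem' := by
    rintro f g ⟨hf, hf'⟩ ⟨hg, hg'⟩
    refine ⟨add_mem hf hg, fun K hK x hx => ?_⟩
    obtain ⟨L, hL, hL0⟩ := hf' K hK x hx
    obtain ⟨M, hM, hM0⟩ := hg' K hK x hx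
    exact ⟨L + M, by rw [ext_add]; exact hL.add hM, by simp [divOf_add, hL0, hM0]⟩
  smul_mem' := by
    rintro c f ⟨hf, hf'⟩
    refine ⟨Submodule.smul_mem _ c hf, fun K hK x hx => ?_⟩
    obtain ⟨L, hL, hL0⟩ := hf' K hK x hx
    exact ⟨c • L, by rw [ext_smul]; exact hL.const_smul c, by simp [divOf_smul, hL0]⟩

/-- `C¹(Ω̄)`: fields that are differentiable in the open domain, with a derivative that extends
continuously to `Ω̄`. -/
noncomputable def C1 (A : Set E3) : Submodule ℝ C(A, E3) where
  carrier := {f | ∃ G : C(A, E3 →L[ℝ] E3), ∀ x : A, x.1 ∈ interior A →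
    HasFDerivAt (ext f) (G x) x.1}
  zero_mem' := ⟨0, fun x _ => by rw [ext_zero]; exact hasFDerivAt_const (0 : E3) x.1⟩
  add_mem' := by
    rintro f g ⟨G, hG⟩ ⟨H, hH⟩
    exact ⟨G + H, fun x hx => by rw [ext_add]; exact (hG x hx).add (hH x hx)⟩
  smul_mem' := by
    rintro c f ⟨G, hG⟩
    exact ⟨c • G, fun x hx => by rw [ext_smul]; exact (hG x hx).const_smul c⟩

/-- `S_r(𝒯) = V_r(𝒯) ∩ C¹(Ω̄)`. -/
noncomputable def S (𝒯 : Finset (Finset E3)) (r : ℕ) : Submodule ℝ C(domain 𝒯, E3) :=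
  V 𝒯 r ⊓ C1 (domain 𝒯)

/-- `curl S_r(𝒯)`: the continuous fields on `Ω̄` that equal the curl of some `w ∈ S_r(𝒯)` in the
open domain. -/
noncomputable def curlS (𝒯 : Finset (Finset E3)) (r : ℕ) : Submodule ℝ C(domain 𝒯, E3) where
  carrier := {v | ∃ w ∈ S 𝒯 r, ∀ x : domain 𝒯, x.1 ∈ interior (domain 𝒯) →
    ∃ L : E3 →L[ℝ] E3, HasFDerivAt (ext w) L x.1 ∧ v x = curlOf L}
  zero_mem' := ⟨0, zero_mem _, fun x _ => ⟨0, by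
    rw [ext_zero]; exact hasFDerivAt_const (0 : E3) x.1, by
    ext i; fin_cases i <;> simp [curlOf]⟩⟩
  add_mem' := by
    rintro f g ⟨u, hu, hu'⟩ ⟨w, hw, hw'⟩
    refine ⟨u + w, add_mem hu hw, fun x hx => ?_⟩
    obtain ⟨L, hL, hL0⟩ := hu' x hx
    obtain ⟨M, hM, hM0⟩ := hw' x hx
    exact ⟨L + M, by rw [ext_add]; exact hL.add hM, by simp [curlOf_add, hL0, hM0]⟩
  smul_mem' := by
    rintro c f ⟨u, hu, hu'⟩
    refine ⟨c • u, Submodule.smul_mem _ c hu, fun x hx => ?_⟩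
    obtain ⟨L, hL, hL0⟩ := hu' x hx
    exact ⟨c • L, by rw [ext_smul]; exact hL.const_smul c, by simp [curlOf_smul, hL0]⟩

/-! ## Freudenthal meshes and uniform refinement -/

/-- The `j`-th vertex (`j = 0, 1, 2, 3`) of the Kuhn simplex of the permutation `σ` in the cell `c` of
the grid with origin `o` and spacings `h`: starting from the lowest corner of the cell, the path
moves one step in the directions `σ.symm 0`, `σ.symm 1`, `σ.symm 2` in turn. -/
noncomputable def kuhnVertex (o : E3) (h : Fin 3 → ℝ) (c : Fin 3 → ℕ) (σ : Equiv.Perm (Fin 3))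
    (j : ℕ) : E3 :=
  o + WithLp.toLp 2 fun i => h i * ((c i : ℝ) + if (σ i : ℕ) < j then 1 else 0)

/-- The Freudenthal mesh of a box made of `N 0 × N 1 × N 2` Kuhn cells, each cut into the six
tetrahedra around its main diagonal. -/
noncomputable def freudenthal (o : E3) (h : Fin 3 → ℝ) (N : Fin 3 → ℕ) : Finset (Finset E3) :=
  (Fintype.piFinset fun i => Finset.range (N i)).biUnion fun c =>
    (Finset.univ : Finset (Equiv.Perm (Fin 3))).image fun σ =>
      (Finset.range 4).image (kuhnVertex o h c σ)

/-- Every simplex of `A` is the union of exactly `m` simplices of `B`. -/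
def SplitsInto (A B : Finset (Finset E3)) (m : ℕ) : Prop :=
  ∀ s ∈ A, (B.filter fun t => hull t ⊆ hull s).card = m ∧
    hull s = ⋃ t ∈ B.filter (fun t => hull t ⊆ hull s), hull t

/-- `𝒯'` is a uniform refinement of `𝒯`: every tetrahedron is split into eight tetrahedra, every face
into four faces, every edge into two edges, and the vertices of `𝒯'` are exactly the vertices of `𝒯`
and the midpoints of the edges of `𝒯`. -/
structure IsUniformRefinement (𝒯 𝒯' : Finset (Finset E3)) : Prop where
  domain_eq : domain 𝒯' = domain 𝒯
  parent : ∀ K' ∈ 𝒯', ∃ K ∈ 𝒯, hull K' ⊆ hull K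
  tets_split : SplitsInto 𝒯 𝒯' 8
  faces_split : SplitsInto (faces 𝒯) (faces 𝒯') 4
  edges_split : SplitsInto (edges 𝒯) (edges 𝒯') 2
  mem_vertices : ∀ x : E3, x ∈ vertices 𝒯' ↔
    x ∈ vertices 𝒯 ∨ ∃ a b : E3, a ≠ b ∧ {a, b} ∈ edges 𝒯 ∧ x = midpoint ℝ a b

end TetMesh

/-!
The dimension gap is bounded below by an upper bound for the curls and a lower bound for the
divergence-free fields, both in terms of the numbers `V`, `E`, `F`, `T` of vertices, edges, faces and
tetrahedra of the original mesh.

*Curls.* A `C¹` piecewise cubic function on the Worsey–Farin split of one tetrahedron is determined by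
its values and gradients at the four vertices and two transversal derivatives at the midpoint of each
edge (`LocalSplit.unisolvent`). Hence `S₃` has dimension at most `3 (4 V + 2 E)`, and so has its
curl (`finrank_curlS_le`).

*Divergence-free fields.* The continuous piecewise quadratics on the split have three degrees of
freedom for each of its `V + F + T` vertices and each of its `E + 3 F + 8 T` edges
(`Conf.le_finrank_V`, `card_vertices_split`, `card_edges_split`). The divergence is linear on each
subtetrahedron, so that it vanishes if it does so at the vertices of the subtetrahedra. These
conditions are redundant: the interior points of two adjacent tetrahedra and the face point between
them are collinear, so that the four subtetrahedra around the segment from the face point to a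
vertex of the face lie in the sectors of two planes, and the alternating sum of the four divergences
vanishes at both ends of the segment (`WorseyFarin.subDiv_jump`). It remains to impose seven conditions
for each pair of a tetrahedron and one of its faces, and five more for each face
(`WorseyFarin.exists_faceConditions`), `28 T + 5 F` in all (`WorseyFarin.le_finrank_Z`).

Together, `dim Z₂ - dim curl S₃ ≥ 7 F - 9 V - 3 E - T` (`WorseyFarin.gap`). A face lies in at most two
tetrahedra, hence `2 F = 4 T + F_b`, and a closed boundary surface has `2 E_b = 3 F_b`. With
`ē V = 2 E`, the bound takes the form with the Euler characteristics
(`WorseyFarin.gap_of_closedSurface`), of which the asymptotic statement for general meshes is a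
consequence. Since `F ≥ 2 T`, the bound `(5 ē - 22 - δ) V` already follows from
`13 (V - E + T) + δ V ≥ 0`, and the inclusion is strict if `13 T > 9 V + 3 E`.

For a Freudenthal mesh, `T` is six times the number of cells, `V` is the number of grid points up to
lower order terms, and `E ≤ 7 V` because the edges have seven directions (`gap_freudenthal`). For
uniform refinements, one step gives `V' = V + E`, `T' ≥ 8 T`, `E' ≤ 2 E + 3 F + T`, `E' ≥ F` and
`F_b' ≤ 4 F_b`. By these recursions, `V - E + T` is at least `-O(4ⁿ)`, and `V` is at most
`T / 6 + O(4ⁿ)`, while `V` and `T` grow at least like `8ⁿ` (`growth`, `gap_refinement`).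
-/

namespace TetMesh

/-! ### Barycentric coordinates of a tetrahedron -/

/-- A finite set of points is nondegenerate when it is the vertex set of a nondegenerate
tetrahedron. -/
def Nondeg (T : Finset E3) : Prop := T.card = 4 ∧ AffineIndependent ℝ ((↑) : T → E3)

/-- The vertices of a nondegenerate tetrahedron as an affine basis of `ℝ³`. -/
noncomputable def tetBasis (T : Finset E3) (h : Nondeg T) : AffineBasis T ℝ E3 :=
  ⟨(↑), h.2, h.2.affineSpan_eq_top_iff_card_eq_finrank_add_one.2 (by simp [h.1])⟩

/-- The barycentric coordinate of the vertex `v` of the tetrahedron `T`, as an affine function on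
the whole space. It is `0` when `v` is not a vertex of `T` or `T` is degenerate. -/
noncomputable def bary (T : Finset E3) (v : E3) : E3 →ᵃ[ℝ] ℝ :=
  if h : Nondeg T ∧ v ∈ T then (tetBasis T h.1).coord ⟨v, h.2⟩ else 0

lemma tetBasis_apply {T : Finset E3} (h : Nondeg T) (v : T) : tetBasis T h v = v := rfl

lemma range_tetBasis {T : Finset E3} (h : Nondeg T) : Set.range (tetBasis T h) = T := by
  ext x; simp [tetBasis_apply]

lemma bary_of_mem {T : Finset E3} (h : Nondeg T) {v : E3} (hv : v ∈ T) :
    bary T v = (tetBasis T h).coord ⟨v, hv⟩ := by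
  rw [bary, dif_pos ⟨h, hv⟩]

lemma bary_of_notMem {T : Finset E3} {v : E3} (hv : v ∉ T) (x : E3) : bary T v x = 0 := by
  simp [bary, hv]

lemma bary_vertex {T : Finset E3} (h : Nondeg T) (v : E3) {q : E3} (hq : q ∈ T) :
    bary T v q = if v = q then 1 else 0 := by
  by_cases hv : v ∈ T
  · rw [bary_of_mem h hv]
    have := (tetBasis T h).coord_apply ⟨v, hv⟩ ⟨q, hq⟩
    simpa [tetBasis_apply] using this
  · rw [bary_of_notMem hv, if_neg]
    rintro rfl; exact hv hq

lemma sum_bary {T : Finset E3} (h : Nondeg T) (x : E3) : ∑ v ∈ T, bary T v x = 1 := by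
  rw [← Finset.sum_coe_sort, ← (tetBasis T h).sum_coord_apply_eq_one x]
  exact Finset.sum_congr rfl fun v _ => by rw [bary_of_mem h v.2]

lemma sum_bary_smul {T : Finset E3} (h : Nondeg T) (x : E3) :
    ∑ v ∈ T, bary T v x • v = x := by
  rw [← Finset.sum_coe_sort T (fun v => bary T v x • v)]
  conv_rhs => rw [← (tetBasis T h).linear_combination_coord_eq_self x]
  exact Finset.sum_congr rfl fun v _ => by rw [bary_of_mem h v.2, tetBasis_apply]

lemma affine_apply_eq {W : Type*} [AddCommGroup W] [Module ℝ W] (A : E3 →ᵃ[ℝ] W) (x : E3) :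
    A x = A.linear x + A 0 := by
  rw [A.decomp]; simp

/-- Affine maps preserve affine combinations. -/
lemma affine_comb {W : Type*} [AddCommGroup W] [Module ℝ W] (A : E3 →ᵃ[ℝ] W) (s : Finset E3)
    (w : E3 → ℝ) (hw : ∑ q ∈ s, w q = 1) :
    A (∑ q ∈ s, w q • q) = ∑ q ∈ s, w q • A q := by
  rw [affine_apply_eq, map_sum]
  have : ∀ q ∈ s, w q • A q = A.linear (w q • q) + w q • A 0 := fun q _ => by
    rw [affine_apply_eq A q, smul_add, map_smul]
  rw [Finset.sum_congr rfl this, Finset.sum_add_distrib, ← Finset.sum_smul, hw, one_smul]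

lemma bary_comb {T : Finset E3} (h : Nondeg T) {s : Finset E3} (hs : s ⊆ T)
    (w : E3 → ℝ) (hw : ∑ q ∈ s, w q = 1) (v : E3) :
    bary T v (∑ q ∈ s, w q • q) = if v ∈ s then w v else 0 := by
  rw [affine_comb _ _ _ hw,
    Finset.sum_congr rfl fun q hq => by rw [bary_vertex h v (hs hq), smul_eq_mul, mul_ite, mul_one,
      mul_zero], Finset.sum_ite_eq]

/-- An affine map is determined by its values at the vertices of a tetrahedron. -/
lemma affine_eq_sum_bary {W : Type*} [AddCommGroup W] [Module ℝ W] {T : Finset E3} (h : Nondeg T)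
    (A : E3 →ᵃ[ℝ] W) (x : E3) : A x = ∑ v ∈ T, bary T v x • A v := by
  conv_lhs => rw [← sum_bary_smul h x]
  exact affine_comb A T _ (sum_bary h x)

lemma mem_hull {s : Finset E3} {x : E3} :
    x ∈ hull s ↔ ∃ w : E3 → ℝ, (∀ y ∈ s, 0 ≤ w y) ∧ ∑ y ∈ s, w y = 1 ∧ ∑ y ∈ s, w y • y = x :=
  Finset.mem_convexHull'

lemma mem_hull_iff_bary {T : Finset E3} (h : Nondeg T) {x : E3} :
    x ∈ hull T ↔ ∀ v ∈ T, 0 ≤ bary T v x := by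
  rw [hull, ← range_tetBasis h, AffineBasis.convexHull_eq_nonneg_coord]
  simp only [Set.mem_ofPred_eq, Subtype.forall]
  exact forall₂_congr fun v hv => by rw [bary_of_mem h hv]

lemma mem_interior_hull_iff {T : Finset E3} (h : Nondeg T) {x : E3} :
    x ∈ interior (hull T) ↔ ∀ v ∈ T, 0 < bary T v x := by
  rw [hull, ← range_tetBasis h, AffineBasis.interior_convexHull]
  simp only [Set.mem_ofPred_eq, Subtype.forall]
  exact forall₂_congr fun v hv => by rw [bary_of_mem h hv]

lemma bary_nonneg {T : Finset E3} (h : Nondeg T) {x : E3} (hx : x ∈ hull T) (v : E3) :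
    0 ≤ bary T v x := by
  by_cases hv : v ∈ T
  · exact (mem_hull_iff_bary h).1 hx v hv
  · rw [bary_of_notMem hv]

lemma mem_hull_of_bary_pos {T s : Finset E3} (h : Nondeg T) {x : E3} (hs : s ⊆ T)
    (h0 : ∀ v ∈ s, 0 ≤ bary T v x) (h1 : ∀ v ∈ T, v ∉ s → bary T v x = 0) : x ∈ hull s := by
  refine mem_hull.2 ⟨fun v => bary T v x, h0, ?_, ?_⟩
  · rw [← sum_bary h x]
    exact Finset.sum_subset hs fun v hv hv' => h1 v hv hv'
  · conv_rhs => rw [← sum_bary_smul h x]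
    exact Finset.sum_subset hs fun v hv hv' => by simp [h1 v hv hv']

lemma bary_eq_zero_of_mem_hull {T s : Finset E3} (h : Nondeg T) {x : E3} (hs : s ⊆ T)
    (hx : x ∈ hull s) {v : E3} (hv : v ∉ s) : bary T v x = 0 := by
  obtain ⟨w, -, h1, rfl⟩ := mem_hull.1 hx
  rw [bary_comb h hs w h1, if_neg hv]

lemma continuous_bary (T : Finset E3) (v : E3) : Continuous (bary T v) :=
  AffineMap.continuous_of_finiteDimensional _

lemma isClosed_hull (s : Finset E3) : IsClosed (hull s) :=
  s.finite_toSet.isClosed_convexHull ℝ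

lemma convex_hull (s : Finset E3) : Convex ℝ (hull s) := convex_convexHull ℝ _

lemma subset_hull {s : Finset E3} {v : E3} (hv : v ∈ s) : v ∈ hull s :=
  subset_convexHull ℝ _ hv

lemma hull_mono {s t : Finset E3} (h : s ⊆ t) : hull s ⊆ hull t :=
  convexHull_mono (by exact_mod_cast h)

lemma hull_pair (a b : E3) : hull {a, b} = segment ℝ a b := by
  simp [hull, convexHull_pair]

lemma interior_hull_nonempty {T : Finset E3} (h : Nondeg T) : (interior (hull T)).Nonempty := by
  rw [hull, interior_convexHull_nonempty_iff_affineSpan_eq_top, ← range_tetBasis h]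
  exact (tetBasis T h).tot

lemma hull_subset_closure_interior {T : Finset E3} (h : Nondeg T) :
    hull T ⊆ closure (interior (hull T)) := by
  rw [(convex_hull T).closure_interior_eq_closure_of_nonempty_interior (interior_hull_nonempty h)]
  exact subset_closure

/-- Four points are the vertices of a nondegenerate tetrahedron if no nonzero linear functional is
constant on them. -/
lemma nondeg_of_functional {T : Finset E3} (hc : T.card = 4)
    (h : ∀ L : E3 →ₗ[ℝ] ℝ, (∀ p ∈ T, ∀ q ∈ T, L p = L q) → L = 0) : Nondeg T := by
  refine ⟨hc, ?_⟩
  rw [affineIndependent_iff_finrank_vectorSpan_eq ℝ (n := 3) _ (by simp [hc])]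
  have : vectorSpan ℝ (Set.range ((↑) : T → E3)) = ⊤ := by
    by_contra hne
    obtain ⟨f, hf0, hf⟩ := Submodule.exists_le_ker_of_lt_top _ (lt_top_iff_ne_top.2 hne)
    refine hf0 (h f fun p hp q hq => ?_)
    have := hf (vsub_mem_vectorSpan ℝ (p₁ := p) (p₂ := q)
      (s := Set.range ((↑) : T → E3)) (by simpa using hp) (by simpa using hq))
    simpa [sub_eq_zero] using this
  rw [this]; simp

/-- A linear functional that is constant on the vertices of a tetrahedron vanishes. -/
lemma functional_eq_zero {T : Finset E3} (h : Nondeg T) (L : E3 →ₗ[ℝ] ℝ) (c : ℝ)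
    (hL : ∀ p ∈ T, L p = c) : L = 0 := by
  have hc : ∀ x, L x = c := fun x => by
    have := affine_eq_sum_bary h L.toAffineMap x
    simp only [LinearMap.coe_toAffineMap] at this
    rw [this, Finset.sum_congr rfl fun v hv => by rw [hL v hv], ← Finset.sum_smul, sum_bary h,
      one_smul]
  ext x
  rw [hc x, ← hc 0, map_zero]; rfl

end TetMesh

namespace TetMesh

/-! ### Polynomial functions on `ℝ³` and their derivatives along lines -/

open MvPolynomial (eval pderiv)

/-- The derivative of the polynomial function `p` at `x`. -/
noncomputable def polyD (p : MvPolynomial (Fin 3) ℝ) (x : E3) : E3 →L[ℝ] ℝ :=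
  ∑ i, eval x.ofLp (pderiv i p) • (EuclideanSpace.proj i : E3 →L[ℝ] ℝ)

/-- The derivative of `p` in the direction `u`, as a polynomial. -/
noncomputable def pdir (p : MvPolynomial (Fin 3) ℝ) (u : E3) : MvPolynomial (Fin 3) ℝ :=
  ∑ i, MvPolynomial.C (u i) * pderiv i p

lemma polyD_apply (p : MvPolynomial (Fin 3) ℝ) (x u : E3) :
    polyD p x u = ∑ i, eval x.ofLp (pderiv i p) * u i := by
  simp [polyD]

lemma eval_pdir (p : MvPolynomial (Fin 3) ℝ) (x u : E3) :
    eval x.ofLp (pdir p u) = polyD p x u := by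
  simp [polyD_apply, pdir, mul_comm]

lemma polyD_single (p : MvPolynomial (Fin 3) ℝ) (x : E3) (i : Fin 3) :
    polyD p x (EuclideanSpace.single i 1) = eval x.ofLp (pderiv i p) := by
  simp [polyD_apply]

lemma hasFDerivAt_eval (p : MvPolynomial (Fin 3) ℝ) (x : E3) :
    HasFDerivAt (fun y : E3 => eval y.ofLp p) (polyD p x) x := by
  induction p using MvPolynomial.induction_on with
  | C a =>
    have : polyD (MvPolynomial.C a) x = 0 := by ext u; simp [polyD_apply]
    rw [this]; simpa using hasFDerivAt_const a x
  | add p q hp hq =>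
    have : polyD (p + q) x = polyD p x + polyD q x := by
      ext u; simp [polyD_apply, add_mul, Finset.sum_add_distrib]
    rw [this]; simpa only [map_add] using! hp.add hq
  | mul_X p i hp =>
    have hX : HasFDerivAt (fun y : E3 => y.ofLp i) (EuclideanSpace.proj i : E3 →L[ℝ] ℝ) x :=
      (EuclideanSpace.proj i : E3 →L[ℝ] ℝ).hasFDerivAt
    have h := hp.mul hX
    have : polyD (p * MvPolynomial.X i) x = eval x.ofLp p • (EuclideanSpace.proj i : E3 →L[ℝ] ℝ) +
        x.ofLp i • polyD p x := by
      ext u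
      simp only [polyD_apply, Derivation.leibniz, MvPolynomial.pderiv_X, smul_eq_mul, map_add,
        map_mul, add_mul, Finset.sum_add_distrib, add_apply, FunLike.coe_smul, Pi.smul_apply,
        PiLp.proj_apply, MvPolynomial.eval_X, Finset.mul_sum]
      congr 1
      · simp [Pi.single_apply, apply_ite (eval x.ofLp)]
      · exact Finset.sum_congr rfl fun j _ => by ring
    rw [this]
    simpa only [map_mul, MvPolynomial.eval_X] using! h

lemma continuous_eval (p : MvPolynomial (Fin 3) ℝ) : Continuous fun x : E3 => eval x.ofLp p :=
  continuous_iff_continuousAt.2 fun x => (hasFDerivAt_eval p x).continuousAt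

lemma continuous_polyD (p : MvPolynomial (Fin 3) ℝ) : Continuous (polyD p) := by
  unfold polyD
  exact continuous_finsetSum _ fun i _ => (continuous_eval _).smul continuous_const

lemma totalDegree_pderiv_le {n : ℕ} {p : MvPolynomial (Fin 3) ℝ} (hp : p.totalDegree ≤ n + 1)
    (i : Fin 3) : (pderiv i p).totalDegree ≤ n := by
  refine Finset.sup_le fun m hm => ?_
  have hm' : MvPolynomial.coeff (m + Finsupp.single i 1) p ≠ 0 := fun h0 => by
    rw [MvPolynomial.mem_support_iff, MvPolynomial.coeff_pderiv, h0, zero_mul] at hm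
    exact hm rfl
  have := (MvPolynomial.le_totalDegree (MvPolynomial.mem_support_iff.2 hm')).trans hp
  rw [Finsupp.sum_add_index' (by simp) (by simp), Finsupp.sum_single_index rfl] at this
  omega

lemma totalDegree_pdir_le {n : ℕ} {p : MvPolynomial (Fin 3) ℝ} (hp : p.totalDegree ≤ n + 1)
    (u : E3) : (pdir p u).totalDegree ≤ n := by
  refine MvPolynomial.totalDegree_finsetSum_le fun i _ => ?_
  rw [← MvPolynomial.smul_eq_C_mul]
  exact (MvPolynomial.totalDegree_smul_le _ _).trans (totalDegree_pderiv_le hp i)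

lemma pderiv_comm (i j : Fin 3) (p : MvPolynomial (Fin 3) ℝ) :
    pderiv i (pderiv j p) = pderiv j (pderiv i p) := by
  ext m
  simp only [MvPolynomial.coeff_pderiv, Finsupp.add_apply, Finsupp.single_apply]
  rw [add_right_comm]
  by_cases h : i = j
  · subst h; ring
  · simp [h, Ne.symm h]; ring

/-- Second derivatives of polynomials are symmetric. -/
lemma polyD_pdir_comm (p : MvPolynomial (Fin 3) ℝ) (x u v : E3) :
    polyD (pdir p u) x v = polyD (pdir p v) x u := by
  simp only [polyD_apply, pdir, map_sum, Derivation.leibniz, MvPolynomial.pderiv_C, smul_eq_mul,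
    Finset.sum_mul]
  rw [Finset.sum_comm]
  refine Finset.sum_congr rfl fun i _ => Finset.sum_congr rfl fun j _ => ?_
  rw [pderiv_comm j i]
  simp only [mul_zero, add_zero, map_mul, MvPolynomial.eval_C]; ring

lemma hasDerivAt_line (p : MvPolynomial (Fin 3) ℝ) (x u : E3) (t : ℝ) :
    HasDerivAt (fun s : ℝ => eval (x + s • u).ofLp p) (polyD p (x + t • u) u) t := by
  have h1 : HasDerivAt (fun s : ℝ => x + s • u) u t := by
    simpa using ((hasDerivAt_id t).smul_const u).const_add x
  exact (hasFDerivAt_eval p (x + t • u)).comp_hasDerivAt t h1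

lemma exists_polynomial_line {n : ℕ} {p : MvPolynomial (Fin 3) ℝ} (hp : p.totalDegree ≤ n)
    (x u : E3) : ∃ q : Polynomial ℝ, q.natDegree ≤ n ∧
      ∀ t : ℝ, eval (x + t • u).ofLp p = q.eval t := by
  refine ⟨MvPolynomial.aeval (fun i => Polynomial.C (x i) + Polynomial.C (u i) * Polynomial.X) p,
    ?_, fun t => ?_⟩
  · have := MvPolynomial.aeval_natDegree_le p hp
      (fun i => Polynomial.C (x i) + Polynomial.C (u i) * Polynomial.X) (n := 1) fun i => by
        compute_degree
    simpa using this
  · clear hp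
    induction p using MvPolynomial.induction_on with
    | C a => simp
    | add p q hp hq => simp only [map_add, hp, hq, Polynomial.eval_add]
    | mul_X p i hp =>
      simp only [map_mul, hp, MvPolynomial.eval_X, MvPolynomial.aeval_X, Polynomial.eval_mul,
        Polynomial.eval_add, Polynomial.eval_C, Polynomial.eval_X, PiLp.add_apply, PiLp.smul_apply,
        smul_eq_mul, mul_comm t]

/-- A cubic polynomial function along a line, with its derivative. -/
lemma cubic_line {p : MvPolynomial (Fin 3) ℝ} (hp : p.totalDegree ≤ 3) (x u : E3) :
    ∃ a b c d : ℝ, ∀ t : ℝ, eval (x + t • u).ofLp p = a + b * t + c * t ^ 2 + d * t ^ 3 ∧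
      polyD p (x + t • u) u = b + 2 * c * t + 3 * d * t ^ 2 := by
  obtain ⟨q, hq, h⟩ := exists_polynomial_line hp x u
  have h' : ∀ t : ℝ, eval (x + t • u).ofLp p =
      q.coeff 0 + q.coeff 1 * t + q.coeff 2 * t ^ 2 + q.coeff 3 * t ^ 3 := fun t => by
    rw [h, Polynomial.eval_eq_sum_range' (n := 4) (by omega)]
    simp [Finset.sum_range_succ]
  refine ⟨_, _, _, _, fun t => ⟨h' t, ?_⟩⟩
  have h1 := hasDerivAt_line p x u t
  rw [funext h] at h1
  rw [h1.unique (q.hasDerivAt t),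
    Polynomial.eval_eq_sum_range' (n := 3) (by have := q.natDegree_derivative_le; omega)]
  simp only [Finset.sum_range_succ, Finset.sum_range_zero, Polynomial.coeff_derivative]
  push_cast
  ring

/-- A quadratic polynomial function along a line, with its derivative. -/
lemma quadratic_line {p : MvPolynomial (Fin 3) ℝ} (hp : p.totalDegree ≤ 2) (x u : E3) :
    ∃ a b c : ℝ, ∀ t : ℝ, eval (x + t • u).ofLp p = a + b * t + c * t ^ 2 ∧
      polyD p (x + t • u) u = b + 2 * c * t := by
  obtain ⟨q, hq, h⟩ := exists_polynomial_line hp x u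
  have h' : ∀ t : ℝ, eval (x + t • u).ofLp p =
      q.coeff 0 + q.coeff 1 * t + q.coeff 2 * t ^ 2 := fun t => by
    rw [h, Polynomial.eval_eq_sum_range' (n := 3) (by omega)]
    simp [Finset.sum_range_succ]
  refine ⟨_, _, _, fun t => ⟨h' t, ?_⟩⟩
  have h1 := hasDerivAt_line p x u t
  rw [funext h] at h1
  rw [h1.unique (q.hasDerivAt t),
    Polynomial.eval_eq_sum_range' (n := 2) (by have := q.natDegree_derivative_le; omega)]
  simp only [Finset.sum_range_succ, Finset.sum_range_zero, Polynomial.coeff_derivative]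
  push_cast
  ring

/-- Functions that agree on a one-sided neighbourhood of `0` have the same derivative there. -/
lemma deriv_eq_of_eq_on_Icc {f g : ℝ → ℝ} {a b ε : ℝ} (hε : 0 < ε) (hf : HasDerivAt f a 0)
    (hg : HasDerivAt g b 0) (h : ∀ s, 0 ≤ s → s ≤ ε → f s = g s) : a = b := by
  have hu : UniqueDiffWithinAt ℝ (Set.Icc 0 ε) 0 :=
    uniqueDiffOn_Icc hε 0 (Set.left_mem_Icc.2 hε.le)
  refine hu.eq_deriv _ hf.hasDerivWithinAt (hg.hasDerivWithinAt.congr (fun s hs => h s hs.1 hs.2) ?_)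
  exact h 0 le_rfl hε.le

/-- Polynomial functions that agree on a segment starting at `x` have the same derivative at `x` in
the direction of that segment. -/
lemma polyD_eq_of_eq_on_segment {p q : MvPolynomial (Fin 3) ℝ} {x u : E3} {ε : ℝ} (hε : 0 < ε)
    (h : ∀ s : ℝ, 0 ≤ s → s ≤ ε → eval (x + s • u).ofLp p = eval (x + s • u).ofLp q) :
    polyD p x u = polyD q x u := by
  have h1 := hasDerivAt_line p x u 0
  have h2 := hasDerivAt_line q x u 0
  rw [zero_smul, add_zero] at h1 h2
  exact deriv_eq_of_eq_on_Icc hε h1 h2 h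

/-- An affine function is a polynomial function of degree at most one. -/
lemma exists_poly_of_affine (A : E3 →ᵃ[ℝ] ℝ) : ∃ p : MvPolynomial (Fin 3) ℝ,
    p.totalDegree ≤ 1 ∧ ∀ x : E3, A x = eval x.ofLp p := by
  refine ⟨∑ i, MvPolynomial.C (A.linear (EuclideanSpace.single i 1)) * MvPolynomial.X i +
    MvPolynomial.C (A 0), ?_, fun x => ?_⟩
  · refine (MvPolynomial.totalDegree_add _ _).trans (max_le ?_ (by simp))
    refine MvPolynomial.totalDegree_finsetSum_le fun i _ => ?_
    rw [← MvPolynomial.smul_eq_C_mul]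
    exact (MvPolynomial.totalDegree_smul_le _ _).trans (by simp)
  · rw [affine_apply_eq]
    have hx : x = ∑ i, x i • EuclideanSpace.single i (1 : ℝ) := by
      ext j; fin_cases j <;> simp [Fin.sum_univ_three]
    conv_lhs => rw [hx, map_sum]
    simp [mul_comm]

end TetMesh

namespace TetMesh

open MvPolynomial (eval pderiv)

/-! ### The cubic Worsey–Farin element on one tetrahedron -/

/-- The local geometry of a Worsey–Farin split: `z` is interior to the tetrahedron `K`, and `m F` is
interior to the face `F` of `K`. -/
structure LocalSplit (K : Finset E3) (z : E3) (m : Finset E3 → E3) : Prop where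
  nondeg : Nondeg K
  center_pos : ∀ v ∈ K, 0 < bary K v z
  face_pos : ∀ F ∈ K.powersetCard 3, ∀ v ∈ F, 0 < bary K v (m F)
  face_zero : ∀ F ∈ K.powersetCard 3, ∀ v, v ∉ F → bary K v (m F) = 0

lemma sum_smul_sub_eq_zero {s : Finset E3} {z : E3} {c : E3 → ℝ} (hc : ∑ v ∈ s, c v = 1)
    (hz : ∑ v ∈ s, c v • v = z) (a : E3) (g : E3 →L[ℝ] ℝ) :
    ∑ v ∈ s, c v * g (v - a) = g (z - a) := by
  have : z - a = ∑ v ∈ s, c v • (v - a) := by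
    simp only [smul_sub, Finset.sum_sub_distrib, hz, ← Finset.sum_smul, hc, one_smul]
  rw [this, map_sum]
  simp

/-- Consider polynomials `p a b` on the triangles with apex `z` and base `[a, b]`, where `a`, `b` run
through a finite set whose affine span contains `z`. Suppose that along each ray from `z` they
vanish to order `k` at the base, with a common value `A` and a common derivative `g` at the apex,
and that they join in a differentiable way along the rays through the vertices `a`. Then `A = 0` and
`g = 0`: half way along the ray through `a`, the derivative is `2⁻ᵏ g` in the directions of
the base edges at `a`, hence also in the direction of the ray, which forces `g (a - z) = -(k + 1) A`;
and a weighted sum of the vectors `a - z` vanishes. -/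
lemma cone_vanish {k : ℕ} (hk : 0 < k) {s : Finset E3} {z : E3} {c : E3 → ℝ}
    (hc : ∑ v ∈ s, c v = 1) (hz : ∑ v ∈ s, c v • v = z) (hs : ∀ a ∈ s, ∃ b ∈ s, b ≠ a)
    (p : E3 → E3 → MvPolynomial (Fin 3) ℝ) (A : ℝ) (g : E3 →L[ℝ] ℝ)
    (hmid : ∀ a ∈ s, ∀ b ∈ s, ∀ b' ∈ s, b ≠ a → b' ≠ a →
      polyD (p a b) (z + (1 / 2 : ℝ) • (a - z)) = polyD (p a b') (z + (1 / 2 : ℝ) • (a - z)))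
    (hform : ∀ a ∈ s, ∀ b ∈ s, b ≠ a → ∀ r t : ℝ, 0 ≤ r → r ≤ 1 → 0 ≤ t → t ≤ 1 →
      eval (z + t • (a + r • (b - a) - z)).ofLp (p a b) =
        (1 - t) ^ k * (A + (k * A + g (a + r • (b - a) - z)) * t)) :
    A = 0 ∧ ∀ a ∈ s, g (a - z) = 0 := by
  have key : ∀ a ∈ s, g (a - z) = -(k + 1) * A := by
    intro a ha
    obtain ⟨b₀, hb₀, hne⟩ := hs a ha
    set x := z + (1 / 2 : ℝ) • (a - z) with hx
    have h1 : ∀ b ∈ s, b ≠ a → polyD (p a b₀) x (b - a) = (1 / 2) ^ k * g (b - a) := by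
      intro b hb hba
      rw [hmid a ha b₀ hb₀ b hb hne hba]
      have d1 := hasDerivAt_line (p a b) x ((1 / 2 : ℝ) • (b - a)) 0
      rw [zero_smul, add_zero, map_smul, smul_eq_mul] at d1
      have d2 : HasDerivAt (fun r : ℝ => (1 / 2 : ℝ) ^ k *
          (A + (k * A + (g (a - z) + r * g (b - a))) * (1 / 2)))
          ((1 / 2) ^ k * (g (b - a) * (1 / 2))) 0 := by
        have := (((((hasDerivAt_id (0 : ℝ)).mul_const (g (b - a))).const_add (g (a - z))).const_add
          (k * A)).mul_const (1 / 2 : ℝ)).const_add A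
        simpa using this.const_mul ((1 / 2 : ℝ) ^ k)
      have := deriv_eq_of_eq_on_Icc one_pos d1 d2 fun r hr0 hr1 => by
        have := hform a ha b hb hba r (1 / 2) hr0 hr1 (by norm_num) (by norm_num)
        have e1 : z + (1 / 2 : ℝ) • (a + r • (b - a) - z) = x + r • (1 / 2 : ℝ) • (b - a) := by
          rw [hx]; module
        have e2 : a + r • (b - a) - z = (a - z) + r • (b - a) := by module
        rw [e1, e2, map_add, map_smul, smul_eq_mul] at this
        rw [this]; norm_num
      linarith
    have h2 : polyD (p a b₀) x (z - a) = (1 / 2) ^ k * g (z - a) := by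
      rw [← sum_smul_sub_eq_zero hc hz, ← sum_smul_sub_eq_zero hc hz, Finset.mul_sum]
      refine Finset.sum_congr rfl fun b hb => ?_
      by_cases hba : b = a
      · simp [hba]
      · rw [h1 b hb hba]; ring
    have d1 := hasDerivAt_line (p a b₀) x (a - z) 0
    rw [zero_smul, add_zero] at d1
    have d2 : HasDerivAt (fun r : ℝ => (1 / 2 - r) ^ k * (A + (k * A + g (a - z)) * (1 / 2 + r)))
        ((k * (1 / 2 - 0) ^ (k - 1) * (-1)) * (A + (k * A + g (a - z)) * (1 / 2 + 0)) +
          (1 / 2 - 0) ^ k * (k * A + g (a - z))) 0 := by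
      have e1 := ((hasDerivAt_id (0 : ℝ)).const_sub (1 / 2)).pow k
      have e2 := (((hasDerivAt_id (0 : ℝ)).const_add (1 / 2)).const_mul (k * A + g (a - z))).const_add A
      simpa only [id, mul_one] using! e1.mul e2
    have h3 := deriv_eq_of_eq_on_Icc (ε := 1 / 2) (by norm_num) d1 d2 fun r hr0 hr1 => by
      have := hform a ha b₀ hb₀ hne 0 (1 / 2 + r) le_rfl zero_le_one (by linarith) (by linarith)
      rw [zero_smul, add_zero] at this
      have e1 : z + (1 / 2 + r) • (a - z) = x + r • (a - z) := by rw [hx]; module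
      rw [e1] at this
      rw [this]; ring
    have h4 : polyD (p a b₀) x (a - z) = (1 / 2) ^ k * g (a - z) := by
      rw [← neg_sub z a, map_neg, map_neg, h2]; ring
    rw [h4] at h3
    obtain ⟨j, rfl⟩ : ∃ j, k = j + 1 := ⟨k - 1, by omega⟩
    have hpos : (0 : ℝ) < (1 / 2) ^ j := by positivity
    have hj : ((j : ℝ) + 1) ≠ 0 := by positivity
    simp only [add_tsub_cancel_right, sub_zero, add_zero, pow_succ] at h3
    push_cast at h3 ⊢
    have h5 : (1 / 2 : ℝ) ^ j * ((j + 1) * (g (a - z) + (j + 1 + 1) * A)) = 0 := by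
      linear_combination 2 * h3
    have h6 := (mul_eq_zero.1 h5).resolve_left hpos.ne'
    have h7 := (mul_eq_zero.1 h6).resolve_left hj
    linarith
  have hA : A = 0 := by
    have h0 := sum_smul_sub_eq_zero hc hz z g
    rw [Finset.sum_congr rfl fun v hv => by rw [key v hv], ← Finset.sum_mul, hc, sub_self,
      map_zero] at h0
    have hk' : (k : ℝ) + 1 ≠ 0 := by positivity
    have : (-((k : ℝ) + 1)) * A = 0 := by linarith
    exact (mul_eq_zero.1 this).resolve_left (neg_ne_zero.2 hk')
  exact ⟨hA, fun a ha => by rw [key a ha, hA, mul_zero]⟩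

/-- A cubic along a segment with a double zero at the end is determined by its value and its
derivative at the start. -/
lemma cubic_ray {p : MvPolynomial (Fin 3) ℝ} (hp : p.totalDegree ≤ 3) {z y : E3}
    (h0 : eval y.ofLp p = 0) (h1 : polyD p y (y - z) = 0) (t : ℝ) :
    eval (z + t • (y - z)).ofLp p =
      (1 - t) ^ 2 * (eval z.ofLp p + (2 * eval z.ofLp p + polyD p z (y - z)) * t) := by
  obtain ⟨a, b, c, d, h⟩ := cubic_line hp z (y - z)
  have e0 := h 0
  have e1 := h 1
  rw [zero_smul, add_zero] at e0
  rw [one_smul, add_sub_cancel, h0, h1] at e1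
  rw [(h t).1, e0.1, e0.2]
  linear_combination (-3 * t ^ 2 + 2 * t ^ 3) * e1.1 + (t ^ 2 - t ^ 3) * e1.2

/-- A quadratic along a segment with a zero at the end is determined by its value and its derivative
at the start. -/
lemma quadratic_ray {p : MvPolynomial (Fin 3) ℝ} (hp : p.totalDegree ≤ 2) {z y : E3}
    (h0 : eval y.ofLp p = 0) (t : ℝ) :
    eval (z + t • (y - z)).ofLp p =
      (1 - t) ^ 1 * (eval z.ofLp p + (1 * eval z.ofLp p + polyD p z (y - z)) * t) := by
  obtain ⟨a, b, c, h⟩ := quadratic_line hp z (y - z)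
  have e0 := h 0
  have e1 := h 1
  rw [zero_smul, add_zero] at e0
  rw [one_smul, add_sub_cancel, h0] at e1
  rw [(h t).1, e0.1, e0.2]
  linear_combination (-t ^ 2) * e1.1

/-- A quadratic on a segment that vanishes at the ends and at the midpoint vanishes on the segment. -/
lemma quadratic_zero_of_three {p : MvPolynomial (Fin 3) ℝ} (hp : p.totalDegree ≤ 2) {a b : E3}
    (h0 : eval a.ofLp p = 0) (h1 : eval b.ofLp p = 0) (h2 : eval (midpoint ℝ a b).ofLp p = 0)
    (t : ℝ) : eval (a + t • (b - a)).ofLp p = 0 := by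
  obtain ⟨α, β, γ, h⟩ := quadratic_line hp a (b - a)
  have e0 := (h 0).1
  have e1 := (h 1).1
  have e2 := (h (1 / 2)).1
  have hm : a + (1 / 2 : ℝ) • (b - a) = midpoint ℝ a b := by
    rw [midpoint_eq_smul_add, invOf_eq_inv]; module
  rw [zero_smul, add_zero, h0] at e0
  rw [one_smul, add_sub_cancel, h1] at e1
  rw [hm, h2] at e2
  rw [(h t).1]
  linear_combination (-1 + 3 * t - 2 * t ^ 2) * e0 + (t - 2 * t ^ 2) * e1 +
    (-4 * t + 4 * t ^ 2) * e2

end TetMesh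

namespace TetMesh

open MvPolynomial (eval pderiv)

lemma mem_hull_segment {s : Finset E3} {x y : E3} (hx : x ∈ hull s) (hy : y ∈ hull s) {t : ℝ}
    (h0 : 0 ≤ t) (h1 : t ≤ 1) : x + t • (y - x) ∈ hull s :=
  (convex_hull s).add_smul_sub_mem hx hy ⟨h0, h1⟩

lemma exists_face_of_pair {K : Finset E3} (hK : K.card = 4) {a b : E3} (ha : a ∈ K) (hb : b ∈ K)
    (hab : a ≠ b) : ∃ F ∈ K.powersetCard 3, a ∈ F ∧ b ∈ F := by
  obtain ⟨F, h1, h2, h3⟩ := Finset.exists_subsuperset_card_eq (s := {a, b}) (t := K) (n := 3)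
    (by simp [Finset.insert_subset_iff, ha, hb]) (by rw [Finset.card_pair hab]; norm_num)
    (by omega)
  exact ⟨F, Finset.mem_powersetCard.2 ⟨h2, h3⟩, h1 (by simp), h1 (by simp)⟩

lemma pair_mem_powersetCard {F : Finset E3} {a b : E3} (ha : a ∈ F) (hb : b ∈ F)
    (hab : b ≠ a) : {a, b} ∈ F.powersetCard 2 :=
  Finset.mem_powersetCard.2 ⟨by simp [Finset.insert_subset_iff, ha, hb],
    Finset.card_pair hab.symm⟩

lemma exists_pair_of_mem_powersetCard {F e : Finset E3} (he : e ∈ F.powersetCard 2) :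
    ∃ a ∈ F, ∃ b ∈ F, b ≠ a ∧ e = {a, b} := by
  obtain ⟨h1, h2⟩ := Finset.mem_powersetCard.1 he
  obtain ⟨a, b, hab, rfl⟩ := Finset.card_eq_two.1 h2
  exact ⟨a, h1 (by simp), b, h1 (by simp), hab.symm, rfl⟩

lemma LocalSplit.sum_face {K : Finset E3} {z : E3} {m : Finset E3 → E3} (h : LocalSplit K z m)
    {F : Finset E3} (hF : F ∈ K.powersetCard 3) : ∑ v ∈ F, bary K v (m F) = 1 := by
  rw [← sum_bary h.nondeg (m F)]
  exact Finset.sum_subset (Finset.mem_powersetCard.1 hF).1 fun v _ hv => h.face_zero F hF v hv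

lemma LocalSplit.sum_smul_face {K : Finset E3} {z : E3} {m : Finset E3 → E3}
    (h : LocalSplit K z m) {F : Finset E3} (hF : F ∈ K.powersetCard 3) :
    ∑ v ∈ F, bary K v (m F) • v = m F := by
  conv_rhs => rw [← sum_bary_smul h.nondeg (m F)]
  exact Finset.sum_subset (Finset.mem_powersetCard.1 hF).1 fun v _ hv => by
    simp [h.face_zero F hF v hv]

/-- Every point of a simplex lies on a ray from a given vertex to the opposite side. -/
lemma exists_ray {s : Finset E3} (hs : s.Nonempty) {z x : E3} (hx : x ∈ hull (insert z s)) :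
    ∃ y ∈ hull s, ∃ t : ℝ, 0 ≤ t ∧ t ≤ 1 ∧ x = z + t • (y - z) := by
  rw [hull, Finset.coe_insert, convexHull_insert (by simpa using hs)] at hx
  obtain ⟨z', hz', y, hy, hxy⟩ := mem_convexJoin.1 hx
  obtain rfl : z' = z := by simpa using hz'
  rw [segment_eq_image'] at hxy
  obtain ⟨t, ht, rfl⟩ := hxy
  exact ⟨y, hy, t, ht.1, ht.2, rfl⟩

/-- A `C¹` piecewise cubic function on the Worsey–Farin split of a tetrahedron vanishes if its
values and gradients vanish at the vertices and its gradients vanish at the midpoints of the edges.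
The function vanishes to second order on the edges. By `cone_vanish`, it vanishes to second order
at the interior point, it vanishes on the faces, and so does its derivative in the direction from
the face point to the interior point, which is a `C¹` piecewise quadratic on each face. It remains
a cubic with two double zeros on every ray from the interior point. -/
theorem LocalSplit.unisolvent {K : Finset E3} {z : E3} {m : Finset E3 → E3}
    (h : LocalSplit K z m) (w : E3 → ℝ) (G : E3 → E3 →L[ℝ] ℝ)
    (hP : ∀ F ∈ K.powersetCard 3, ∀ e ∈ F.powersetCard 2,
      ∃ p : MvPolynomial (Fin 3) ℝ, p.totalDegree ≤ 3 ∧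
        ∀ x ∈ hull (insert z (insert (m F) e)), w x = eval x.ofLp p ∧ G x = polyD p x)
    (hv : ∀ v ∈ K, w v = 0 ∧ G v = 0)
    (he : ∀ a ∈ K, ∀ b ∈ K, a ≠ b → G (midpoint ℝ a b) = 0) :
    ∀ F ∈ K.powersetCard 3, ∀ e ∈ F.powersetCard 2,
      ∀ x ∈ hull (insert z (insert (m F) e)), w x = 0 := by
  choose! P hdeg hval using hP
  have memz : ∀ F e, z ∈ hull (insert z (insert (m F) e)) := fun F e => subset_hull (by simp)
  have memm : ∀ F e, m F ∈ hull (insert z (insert (m F) e)) := fun F e => subset_hull (by simp)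
  have mema : ∀ F a b, a ∈ hull (insert z (insert (m F) {a, b})) := fun F a b =>
    subset_hull (by simp)
  have memb : ∀ F a b, b ∈ hull (insert z (insert (m F) {a, b})) := fun F a b =>
    subset_hull (by simp)
  have hdeg2 : ∀ F ∈ K.powersetCard 3, ∀ e ∈ F.powersetCard 2, ∀ u,
      (pdir (P F e) u).totalDegree ≤ 2 := fun F hF e he' u =>
    totalDegree_pdir_le (hdeg F hF e he') u
  -- second order vanishing on the edges
  have hedge : ∀ a ∈ K, ∀ b ∈ K, b ≠ a → ∀ r : ℝ, 0 ≤ r → r ≤ 1 →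
      w (a + r • (b - a)) = 0 ∧ G (a + r • (b - a)) = 0 := by
    intro a ha b hb hab
    obtain ⟨F, hF, haF, hbF⟩ := exists_face_of_pair h.nondeg.1 ha hb hab.symm
    have hE := pair_mem_powersetCard haF hbF hab
    have hmem : ∀ r : ℝ, 0 ≤ r → r ≤ 1 →
        a + r • (b - a) ∈ hull (insert z (insert (m F) {a, b})) := fun r h0 h1 =>
      mem_hull_segment (mema F a b) (memb F a b) h0 h1
    have hG : ∀ r : ℝ, 0 ≤ r → r ≤ 1 → G (a + r • (b - a)) = 0 := by
      intro r h0 h1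
      ext u
      rw [(hval F hF _ hE _ (hmem r h0 h1)).2, ← eval_pdir]
      refine quadratic_zero_of_three (hdeg2 F hF _ hE u) ?_ ?_ ?_ r
      · rw [eval_pdir, ← (hval F hF _ hE _ (mema F a b)).2, (hv a ha).2]; rfl
      · rw [eval_pdir, ← (hval F hF _ hE _ (memb F a b)).2, (hv b hb).2]; rfl
      · have hm : midpoint ℝ a b = a + (1 / 2 : ℝ) • (b - a) := by
          rw [midpoint_eq_smul_add, invOf_eq_inv]; module
        rw [eval_pdir, ← (hval F hF _ hE _ (hm ▸ hmem (1 / 2) (by norm_num) (by norm_num))).2,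
          he a ha b hb hab.symm]; rfl
    intro r h0 h1
    refine ⟨?_, hG r h0 h1⟩
    obtain ⟨α, β, γ, δ, hc⟩ := cubic_line (hdeg F hF _ hE) a (b - a)
    have hd : ∀ r : ℝ, 0 ≤ r → r ≤ 1 → β + 2 * γ * r + 3 * δ * r ^ 2 = 0 := fun r h0 h1 => by
      rw [← (hc r).2, ← (hval F hF _ hE _ (hmem r h0 h1)).2, hG r h0 h1]; rfl
    have d0 := hd 0 le_rfl zero_le_one
    have d1 := hd 1 zero_le_one le_rfl
    have d2 := hd (1 / 2) (by norm_num) (by norm_num)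
    have e0 := (hc 0).1
    rw [zero_smul, add_zero, ← (hval F hF _ hE _ (mema F a b)).1, (hv a ha).1] at e0
    rw [(hval F hF _ hE _ (hmem r h0 h1)).1, (hc r).1]
    have hβ : β = 0 := by linarith
    have hδ : δ = 0 := by linarith
    have hγ : γ = 0 := by linarith
    rw [hβ, hγ, hδ]; linarith
  -- the cubics along the rays to the edges
  have hray : ∀ F ∈ K.powersetCard 3, ∀ a ∈ F, ∀ b ∈ F, b ≠ a →
      ∀ q ∈ hull (insert z (insert (m F) {a, b})), ∀ r t : ℝ, 0 ≤ r → r ≤ 1 →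
      eval (q + t • (a + r • (b - a) - q)).ofLp (P F {a, b}) =
        (1 - t) ^ 2 * (w q + ((2 : ℕ) * w q + G q (a + r • (b - a) - q)) * t) := by
    intro F hF a ha b hb hab q hq r t h0 h1
    have hE := pair_mem_powersetCard ha hb hab
    have hFK := (Finset.mem_powersetCard.1 hF).1
    have hy := mem_hull_segment (mema F a b) (memb F a b) h0 h1
    have hz := hedge a (hFK ha) b (hFK hb) hab r h0 h1
    have hvy := hval F hF _ hE _ hy
    have hvq := hval F hF _ hE _ hq
    rw [hvq.1, hvq.2]
    refine cubic_ray (hdeg F hF _ hE) ?_ ?_ t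
    · rw [← hvy.1, hz.1]
    · rw [← hvy.2, hz.2]; rfl
  -- second order vanishing at the interior point
  have hcenter : w z = 0 ∧ G z = 0 := by
    have hch : ∀ a ∈ K, ∀ b ∈ K, b ≠ a → ∃ F ∈ K.powersetCard 3, a ∈ F ∧ b ∈ F :=
      fun a ha b hb hab => exists_face_of_pair h.nondeg.1 ha hb hab.symm
    choose! Fc hFc hFca hFcb using hch
    have hmem : ∀ F a b, z + (1 / 2 : ℝ) • (a - z) ∈ hull (insert z (insert (m F) {a, b})) :=
      fun F a b => mem_hull_segment (memz F _) (mema F a b) (by norm_num) (by norm_num)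
    obtain ⟨h1, h2⟩ := cone_vanish two_pos (sum_bary h.nondeg z) (sum_bary_smul h.nondeg z)
      (fun a ha => Finset.exists_mem_ne (by rw [h.nondeg.1]; norm_num) a)
      (fun a b => P (Fc a b) {a, b}) (w z) (G z)
      (fun a ha b hb b' hb' hab hab' => by
        rw [← (hval _ (hFc a ha b hb hab) _ (pair_mem_powersetCard (hFca a ha b hb hab)
            (hFcb a ha b hb hab) hab) _ (hmem _ a b)).2,
          ← (hval _ (hFc a ha b' hb' hab') _ (pair_mem_powersetCard (hFca a ha b' hb' hab')
            (hFcb a ha b' hb' hab') hab') _ (hmem _ a b')).2])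
      (fun a ha b hb hab r t hr0 hr1 _ _ => hray _ (hFc a ha b hb hab) a (hFca a ha b hb hab) b
        (hFcb a ha b hb hab) hab z (memz _ _) r t hr0 hr1)
    refine ⟨h1, ?_⟩
    have := functional_eq_zero h.nondeg (G z).toLinearMap (G z z) fun a ha => by
      have := h2 a ha
      rw [map_sub, sub_eq_zero] at this
      exact this
    ext u
    exact congrArg (fun L : E3 →ₗ[ℝ] ℝ => L u) this
  intro F hF e hE
  have hFK := (Finset.mem_powersetCard.1 hF).1
  have hFne : ∀ a ∈ F, ∃ b ∈ F, b ≠ a := fun a _ =>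
    Finset.exists_mem_ne (by rw [(Finset.mem_powersetCard.1 hF).2]; norm_num) a
  -- vanishing on the face
  have hface : ∀ a ∈ F, ∀ b ∈ F, b ≠ a → ∀ r t : ℝ, 0 ≤ r → r ≤ 1 → 0 ≤ t → t ≤ 1 →
      eval (m F + t • (a + r • (b - a) - m F)).ofLp (P F {a, b}) = 0 := by
    have hmem : ∀ a b, m F + (1 / 2 : ℝ) • (a - m F) ∈ hull (insert z (insert (m F) {a, b})) :=
      fun a b => mem_hull_segment (memm F _) (mema F a b) (by norm_num) (by norm_num)
    obtain ⟨h1, h2⟩ := cone_vanish two_pos (h.sum_face hF) (h.sum_smul_face hF) hFne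
      (fun a b => P F {a, b}) (w (m F)) (G (m F))
      (fun a ha b hb b' hb' hab hab' => by
        rw [← (hval _ hF _ (pair_mem_powersetCard ha hb hab) _ (hmem a b)).2,
          ← (hval _ hF _ (pair_mem_powersetCard ha hb' hab') _ (hmem a b')).2])
      (fun a ha b hb hab r t hr0 hr1 _ _ => hray F hF a ha b hb hab _ (memm _ _) r t hr0 hr1)
    intro a ha b hb hab r t hr0 hr1 _ _
    rw [hray F hF a ha b hb hab _ (memm _ _) r t hr0 hr1, h1]
    have : a + r • (b - a) - m F = (1 - r) • (a - m F) + r • (b - m F) := by module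
    rw [this, map_add, map_smul, map_smul, h2 a ha, h2 b hb]
    simp
  -- vanishing of the transversal derivative on the face
  have hpsi : ∀ a ∈ F, ∀ b ∈ F, b ≠ a → ∀ r t : ℝ, 0 ≤ r → r ≤ 1 → 0 ≤ t → t ≤ 1 →
      eval (m F + t • (a + r • (b - a) - m F)).ofLp (pdir (P F {a, b}) (z - m F)) = 0 := by
    -- second derivatives agree along segments parallel to the line through the split points
    have hsecond : ∀ e ∈ F.powersetCard 2, ∀ e' ∈ F.powersetCard 2, ∀ x,
        (∀ s : ℝ, 0 ≤ s → s ≤ 1 / 2 → x + s • (z - m F) ∈ hull (insert z (insert (m F) e)) ∧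
          x + s • (z - m F) ∈ hull (insert z (insert (m F) e'))) →
        polyD (pdir (P F e) (z - m F)) x = polyD (pdir (P F e') (z - m F)) x := by
      intro e hE e' hE' x hx
      ext u
      rw [polyD_pdir_comm, polyD_pdir_comm _ _ _ u]
      refine polyD_eq_of_eq_on_segment (ε := 1 / 2) (by norm_num) fun s h0 h1 => ?_
      rw [eval_pdir, eval_pdir, ← (hval F hF e hE _ (hx s h0 h1).1).2,
        ← (hval F hF e' hE' _ (hx s h0 h1).2).2]
    obtain ⟨a₀, ha₀⟩ : F.Nonempty := Finset.card_pos.1 (by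
      rw [(Finset.mem_powersetCard.1 hF).2]; norm_num)
    obtain ⟨b₀, hb₀, hab₀⟩ := hFne a₀ ha₀
    have hE₀ := pair_mem_powersetCard ha₀ hb₀ hab₀
    set g := polyD (pdir (P F {a₀, b₀}) (z - m F)) (m F) with hg
    have hgc : ∀ e ∈ F.powersetCard 2, polyD (pdir (P F e) (z - m F)) (m F) = g := by
      intro e hE
      refine hsecond e hE _ hE₀ _ fun s h0 h1 => ⟨?_, ?_⟩ <;>
        exact mem_hull_segment (memm F _) (memz F _) h0 (by linarith)
    have hA : ∀ e ∈ F.powersetCard 2,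
        eval (m F).ofLp (pdir (P F e) (z - m F)) = G (m F) (z - m F) := by
      intro e hE
      rw [eval_pdir, ← (hval F hF e hE _ (memm F e)).2]
    have hform : ∀ a ∈ F, ∀ b ∈ F, b ≠ a → ∀ r t : ℝ, 0 ≤ r → r ≤ 1 →
        eval (m F + t • (a + r • (b - a) - m F)).ofLp (pdir (P F {a, b}) (z - m F)) =
          (1 - t) ^ 1 * (G (m F) (z - m F) + ((1 : ℕ) * G (m F) (z - m F) +
            g (a + r • (b - a) - m F)) * t) := by
      intro a ha b hb hab r t h0 h1
      have hE := pair_mem_powersetCard ha hb hab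
      rw [← hgc _ hE, ← hA _ hE, Nat.cast_one]
      refine quadratic_ray (hdeg2 F hF _ hE _) ?_ t
      rw [eval_pdir, ← (hval F hF _ hE _ (mem_hull_segment (mema F a b) (memb F a b) h0 h1)).2,
        (hedge a (hFK ha) b (hFK hb) hab r h0 h1).2]
      rfl
    obtain ⟨h1, h2⟩ := cone_vanish one_pos (h.sum_face hF) (h.sum_smul_face hF) hFne
      (fun a b => pdir (P F {a, b}) (z - m F)) (G (m F) (z - m F)) g
      (fun a ha b hb b' hb' hab hab' => by
        refine hsecond _ (pair_mem_powersetCard ha hb hab) _ (pair_mem_powersetCard ha hb' hab') _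
          fun s h0 h1 => ?_
        have e1 : m F + (1 / 2 : ℝ) • (a - m F) + s • (z - m F) =
            (m F + (2 * s) • (z - m F)) + (1 / 2 : ℝ) • (a - (m F + (2 * s) • (z - m F))) := by
          module
        rw [e1]
        constructor <;>
          exact mem_hull_segment (mem_hull_segment (memm F _) (memz F _) (by linarith)
            (by linarith)) (mema F _ _) (by norm_num) (by norm_num))
      (fun a ha b hb hab r t hr0 hr1 _ _ => hform a ha b hb hab r t hr0 hr1)
    intro a ha b hb hab r t hr0 hr1 _ _
    rw [hform a ha b hb hab r t hr0 hr1, h1]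
    have : a + r • (b - a) - m F = (1 - r) • (a - m F) + r • (b - m F) := by module
    rw [this, map_add, map_smul, map_smul, h2 a ha, h2 b hb]
    simp
  obtain ⟨a, ha, b, hb, hab, rfl⟩ := exists_pair_of_mem_powersetCard hE
  intro x hx
  obtain ⟨y, hy, t, ht0, ht1, rfl⟩ := exists_ray (by simp) hx
  have hyT := hull_mono (Finset.subset_insert z _) hy
  obtain ⟨y', hy', t', ht0', ht1', hyy⟩ := exists_ray (by simp) hy
  rw [hull_pair, segment_eq_image'] at hy'
  obtain ⟨r, hr, rfl⟩ := hy'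
  have hy0 : eval y.ofLp (P F {a, b}) = 0 := by
    rw [hyy]; exact hface a ha b hb hab r t' hr.1 hr.2 ht0' ht1'
  have hy1 : polyD (P F {a, b}) y (m F - y) = 0 := by
    have : polyD (P F {a, b}) y (m F - y) = polyD 0 y (m F - y) := by
      refine polyD_eq_of_eq_on_segment one_pos fun s h0 h1 => ?_
      have e1 : y + s • (m F - y) =
          m F + ((1 - s) * t') • (a + r • (b - a) - m F) := by rw [hyy]; module
      rw [e1, hface a ha b hb hab r _ hr.1 hr.2 (by nlinarith) (by nlinarith), map_zero]
    rw [this]; simp [polyD]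
  have hy2 : polyD (P F {a, b}) y (z - m F) = 0 := by
    rw [← eval_pdir, hyy]; exact hpsi a ha b hb hab r t' hr.1 hr.2 ht0' ht1'
  have hyd : polyD (P F {a, b}) y (y - z) = 0 := by
    have : y - z = -(m F - y) - (z - m F) := by module
    rw [this, map_sub, map_neg, hy1, hy2]; simp
  have hz := hval F hF _ hE _ (memz F {a, b})
  rw [(hval F hF _ hE _ hx).1, cubic_ray (hdeg F hF _ hE) hy0 hyd t, ← hz.1, ← hz.2, hcenter.1,
    hcenter.2]
  simp

end TetMesh

namespace TetMesh

open MvPolynomial (eval pderiv)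

/-! ### Piecewise polynomial fields and their derivatives -/

/-- The derivative of the vector field with polynomial components `p`. -/
noncomputable def polyDV (p : Fin 3 → MvPolynomial (Fin 3) ℝ) (x : E3) : E3 →L[ℝ] E3 :=
  ((EuclideanSpace.equiv (Fin 3) ℝ).symm : (Fin 3 → ℝ) →L[ℝ] E3).comp
    (ContinuousLinearMap.pi fun i => polyD (p i) x)

lemma polyDV_apply (p : Fin 3 → MvPolynomial (Fin 3) ℝ) (x u : E3) (i : Fin 3) :
    polyDV p x u i = polyD (p i) x u := rfl

lemma continuous_polyDV (p : Fin 3 → MvPolynomial (Fin 3) ℝ) : Continuous (polyDV p) := by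
  unfold polyDV
  refine continuous_const.clm_comp ?_
  have : (fun x => ContinuousLinearMap.pi fun i => polyD (p i) x) =
      fun x => ∑ i, (ContinuousLinearMap.single ℝ (fun _ : Fin 3 => ℝ) i).comp (polyD (p i) x) := by
    funext x; ext u i
    simp [Finset.sum_apply, Pi.single_apply]
  rw [this]
  exact continuous_finsetSum _ fun i _ => continuous_const.clm_comp (continuous_polyD _)

lemma ext_apply {A : Set E3} (f : C(A, E3)) (x : A) : ext f x = f x :=
  Subtype.val_injective.extend_apply _ _ _

lemma hull_subset_domain {𝒮 : Finset (Finset E3)} {T : Finset E3} (hT : T ∈ 𝒮) :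
    hull T ⊆ domain 𝒮 := Set.subset_biUnion_of_mem (u := hull) hT

lemma hasFDerivAt_ext {𝒮 : Finset (Finset E3)} {f : C(domain 𝒮, E3)} {T : Finset E3} (hT : T ∈ 𝒮)
    {p : Fin 3 → MvPolynomial (Fin 3) ℝ}
    (hp : ∀ i, ∀ x : domain 𝒮, x.1 ∈ hull T → f x i = eval x.1.ofLp (p i))
    {x : E3} (hx : x ∈ interior (hull T)) : HasFDerivAt (ext f) (polyDV p x) x := by
  have h1 : HasFDerivAt (fun y : E3 => fun i => eval y.ofLp (p i))
      (ContinuousLinearMap.pi fun i => polyD (p i) x) x :=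
    hasFDerivAt_pi.2 fun i => hasFDerivAt_eval (p i) x
  have h2 := ((EuclideanSpace.equiv (Fin 3) ℝ).symm : (Fin 3 → ℝ) →L[ℝ] E3).hasFDerivAt.comp x h1
  refine h2.congr_of_eventuallyEq ?_
  filter_upwards [isOpen_interior.mem_nhds hx] with y hy
  have hyT := interior_subset hy
  have := ext_apply f ⟨y, hull_subset_domain hT hyT⟩
  simp only at this
  rw [this]
  ext i
  exact hp i _ hyT

lemma divOf_polyDV (p : Fin 3 → MvPolynomial (Fin 3) ℝ) (x : E3) :
    divOf (polyDV p x) = ∑ i, eval x.ofLp (pderiv i (p i)) := by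
  simp [divOf, polyDV_apply, polyD_single]

/-- Continuous functions on the domain that agree in the interior of a tetrahedron agree on the
closed tetrahedron. -/
lemma eq_on_hull {𝒮 : Finset (Finset E3)} {T : Finset E3} (hT : T ∈ 𝒮) (h : Nondeg T) {Y : Type*}
    [TopologicalSpace Y] [T2Space Y] {φ ψ : domain 𝒮 → Y} (hφ : Continuous φ) (hψ : Continuous ψ)
    (heq : ∀ x : domain 𝒮, x.1 ∈ interior (hull T) → φ x = ψ x) (x : domain 𝒮)
    (hx : x.1 ∈ hull T) : φ x = ψ x := by
  have hcl : x ∈ closure {x : domain 𝒮 | x.1 ∈ interior (hull T)} := by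
    rw [closure_subtype]
    refine closure_mono ?_ (hull_subset_closure_interior h hx)
    exact fun y hy => ⟨⟨y, hull_subset_domain hT (interior_subset hy)⟩, hy, rfl⟩
  exact closure_minimal (t := {x | φ x = ψ x}) heq (isClosed_eq hφ hψ) hcl

lemma interior_hull_subset {𝒮 : Finset (Finset E3)} {T : Finset E3} (hT : T ∈ 𝒮) :
    interior (hull T) ⊆ interior (domain 𝒮) := interior_mono (hull_subset_domain hT)

/-- By continuity, the extension of the gradient of a piecewise polynomial field is the gradient of its
polynomial on each closed tetrahedron, up to the boundary. -/
lemma grad_eq {𝒮 : Finset (Finset E3)} {w : C(domain 𝒮, E3)} {G : C(domain 𝒮, E3 →L[ℝ] E3)}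
    (hG : ∀ x : domain 𝒮, x.1 ∈ interior (domain 𝒮) → HasFDerivAt (ext w) (G x) x.1)
    {T : Finset E3} (hT : T ∈ 𝒮) (h : Nondeg T) {p : Fin 3 → MvPolynomial (Fin 3) ℝ}
    (hp : ∀ i, ∀ x : domain 𝒮, x.1 ∈ hull T → w x i = eval x.1.ofLp (p i))
    (x : domain 𝒮) (hx : x.1 ∈ hull T) : G x = polyDV p x.1 :=
  eq_on_hull hT h G.continuous ((continuous_polyDV p).comp continuous_subtype_val)
    (fun x hx => (hG x (interior_hull_subset hT hx)).unique (hasFDerivAt_ext hT hp hx)) x hx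

/-- A piecewise polynomial field is determined by its tuple of polynomials, one for each tetrahedron and
component. -/
lemma finiteDimensional_V (𝒮 : Finset (Finset E3)) (k : ℕ) : FiniteDimensional ℝ (V 𝒮 k) := by
  have hT : ∀ x : domain 𝒮, ∃ T : 𝒮, x.1 ∈ hull T := fun x => by
    obtain ⟨T, hT, hx⟩ := Set.mem_iUnion₂.1 x.2
    exact ⟨⟨T, hT⟩, hx⟩
  choose τ hτ using hT
  -- the space of all piecewise polynomials, continuous or not
  let Q : (𝒮 × Fin 3 → MvPolynomial.restrictTotalDegree (Fin 3) ℝ k) →ₗ[ℝ]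
      (domain 𝒮 → Fin 3 → ℝ) :=
    { toFun := fun q x i => eval x.1.ofLp (q (τ x, i)).1
      map_add' := fun q r => by funext x i; simp
      map_smul' := fun c q => by funext x i; simp }
  let ι : C(domain 𝒮, E3) →ₗ[ℝ] (domain 𝒮 → Fin 3 → ℝ) :=
    { toFun := fun f x => (f x).ofLp
      map_add' := fun f g => by funext x i; simp
      map_smul' := fun c f => by funext x i; simp }
  have hι : Function.Injective ι := fun f g h => by
    ext x i; exact congrFun (congrFun h x) i
  have hle : (V 𝒮 k).map ι ≤ LinearMap.range Q := by
    rintro _ ⟨f, hf, rfl⟩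
    choose! p hp hfp using hf
    refine ⟨fun Ti => ⟨p Ti.1 Ti.2, (MvPolynomial.mem_restrictTotalDegree ..).2
      (hp _ Ti.1.2 _)⟩, ?_⟩
    funext x i
    exact (hfp _ (τ x).2 i x (hτ x)).symm
  have : FiniteDimensional ℝ ((V 𝒮 k).map ι) := Submodule.finiteDimensional_of_le hle
  exact Module.Finite.equiv (Submodule.equivMapOfInjective ι hι (V 𝒮 k)).symm

lemma Z_le_V (𝒮 : Finset (Finset E3)) (k : ℕ) : Z 𝒮 k ≤ V 𝒮 k := fun _ hf => hf.1

lemma finiteDimensional_Z (𝒮 : Finset (Finset E3)) (k : ℕ) : FiniteDimensional ℝ (Z 𝒮 k) :=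
  have := finiteDimensional_V 𝒮 k
  Submodule.finiteDimensional_of_le (Z_le_V 𝒮 k)

/-! ### The curl of `C¹` cubics -/

lemma continuous_curlOf : Continuous curlOf := by
  unfold curlOf
  fun_prop

/-- The curl of a continuous gradient field. -/
noncomputable def curlMap (A : Set E3) : C(A, E3 →L[ℝ] E3) →ₗ[ℝ] C(A, E3) where
  toFun G := ⟨fun x => curlOf (G x), continuous_curlOf.comp G.continuous⟩
  map_add' G H := by ext1 x; exact curlOf_add _ _
  map_smul' c G := by ext1 x; exact curlOf_smul _ _

/-- The pairs of a piecewise polynomial field and a continuous extension of its gradient. -/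
noncomputable def gradPairs (𝒮 : Finset (Finset E3)) (k : ℕ) :
    Submodule ℝ (C(domain 𝒮, E3) × C(domain 𝒮, E3 →L[ℝ] E3)) where
  carrier := {q | q.1 ∈ V 𝒮 k ∧ ∀ x : domain 𝒮, x.1 ∈ interior (domain 𝒮) →
    HasFDerivAt (ext q.1) (q.2 x) x.1}
  zero_mem' := ⟨zero_mem _, fun x _ => by
    simp only [Prod.fst_zero, ext_zero]; exact hasFDerivAt_const (0 : E3) x.1⟩
  add_mem' := by
    rintro q r ⟨hq, hq'⟩ ⟨hr, hr'⟩
    exact ⟨add_mem hq hr, fun x hx => by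
      simp only [Prod.fst_add, ext_add]; exact (hq' x hx).add (hr' x hx)⟩
  smul_mem' := by
    rintro c q ⟨hq, hq'⟩
    exact ⟨Submodule.smul_mem _ c hq, fun x hx => by
      simp only [Prod.smul_fst, ext_smul]; exact (hq' x hx).const_smul c⟩

/-- A field in `curlS` is the curl of the extended gradient on the closed domain, not only in its
interior. -/
lemma exists_gradPair {𝒮 : Finset (Finset E3)} (h𝒮 : ∀ T ∈ 𝒮, Nondeg T) {k : ℕ}
    {v : C(domain 𝒮, E3)} (hv : v ∈ curlS 𝒮 k) :
    ∃ w G, (w, G) ∈ gradPairs 𝒮 k ∧ v = curlMap _ G := by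
  obtain ⟨w, ⟨hwV, G, hG⟩, hcurl⟩ := hv
  refine ⟨w, G, ⟨hwV, hG⟩, ?_⟩
  ext1 x
  obtain ⟨T, hT, hx⟩ := Set.mem_iUnion₂.1 x.2
  refine eq_on_hull hT (h𝒮 T hT) v.continuous (curlMap _ G).continuous (fun x hx => ?_) x hx
  obtain ⟨L, hL, hvL⟩ := hcurl x (interior_hull_subset hT hx)
  rw [hvL, hL.unique (hG x (interior_hull_subset hT hx))]
  rfl

/-- The divergence of a curl vanishes by the symmetry of the second derivatives of the polynomials. -/
lemma curlS_le_Z {𝒮 : Finset (Finset E3)} (h𝒮 : ∀ T ∈ 𝒮, Nondeg T) (k : ℕ) :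
    curlS 𝒮 (k + 1) ≤ Z 𝒮 k := by
  intro v hv
  obtain ⟨w, G, ⟨hwV, hG⟩, rfl⟩ := exists_gradPair h𝒮 hv
  have hpoly : ∀ T ∈ 𝒮, ∃ q p : Fin 3 → MvPolynomial (Fin 3) ℝ, (∀ i, (q i).totalDegree ≤ k) ∧
      (∀ i, ∀ x : domain 𝒮, x.1 ∈ hull T → curlMap _ G x i = eval x.1.ofLp (q i)) ∧
      q = ![pderiv 1 (p 2) - pderiv 2 (p 1), pderiv 2 (p 0) - pderiv 0 (p 2),
        pderiv 0 (p 1) - pderiv 1 (p 0)] := by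
    intro T hT
    choose p hp hwp using hwV T hT
    have hsub : ∀ i j, (pderiv i (p j)).totalDegree ≤ k := fun i j => totalDegree_pderiv_le (hp j) i
    refine ⟨_, p, fun i => ?_, fun i x hx => ?_, rfl⟩
    · fin_cases i <;> exact (MvPolynomial.totalDegree_sub _ _).trans (max_le (hsub _ _) (hsub _ _))
    · have hGx := grad_eq hG hT (h𝒮 T hT) hwp x hx
      change curlOf (G x) i = _
      rw [hGx]
      fin_cases i <;> simp [curlOf, polyDV_apply, polyD_single]
  refine ⟨fun T hT i => ?_, fun T hT x hx => ?_⟩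
  · obtain ⟨q, p, hq, hqe, -⟩ := hpoly T hT
    exact ⟨q i, hq i, hqe i⟩
  · obtain ⟨q, p, hq, hqe, hqp⟩ := hpoly T hT
    refine ⟨_, hasFDerivAt_ext hT hqe hx, ?_⟩
    rw [divOf_polyDV, Fin.sum_univ_three, hqp]
    simp only [Matrix.cons_val, map_sub, pderiv_comm 1 0, pderiv_comm 2 0, pderiv_comm 2 1]
    ring

end TetMesh

namespace TetMesh

open MvPolynomial (eval pderiv)

/-! ### The geometry of the split -/

lemma IsTetMesh.nondeg {𝒯 : Finset (Finset E3)} (h : IsTetMesh 𝒯) {K : Finset E3} (hK : K ∈ 𝒯) :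
    Nondeg K := ⟨h.card_eq K hK, h.indep K hK⟩

lemma mem_simplices {𝒯 : Finset (Finset E3)} {k : ℕ} {s : Finset E3} :
    s ∈ simplices 𝒯 k ↔ ∃ K ∈ 𝒯, s ∈ K.powersetCard k := Finset.mem_biUnion

lemma mem_vertices {𝒯 : Finset (Finset E3)} {v : E3} :
    v ∈ vertices 𝒯 ↔ ∃ K ∈ 𝒯, v ∈ K := Finset.mem_biUnion

/-- A point of the relative interior of a face has positive barycentric coordinates: otherwise the
point could be moved slightly away from a vertex of the face without leaving the face, which would
make the corresponding coordinate negative. -/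
lemma bary_pos_of_mem_intrinsicInterior {K F : Finset E3} (h : Nondeg K) (hF : F ⊆ K) {x : E3}
    (hx : x ∈ intrinsicInterior ℝ (hull F)) {v : E3} (hv : v ∈ F) : 0 < bary K v x := by
  have hxF := intrinsicInterior_subset hx
  have h0 := bary_nonneg h (hull_mono hF hxF) v
  refine lt_of_le_of_ne h0 fun hzero => ?_
  obtain ⟨y, hy, rfl⟩ := hx
  let γ : ℝ → affineSpan ℝ (hull F) := fun t =>
    ⟨AffineMap.lineMap v y.1 t, AffineMap.lineMap_mem t
      (subset_affineSpan ℝ _ (subset_hull hv)) y.2⟩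
  have hγ : Continuous γ := Continuous.subtype_mk (by fun_prop) _
  have h1 : γ 1 = y := Subtype.ext (AffineMap.lineMap_apply_one _ _)
  have hev := hγ.continuousAt.preimage_mem_nhds (x := (1 : ℝ))
    (h1 ▸ isOpen_interior.mem_nhds hy)
  obtain ⟨ε, hε, hball⟩ := Metric.mem_nhds_iff.1 hev
  have hm : (1 + ε / 2 : ℝ) ∈ Metric.ball (1 : ℝ) ε := by
    rw [Metric.mem_ball, Real.dist_eq, add_sub_cancel_left, abs_of_pos (by linarith)]; linarith
  have hmem : (γ (1 + ε / 2)).1 ∈ hull F :=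
    interior_subset (s := ((↑) ⁻¹' hull F : Set (affineSpan ℝ (hull F)))) (hball hm)
  change AffineMap.lineMap v y.1 (1 + ε / 2) ∈ hull F at hmem
  have hneg := bary_nonneg h (hull_mono hF hmem) v
  rw [AffineMap.apply_lineMap, ← hzero, bary_vertex h v (hF hv), if_pos rfl,
    AffineMap.lineMap_apply_module] at hneg
  simp only [smul_eq_mul] at hneg
  linarith

lemma WorseyFarin.localSplit {𝒯 : Finset (Finset E3)} (h𝒯 : IsTetMesh 𝒯) (W : WorseyFarin 𝒯)
    {K : Finset E3} (hK : K ∈ 𝒯) : LocalSplit K (W.center K) W.facePoint where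
  nondeg := h𝒯.nondeg hK
  center_pos := (mem_interior_hull_iff (h𝒯.nondeg hK)).1 (W.center_mem K hK)
  face_pos F hF _ hv := bary_pos_of_mem_intrinsicInterior (h𝒯.nondeg hK)
    (Finset.mem_powersetCard.1 hF).1 (W.facePoint_mem F (mem_simplices.2 ⟨K, hK, hF⟩)) hv
  face_zero F hF _ hv := bary_eq_zero_of_mem_hull (h𝒯.nondeg hK) (Finset.mem_powersetCard.1 hF).1
    (intrinsicInterior_subset (W.facePoint_mem F (mem_simplices.2 ⟨K, hK, hF⟩))) hv

lemma WorseyFarin.mem_split {𝒯 : Finset (Finset E3)} {W : WorseyFarin 𝒯} {T : Finset E3} :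
    T ∈ W.split ↔ ∃ K ∈ 𝒯, ∃ F ∈ K.powersetCard 3, ∃ e ∈ F.powersetCard 2,
      insert (W.center K) (insert (W.facePoint F) e) = T := by
  simp [WorseyFarin.split]

/-- If a linear functional takes the value `c` at an affine combination and at all points but one,
then also at that point, provided its weight does not vanish. -/
lemma functional_eq_of_comb {s : Finset E3} {w : E3 → ℝ} {x : E3} (h1 : ∑ v ∈ s, w v = 1)
    (h2 : ∑ v ∈ s, w v • v = x) (L : E3 →ₗ[ℝ] ℝ) {c : ℝ} (hx : L x = c) {r : E3} (hr : r ∈ s)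
    (hw : w r ≠ 0) (hL : ∀ v ∈ s, v ≠ r → L v = c) : L r = c := by
  have h3 : ∑ v ∈ s, w v * (L v - c) = 0 := by
    have : ∑ v ∈ s, w v * L v = c := by rw [← hx, ← h2, map_sum]; simp
    simp only [mul_sub, Finset.sum_sub_distrib, this, ← Finset.sum_mul, h1, one_mul, sub_self]
  rw [Finset.sum_eq_single_of_mem r hr fun v hv hvr => by rw [hL v hv hvr, sub_self, mul_zero]] at h3
  exact sub_eq_zero.1 ((mul_eq_zero.1 h3).resolve_left hw)

lemma exists_eq_insert_of_card_succ {s t : Finset E3} (h : s ⊆ t) (hc : t.card = s.card + 1) :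
    ∃ r, r ∉ s ∧ t = insert r s := by
  obtain ⟨r, hr⟩ : (t \ s).Nonempty := by
    rw [← Finset.card_pos, Finset.card_sdiff_of_subset h]; omega
  rw [Finset.mem_sdiff] at hr
  refine ⟨r, hr.2, (Finset.eq_of_subset_of_card_le ?_ ?_).symm⟩
  · exact Finset.insert_subset hr.1 h
  · rw [Finset.card_insert_of_notMem hr.2, hc]

namespace LocalSplit

variable {K : Finset E3} {z : E3} {m : Finset E3 → E3}

lemma center_ne_facePoint (h : LocalSplit K z m) {F : Finset E3} (hF : F ∈ K.powersetCard 3) :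
    z ≠ m F := by
  intro he
  obtain ⟨hFK, hFc⟩ := Finset.mem_powersetCard.1 hF
  obtain ⟨u, hu, hKu⟩ := exists_eq_insert_of_card_succ hFK (by rw [h.nondeg.1, hFc])
  have h1 := h.center_pos u (by rw [hKu]; simp)
  rw [he, h.face_zero F hF u hu] at h1
  exact lt_irrefl _ h1

lemma center_notMem (h : LocalSplit K z m) : z ∉ K := by
  intro hz
  obtain ⟨v, hv, hvz⟩ := Finset.exists_mem_ne (s := K) (by rw [h.nondeg.1]; norm_num) z
  have h1 := h.center_pos v hv
  rw [bary_vertex h.nondeg v hz, if_neg hvz] at h1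
  exact lt_irrefl _ h1

lemma facePoint_notMem (h : LocalSplit K z m) {F : Finset E3} (hF : F ∈ K.powersetCard 3) :
    m F ∉ K := by
  intro hm
  obtain ⟨v, hv, hvz⟩ := Finset.exists_mem_ne (s := F)
    (by rw [(Finset.mem_powersetCard.1 hF).2]; norm_num) (m F)
  have h1 := h.face_pos F hF v hv
  rw [bary_vertex h.nondeg v hm, if_neg hvz] at h1
  exact lt_irrefl _ h1

lemma nondeg_split (h : LocalSplit K z m) {F e : Finset E3} (hF : F ∈ K.powersetCard 3)
    (he : e ∈ F.powersetCard 2) : Nondeg (insert z (insert (m F) e)) := by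
  obtain ⟨hFK, hFc⟩ := Finset.mem_powersetCard.1 hF
  obtain ⟨heF, hec⟩ := Finset.mem_powersetCard.1 he
  obtain ⟨u, hu, hKu⟩ := exists_eq_insert_of_card_succ hFK (by rw [h.nondeg.1, hFc])
  obtain ⟨r, hr, hFr⟩ := exists_eq_insert_of_card_succ heF (by rw [hFc, hec])
  have hrF : r ∈ F := by rw [hFr]; simp
  have huK : u ∈ K := by rw [hKu]; simp
  refine nondeg_of_functional ?_ fun L hL => ?_
  · rw [Finset.card_insert_of_notMem, Finset.card_insert_of_notMem, hec]
    · exact fun hm => h.facePoint_notMem hF (hFK (heF hm))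
    · rw [Finset.mem_insert, not_or]
      exact ⟨h.center_ne_facePoint hF, fun hz => h.center_notMem (hFK (heF hz))⟩
  · have hm : L (m F) = L z := hL _ (by simp) _ (by simp)
    have hev : ∀ v ∈ e, L v = L z := fun v hv => hL _ (by simp [hv]) _ (by simp)
    have hLr : L r = L z := functional_eq_of_comb (h.sum_face hF) (h.sum_smul_face hF) L hm hrF
      (h.face_pos F hF r hrF).ne' fun v hv hvr => hev v (by
        rw [hFr, Finset.mem_insert] at hv; exact hv.resolve_left hvr)
    have hFv : ∀ v ∈ F, L v = L z := fun v hv => by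
      rw [hFr, Finset.mem_insert] at hv
      rcases hv with rfl | hv
      exacts [hLr, hev v hv]
    have hLu : L u = L z := functional_eq_of_comb (sum_bary h.nondeg z) (sum_bary_smul h.nondeg z)
      L rfl huK (h.center_pos u huK).ne' fun v hv hvu => hFv v (by
        rw [hKu, Finset.mem_insert] at hv; exact hv.resolve_left hvu)
    refine functional_eq_zero h.nondeg L (L z) fun v hv => ?_
    rw [hKu, Finset.mem_insert] at hv
    rcases hv with rfl | hv
    exacts [hLu, hFv v hv]

end LocalSplit

lemma WorseyFarin.nondeg_split {𝒯 : Finset (Finset E3)} (h𝒯 : IsTetMesh 𝒯) (W : WorseyFarin 𝒯) :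
    ∀ T ∈ W.split, Nondeg T := by
  intro T hT
  obtain ⟨K, hK, F, hF, e, he, rfl⟩ := WorseyFarin.mem_split.1 hT
  exact (W.localSplit h𝒯 hK).nondeg_split hF he

/-! ### The dimension of the space of curls -/

/-- Evaluation at a point of the domain, as a linear map; it is `0` at points outside. -/
noncomputable def evalAt (A : Set E3) (Y : Type*) [NormedAddCommGroup Y] [NormedSpace ℝ Y] (x : E3) :
    C(A, Y) →ₗ[ℝ] Y :=
  if h : x ∈ A then (ContinuousMap.evalCLM ℝ (⟨x, h⟩ : A) : C(A, Y) →L[ℝ] Y) else 0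

lemma evalAt_apply {A : Set E3} {Y : Type*} [NormedAddCommGroup Y] [NormedSpace ℝ Y]
    (f : C(A, Y)) (x : A) : evalAt A Y x.1 f = f x := by
  simp [evalAt]

/-- Two directions that, together with the direction of the edge, span the space. -/
lemma exists_transversal {K : Finset E3} (h : Nondeg K) {e : Finset E3} (he : e ∈ K.powersetCard 2) :
    ∃ n : Fin 2 → E3, ∀ L : E3 →L[ℝ] ℝ, (∀ a ∈ e, ∀ b ∈ e, L (b - a) = 0) → (∀ j, L (n j) = 0) →
      L = 0 := by
  obtain ⟨heK, hec⟩ := Finset.mem_powersetCard.1 he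
  obtain ⟨c, d, hcd, hKe⟩ := Finset.card_eq_two.1 (show (K \ e).card = 2 by
    rw [Finset.card_sdiff_of_subset heK, h.1, hec])
  obtain ⟨a, ha⟩ := Finset.card_pos.1 (by rw [hec]; norm_num : 0 < e.card)
  refine ⟨![c - a, d - a], fun L h1 h2 => ?_⟩
  have := functional_eq_zero h L.toLinearMap (L a) fun p hp => by
    change L p = L a
    by_cases hpe : p ∈ e
    · have := h1 a ha p hpe
      rwa [map_sub, sub_eq_zero] at this
    · have hp' : p ∈ K \ e := Finset.mem_sdiff.2 ⟨hp, hpe⟩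
      rw [hKe, Finset.mem_insert, Finset.mem_singleton] at hp'
      rcases hp' with rfl | rfl
      · simpa [sub_eq_zero] using h2 0
      · simpa [sub_eq_zero] using h2 1
  ext u
  exact congrArg (fun L : E3 →ₗ[ℝ] ℝ => L u) this

/-- The curls of `C¹` cubics form a space of dimension at most `12 V + 6 E`: a `C¹` cubic field is
determined by its values and gradients at the vertices and by two transversal derivatives at the
midpoint of every edge. -/
theorem finrank_curlS_le {𝒯 : Finset (Finset E3)} (h𝒯 : IsTetMesh 𝒯) (W : WorseyFarin 𝒯) :
    Module.finrank ℝ (curlS W.split 3) ≤ 12 * (vertices 𝒯).card + 6 * (edges 𝒯).card := by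
  have hnd := W.nondeg_split h𝒯
  have hedge : ∀ e : edges 𝒯, ∃ n : Fin 2 → E3, ∀ L : E3 →L[ℝ] ℝ,
      (∀ a ∈ e.1, ∀ b ∈ e.1, L (b - a) = 0) → (∀ j, L (n j) = 0) → L = 0 := fun e => by
    obtain ⟨K, hK, he⟩ := mem_simplices.1 e.2
    exact exists_transversal (h𝒯.nondeg hK) he
  choose n hn using hedge
  -- the midpoint of an edge is half the sum of its vertices
  let mid : Finset E3 → E3 := fun e => (1 / 2 : ℝ) • ∑ v ∈ e, v
  have hmid : ∀ a b : E3, a ≠ b → mid {a, b} = midpoint ℝ a b := fun a b hab => by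
    simp only [mid]
    rw [Finset.sum_pair hab, midpoint_eq_smul_add, invOf_eq_inv, one_div]
  let D := domain W.split
  let ev := evalAt D E3
  let evG := evalAt D (E3 →L[ℝ] E3)
  let Φ : (C(D, E3) × C(D, E3 →L[ℝ] E3)) →ₗ[ℝ]
      ((vertices 𝒯 × Option (Fin 3)) ⊕ (edges 𝒯 × Fin 2) → E3) :=
    { toFun := fun q => Sum.elim
        (fun vi => vi.2.elim (ev vi.1 q.1) fun i => evG vi.1 q.2 (EuclideanSpace.single i 1))
        (fun ej => evG (mid ej.1) q.2 (n ej.1 ej.2))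
      map_add' := fun q r => by
        funext j
        rcases j with ⟨v, _ | i⟩ | ⟨e, j⟩ <;> simp
      map_smul' := fun c q => by
        funext j
        rcases j with ⟨v, _ | i⟩ | ⟨e, j⟩ <;> simp }
  let R := gradPairs W.split 3
  have hinj : Function.Injective (Φ.domRestrict R) := by
    rw [injective_iff_map_eq_zero]
    rintro ⟨⟨w, G⟩, hwV, hG⟩ h0
    have h0v : ∀ v ∈ vertices 𝒯, ev v w = 0 ∧ evG v G = 0 := fun v hv => by
      refine ⟨congrFun h0 (Sum.inl (⟨v, hv⟩, none)), ?_⟩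
      have hi : ∀ i, evG v G (EuclideanSpace.single i 1) = 0 := fun i =>
        congrFun h0 (Sum.inl (⟨v, hv⟩, some i))
      ext u j
      have hu : u = ∑ i, u i • EuclideanSpace.single i (1 : ℝ) := by
        ext j; fin_cases j <;> simp [Fin.sum_univ_three]
      rw [hu, map_sum]
      simp [hi]
    have h0e : ∀ e (he : e ∈ edges 𝒯), ∀ j, evG (mid e) G (n ⟨e, he⟩ j) = 0 := fun e he j =>
      congrFun h0 (Sum.inr (⟨e, he⟩, j))
    have hw0 : ∀ x : D, w x = 0 := by
      intro x
      obtain ⟨T, hT, hx⟩ := Set.mem_iUnion₂.1 x.2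
      obtain ⟨K, hK, F, hF, e, he, rfl⟩ := WorseyFarin.mem_split.1 hT
      have hloc := W.localSplit h𝒯 hK
      ext i
      let π : E3 →L[ℝ] ℝ := EuclideanSpace.proj i
      have hP : ∀ F ∈ K.powersetCard 3, ∀ e ∈ F.powersetCard 2,
          ∃ p : MvPolynomial (Fin 3) ℝ, p.totalDegree ≤ 3 ∧
            ∀ x ∈ hull (insert (W.center K) (insert (W.facePoint F) e)),
              ev x w i = eval x.ofLp p ∧ π.comp (evG x G) = polyD p x := by
        intro F hF e he
        have hT : insert (W.center K) (insert (W.facePoint F) e) ∈ W.split :=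
          WorseyFarin.mem_split.2 ⟨K, hK, F, hF, e, he, rfl⟩
        choose p hp hwp using hwV _ hT
        refine ⟨p i, hp i, fun x hx => ?_⟩
        have hxD := hull_subset_domain hT hx
        have e1 : ev x w = w ⟨x, hxD⟩ := evalAt_apply w ⟨x, hxD⟩
        have e2 : evG x G = G ⟨x, hxD⟩ := evalAt_apply G ⟨x, hxD⟩
        refine ⟨by rw [e1]; exact hwp i ⟨x, hxD⟩ hx, ?_⟩
        rw [e2, grad_eq hG hT (hnd _ hT) hwp ⟨x, hxD⟩ hx]
        rfl
      have hfin := hloc.unisolvent (fun x => ev x w i) (fun x => π.comp (evG x G)) hP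
        (fun v hv => by
          have := h0v v (mem_vertices.2 ⟨K, hK, hv⟩)
          simp [this.1, this.2])
        (fun a ha b hb hab => by
          have heK : {a, b} ∈ K.powersetCard 2 := pair_mem_powersetCard ha hb hab.symm
          have he : {a, b} ∈ edges 𝒯 := mem_simplices.2 ⟨K, hK, heK⟩
          obtain ⟨F, hF, haF, hbF⟩ := exists_face_of_pair hloc.nondeg.1 ha hb hab
          have hE := pair_mem_powersetCard haF hbF hab.symm
          obtain ⟨p, hp, hval⟩ := hP F hF _ hE
          have hsub : hull {a, b} ⊆ hull (insert (W.center K) (insert (W.facePoint F) {a, b})) :=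
            hull_mono ((Finset.subset_insert _ _).trans (Finset.subset_insert _ _))
          have ha' := subset_hull (s := {a, b}) (v := a) (by simp)
          have hb' := subset_hull (s := {a, b}) (v := b) (by simp)
          have hm' : midpoint ℝ a b = a + (1 / 2 : ℝ) • (b - a) := by
            rw [midpoint_eq_smul_add, invOf_eq_inv]; module
          -- the tangential derivative vanishes because a cubic on the edge with double zeros at
          -- both ends vanishes
          have htan : π.comp (evG (midpoint ℝ a b) G) (b - a) = 0 := by
            have hmh : midpoint ℝ a b ∈ hull {a, b} := by
              rw [hm']; exact mem_hull_segment ha' hb' (by norm_num) (by norm_num)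
            rw [(hval _ (hsub hmh)).2, hm']
            obtain ⟨α, β, γ, δ, hc⟩ := cubic_line hp a (b - a)
            have va := h0v a (mem_vertices.2 ⟨K, hK, ha⟩)
            have vb := h0v b (mem_vertices.2 ⟨K, hK, hb⟩)
            have pa := hval a (hsub ha')
            have pb := hval b (hsub hb')
            rw [va.1, va.2] at pa
            rw [vb.1, vb.2] at pb
            have c0 := hc 0
            have c1 := hc 1
            rw [zero_smul, add_zero, ← pa.1, ← pa.2] at c0
            rw [one_smul, add_sub_cancel, ← pb.1, ← pb.2] at c1
            rw [(hc (1 / 2)).2]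
            have c01 : (0 : ℝ) = α + β * 0 + γ * 0 ^ 2 + δ * 0 ^ 3 := by simpa using c0.1
            have c02 : (0 : ℝ) = β + 2 * γ * 0 + 3 * δ * 0 ^ 2 := by simpa using c0.2
            have c11 : (0 : ℝ) = α + β * 1 + γ * 1 ^ 2 + δ * 1 ^ 3 := by simpa using c1.1
            have c12 : (0 : ℝ) = β + 2 * γ * 1 + 3 * δ * 1 ^ 2 := by simpa using c1.2
            linarith
          refine hn ⟨_, he⟩ _ (fun x hx y hy => ?_) fun j => ?_
          · have hba : π.comp (evG (midpoint ℝ a b) G) (a - b) = 0 := by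
              rw [← neg_sub, map_neg, htan, neg_zero]
            simp only [Finset.mem_insert, Finset.mem_singleton] at hx hy
            rcases hx with rfl | rfl <;> rcases hy with rfl | rfl
            · rw [sub_self, map_zero]
            · exact htan
            · exact hba
            · rw [sub_self, map_zero]
          · have := h0e _ he j
            rw [hmid a b hab] at this
            simp [this])
      have := hfin F hF e he x.1 hx
      rw [show ev x.1 w = w x from evalAt_apply w x] at this
      simpa using this
    have hw : w = 0 := by ext1 x; exact hw0 x
    have hG0 : G = 0 := by
      ext1 x
      obtain ⟨T, hT, hx⟩ := Set.mem_iUnion₂.1 x.2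
      refine eq_on_hull hT (hnd T hT) G.continuous (0 : C(D, E3 →L[ℝ] E3)).continuous
        (fun x hx => ?_) x hx
      refine (hG x (interior_hull_subset hT hx)).unique ?_
      rw [show ((w, G) : C(D, E3) × C(D, E3 →L[ℝ] E3)).1 = 0 from hw, ext_zero]
      exact hasFDerivAt_const (0 : E3) x.1
    exact Subtype.ext (Prod.ext hw hG0)
  have hRfin : Module.Finite ℝ R := Module.Finite.of_injective _ hinj
  have h1 : Module.finrank ℝ R ≤ 12 * (vertices 𝒯).card + 6 * (edges 𝒯).card := by
    refine (LinearMap.finrank_le_finrank_of_injective hinj).trans ?_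
    rw [Module.finrank_pi_fintype]
    simp
    omega
  have hle : curlS W.split 3 ≤ R.map ((curlMap D).comp (LinearMap.snd ℝ _ _)) := by
    intro v hv
    obtain ⟨w, G, hwG, rfl⟩ := exists_gradPair hnd hv
    exact ⟨(w, G), hwG, rfl⟩
  exact (Submodule.finrank_mono hle).trans ((Submodule.finrank_map_le _ _).trans h1)

end TetMesh

namespace TetMesh

open MvPolynomial (eval pderiv)

/-! ### Hat functions and carriers -/

/-- Conformity in terms of barycentric coordinates: at a common point of two tetrahedra, the
coordinates with respect to both agree. -/
structure Conf (𝒮 : Finset (Finset E3)) : Prop where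
  nondeg : ∀ T ∈ 𝒮, Nondeg T
  bary_eq : ∀ T ∈ 𝒮, ∀ T' ∈ 𝒮, ∀ x ∈ hull T, x ∈ hull T' → ∀ v, bary T v x = bary T' v x

lemma IsTetMesh.conf {𝒯 : Finset (Finset E3)} (h : IsTetMesh 𝒯) : Conf 𝒯 where
  nondeg _ hK := h.nondeg hK
  bary_eq K hK L hL x hxK hxL v := by
    obtain ⟨w, -, h1, rfl⟩ := mem_hull.1 (h.conforming K hK L hL ⟨hxK, hxL⟩)
    rw [bary_comb (h.nondeg hK) Finset.inter_subset_left w h1,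
      bary_comb (h.nondeg hL) Finset.inter_subset_right w h1]

/-- The continuous piecewise linear hat function of the vertex `v`, and `0` outside the mesh. For a
conforming mesh the choice of the tetrahedron does not matter, see `Conf.hat_eq`. -/
noncomputable def hat (𝒮 : Finset (Finset E3)) (v x : E3) : ℝ :=
  if h : ∃ T ∈ 𝒮, x ∈ hull T then bary h.choose v x else 0

namespace Conf

variable {𝒮 : Finset (Finset E3)}

lemma hat_eq (h : Conf 𝒮) {T : Finset E3} (hT : T ∈ 𝒮) {x : E3} (hx : x ∈ hull T) (v : E3) :
    hat 𝒮 v x = bary T v x := by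
  have hex : ∃ T ∈ 𝒮, x ∈ hull T := ⟨T, hT, hx⟩
  rw [hat, dif_pos hex]
  exact h.bary_eq _ hex.choose_spec.1 T hT x hex.choose_spec.2 hx v

lemma hat_vertex (h : Conf 𝒮) (v : E3) {q : E3} (hq : q ∈ vertices 𝒮) :
    hat 𝒮 v q = if v = q then 1 else 0 := by
  obtain ⟨T, hT, hqT⟩ := mem_vertices.1 hq
  rw [h.hat_eq hT (subset_hull hqT), bary_vertex (h.nondeg T hT) v hqT]

lemma hat_midpoint (h : Conf 𝒮) (v : E3) {a b : E3} (hab : a ≠ b) (he : {a, b} ∈ edges 𝒮) :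
    hat 𝒮 v (midpoint ℝ a b) = if v ∈ ({a, b} : Finset E3) then 1 / 2 else 0 := by
  obtain ⟨T, hT, heT⟩ := mem_simplices.1 he
  have hsub := (Finset.mem_powersetCard.1 heT).1
  have hm : midpoint ℝ a b ∈ hull T := (convex_hull T).midpoint_mem
    (subset_hull (hsub (by simp))) (subset_hull (hsub (by simp)))
  have hw : ∑ q ∈ ({a, b} : Finset E3), (1 / 2 : ℝ) = 1 := by
    rw [Finset.sum_const, Finset.card_pair hab]; norm_num
  have hme : midpoint ℝ a b = ∑ q ∈ ({a, b} : Finset E3), (1 / 2 : ℝ) • q := by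
    rw [Finset.sum_pair hab, midpoint_eq_smul_add, invOf_eq_inv]; module
  rw [h.hat_eq hT hm, hme, bary_comb (h.nondeg T hT) hsub (fun _ => 1 / 2) hw]

lemma continuousOn_hat (h : Conf 𝒮) (v : E3) : ContinuousOn (hat 𝒮 v) (domain 𝒮) := by
  have : domain 𝒮 = ⋃ T : 𝒮, hull T.1 := by simp [domain, Set.iUnion_subtype]
  rw [this]
  refine (locallyFinite_of_finite _).continuousOn_iUnion (fun T => isClosed_hull _) fun T => ?_
  exact (continuous_bary T.1 v).continuousOn.congr fun x hx => h.hat_eq T.2 hx v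

end Conf

/-- The vertices of the smallest simplex of the mesh that contains `x`. -/
noncomputable def carrier (𝒮 : Finset (Finset E3)) (x : E3) : Finset E3 :=
  (vertices 𝒮).filter fun v => hat 𝒮 v x ≠ 0

namespace Conf

variable {𝒮 : Finset (Finset E3)}

lemma mem_carrier (h : Conf 𝒮) {T : Finset E3} (hT : T ∈ 𝒮) {x : E3} (hx : x ∈ hull T) {v : E3} :
    v ∈ carrier 𝒮 x ↔ v ∈ T ∧ 0 < bary T v x := by
  rw [carrier, Finset.mem_filter, h.hat_eq hT hx]
  constructor
  · rintro ⟨-, h2⟩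
    have hv : v ∈ T := by
      by_contra hv
      exact h2 (bary_of_notMem hv x)
    exact ⟨hv, lt_of_le_of_ne (bary_nonneg (h.nondeg T hT) hx v) (Ne.symm h2)⟩
  · rintro ⟨h1, h2⟩
    exact ⟨mem_vertices.2 ⟨T, hT, h1⟩, h2.ne'⟩

lemma carrier_subset (h : Conf 𝒮) {T : Finset E3} (hT : T ∈ 𝒮) {x : E3} (hx : x ∈ hull T) :
    carrier 𝒮 x ⊆ T := fun _ hv => ((h.mem_carrier hT hx).1 hv).1

lemma mem_hull_carrier (h : Conf 𝒮) {T : Finset E3} (hT : T ∈ 𝒮) {x : E3} (hx : x ∈ hull T) :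
    x ∈ hull (carrier 𝒮 x) := by
  refine mem_hull_of_bary_pos (h.nondeg T hT) (h.carrier_subset hT hx)
    (fun v hv => ((h.mem_carrier hT hx).1 hv).2.le) fun v hv hv' => ?_
  by_contra hne
  exact hv' ((h.mem_carrier hT hx).2
    ⟨hv, lt_of_le_of_ne (bary_nonneg (h.nondeg T hT) hx v) (Ne.symm hne)⟩)

/-- A convex combination of vertices of a simplex with positive weights has these vertices as
carrier. -/
lemma carrier_comb (h : Conf 𝒮) {T s : Finset E3} (hT : T ∈ 𝒮) (hs : s ⊆ T) {w : E3 → ℝ}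
    (hw : ∀ v ∈ s, 0 < w v) (h1 : ∑ v ∈ s, w v = 1) : carrier 𝒮 (∑ v ∈ s, w v • v) = s := by
  have hx : ∑ v ∈ s, w v • v ∈ hull T :=
    hull_mono hs (mem_hull.2 ⟨w, fun v hv => (hw v hv).le, h1, rfl⟩)
  ext v
  rw [h.mem_carrier hT hx, bary_comb (h.nondeg T hT) hs w h1]
  by_cases hv : v ∈ s
  · simp [hv, hs hv, hw v hv]
  · simp [hv]

lemma carrier_vertex (h : Conf 𝒮) {v : E3} (hv : v ∈ vertices 𝒮) : carrier 𝒮 v = {v} := by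
  obtain ⟨T, hT, hvT⟩ := mem_vertices.1 hv
  have := h.carrier_comb (s := {v}) hT (by simpa using hvT) (w := fun _ => 1) (by simp) (by simp)
  simpa using this

/-- The relative interiors of the simplices of a conforming mesh are disjoint from the simplices
that do not contain them. -/
lemma subset_of_comb_mem_hull (h : Conf 𝒮) {T T' s : Finset E3} (hT : T ∈ 𝒮) (hT' : T' ∈ 𝒮)
    (hs : s ⊆ T) {w : E3 → ℝ} (hw : ∀ v ∈ s, 0 < w v) (h1 : ∑ v ∈ s, w v = 1)
    (hx : ∑ v ∈ s, w v • v ∈ hull T') : s ⊆ T' := by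
  rw [← h.carrier_comb hT hs hw h1]
  exact h.carrier_subset hT' hx

/-! ### The dimension of the space of continuous quadratics -/

/-- The quadratic shape functions: the hat functions of the vertices and, for every edge, the
product of the hat functions of its ends. -/
noncomputable def shape (𝒮 : Finset (Finset E3)) : vertices 𝒮 ⊕ edges 𝒮 → E3 → ℝ :=
  Sum.elim (fun v x => hat 𝒮 v x) fun e x => ∏ v ∈ e.1, hat 𝒮 v x

lemma continuousOn_shape (h : Conf 𝒮) (j : vertices 𝒮 ⊕ edges 𝒮) :
    ContinuousOn (shape 𝒮 j) (domain 𝒮) := by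
  rcases j with v | e
  · exact h.continuousOn_hat v
  · exact continuousOn_finsetProd _ fun v _ => h.continuousOn_hat v

lemma shape_poly (h : Conf 𝒮) (j : vertices 𝒮 ⊕ edges 𝒮) {T : Finset E3} (hT : T ∈ 𝒮) :
    ∃ p : MvPolynomial (Fin 3) ℝ, p.totalDegree ≤ 2 ∧
      ∀ x ∈ hull T, shape 𝒮 j x = eval x.ofLp p := by
  have hb : ∀ v, ∃ p : MvPolynomial (Fin 3) ℝ, p.totalDegree ≤ 1 ∧
      ∀ x ∈ hull T, hat 𝒮 v x = eval x.ofLp p := fun v => by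
    obtain ⟨p, hp, hpe⟩ := exists_poly_of_affine (bary T v)
    exact ⟨p, hp, fun x hx => by rw [h.hat_eq hT hx, hpe]⟩
  rcases j with v | e
  · obtain ⟨p, hp, hpe⟩ := hb v
    exact ⟨p, hp.trans one_le_two, hpe⟩
  · choose p hp hpe using hb
    obtain ⟨K, -, he⟩ := mem_simplices.1 e.2
    refine ⟨∏ v ∈ e.1, p v, ?_, fun x hx => ?_⟩
    · refine (MvPolynomial.totalDegree_finsetProd _ _).trans ?_
      refine (Finset.sum_le_card_nsmul _ _ 1 fun v _ => hp v).trans ?_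
      rw [(Finset.mem_powersetCard.1 he).2]
      norm_num
    · rw [map_prod]
      exact Finset.prod_congr rfl fun v _ => hpe v x hx

/-- The field with given coefficients with respect to the quadratic shape functions. -/
noncomputable def interp (h : Conf 𝒮) : (vertices 𝒮 ⊕ edges 𝒮 → E3) →ₗ[ℝ] C(domain 𝒮, E3) where
  toFun c := ⟨fun x => ∑ j, shape 𝒮 j x • c j, continuous_finsetSum _ fun j _ =>
    (continuousOn_iff_continuous_domRestrict.1 (h.continuousOn_shape j)).smul continuous_const⟩
  map_add' c d := by ext1 x; simp [Finset.sum_add_distrib]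
  map_smul' r c := by ext1 x; simp [Finset.smul_sum, smul_comm r]

lemma interp_apply (h : Conf 𝒮) (c : vertices 𝒮 ⊕ edges 𝒮 → E3) (x : domain 𝒮) :
    h.interp c x = ∑ j, shape 𝒮 j x • c j := rfl

lemma interp_mem (h : Conf 𝒮) (c : vertices 𝒮 ⊕ edges 𝒮 → E3) : h.interp c ∈ V 𝒮 2 := by
  intro T hT i
  choose p hp hpe using fun j => h.shape_poly j hT
  refine ⟨∑ j, MvPolynomial.C (c j i) * p j, ?_, fun x hx => ?_⟩
  · refine MvPolynomial.totalDegree_finsetSum_le fun j _ => ?_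
    rw [← MvPolynomial.smul_eq_C_mul]
    exact (MvPolynomial.totalDegree_smul_le _ _).trans (hp j)
  · rw [interp_apply, map_sum]
    simp only [WithLp.ofLp_sum, Finset.sum_apply]
    refine Finset.sum_congr rfl fun j _ => ?_
    rw [map_mul, MvPolynomial.eval_C, ← hpe j x hx]
    simp [mul_comm]

/-- The coefficients can be read off the values at the vertices and then at the midpoints of the edges. -/
lemma interp_injective (h : Conf 𝒮) : Function.Injective h.interp := by
  rw [injective_iff_map_eq_zero]
  intro c hc
  have hval : ∀ x ∈ domain 𝒮, ∑ v, hat 𝒮 v.1 x • c (Sum.inl v) +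
      ∑ e, (∏ v ∈ e.1, hat 𝒮 v x) • c (Sum.inr e) = 0 := fun x hx => by
    have := congrArg (fun f : C(domain 𝒮, E3) => f ⟨x, hx⟩) hc
    simpa [interp_apply, shape] using this
  have hvert : ∀ v, c (Sum.inl v) = 0 := by
    intro v
    obtain ⟨T, hT, hvT⟩ := mem_vertices.1 v.2
    have := hval v.1 (hull_subset_domain hT (subset_hull hvT))
    rw [Finset.sum_eq_single_of_mem v (Finset.mem_univ _) fun u _ hu => by
        rw [h.hat_vertex _ v.2, if_neg (fun he => hu (Subtype.ext he)), zero_smul],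
      Finset.sum_eq_zero fun e _ => ?_, add_zero, h.hat_vertex _ v.2, if_pos rfl, one_smul] at this
    · exact this
    · -- one of the two ends of an edge differs from `v`
      obtain ⟨K, -, he⟩ := mem_simplices.1 e.2
      obtain ⟨u, hu, huv⟩ := Finset.exists_mem_ne (s := e.1)
        (by rw [(Finset.mem_powersetCard.1 he).2]; norm_num) v.1
      rw [Finset.prod_eq_zero hu (by rw [h.hat_vertex _ v.2, if_neg huv]), zero_smul]
  have hedge : ∀ e, c (Sum.inr e) = 0 := by
    rintro ⟨e, he⟩
    obtain ⟨T, hT, heT⟩ := mem_simplices.1 he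
    obtain ⟨a, ha, b, hb, hba, rfl⟩ := exists_pair_of_mem_powersetCard heT
    have := hval (midpoint ℝ a b) (hull_subset_domain hT ((convex_hull T).midpoint_mem
      (subset_hull ha) (subset_hull hb)))
    simp only [hvert, smul_zero, Finset.sum_const_zero, zero_add] at this
    rw [Finset.sum_eq_single_of_mem ⟨{a, b}, he⟩ (Finset.mem_univ _) fun e' _ he' => ?_] at this
    · refine (smul_eq_zero.1 this).resolve_left (Finset.prod_ne_zero_iff.2 fun v hv => ?_)
      rw [h.hat_midpoint v hba.symm he, if_pos hv]; norm_num
    · obtain ⟨K, -, heK⟩ := mem_simplices.1 e'.2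
      obtain ⟨u, hu, hue⟩ : ∃ u ∈ e'.1, u ∉ ({a, b} : Finset E3) := by
        by_contra! hcon
        refine he' (Subtype.ext (Finset.eq_of_subset_of_card_le hcon ?_))
        rw [(Finset.mem_powersetCard.1 heK).2, Finset.card_pair hba.symm]
      rw [Finset.prod_eq_zero hu (by rw [h.hat_midpoint u hba.symm he, if_neg hue]), zero_smul]
  funext j
  rcases j with v | e
  exacts [hvert v, hedge e]

/-- The quadratic shape functions are linearly independent. -/
lemma le_finrank_V (h : Conf 𝒮) :
    3 * ((vertices 𝒮).card + (edges 𝒮).card) ≤ Module.finrank ℝ (V 𝒮 2) := by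
  have := finiteDimensional_V 𝒮 2
  have hinj : Function.Injective (h.interp.codRestrict (V 𝒮 2) h.interp_mem) :=
    fun c d hcd => h.interp_injective (congrArg Subtype.val hcd)
  have := LinearMap.finrank_le_finrank_of_injective hinj
  rw [Module.finrank_pi_fintype] at this
  simp at this
  omega

end Conf

/-! ### Conformity of the split -/

/-- The coordinates with respect to a tetrahedron in terms of those with respect to a subtetrahedron. -/
lemma LocalSplit.bary_split {K : Finset E3} {z : E3} {m : Finset E3 → E3} (h : LocalSplit K z m)
    {F e : Finset E3} (hF : F ∈ K.powersetCard 3) (he : e ∈ F.powersetCard 2) (v x : E3) :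
    bary K v x = bary (insert z (insert (m F) e)) z x * bary K v z +
      bary (insert z (insert (m F) e)) (m F) x * bary K v (m F) +
      if v ∈ e then bary (insert z (insert (m F) e)) v x else 0 := by
  have hFK := (Finset.mem_powersetCard.1 hF).1
  have heF := (Finset.mem_powersetCard.1 he).1
  rw [affine_eq_sum_bary (h.nondeg_split hF he) (bary K v) x, Finset.sum_insert,
    Finset.sum_insert, ← add_assoc]
  · congr 1
    rw [Finset.sum_congr rfl fun q hq => by
      rw [bary_vertex h.nondeg v (hFK (heF hq)), smul_eq_mul, mul_ite, mul_one, mul_zero],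
      Finset.sum_ite_eq]
  · exact fun hm => h.facePoint_notMem hF (hFK (heF hm))
  · rw [Finset.mem_insert, not_or]
    exact ⟨h.center_ne_facePoint hF, fun hz => h.center_notMem (hFK (heF hz))⟩

/-- The coordinate of an arbitrary point `p` with respect to a subtetrahedron, where `p` may be the
interior point, the face point, an old vertex or none of them. -/
lemma LocalSplit.bary_split_apply {K : Finset E3} {z : E3} {m : Finset E3 → E3}
    (h : LocalSplit K z m) {F e : Finset E3} (hF : F ∈ K.powersetCard 3)
    (he : e ∈ F.powersetCard 2) (p x : E3) :
    bary (insert z (insert (m F) e)) p x =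
      (if p = z then bary (insert z (insert (m F) e)) z x else 0) +
      (if p = m F then bary (insert z (insert (m F) e)) (m F) x else 0) +
      if p ∈ e then bary (insert z (insert (m F) e)) p x else 0 := by
  have hFK := (Finset.mem_powersetCard.1 hF).1
  have heF := (Finset.mem_powersetCard.1 he).1
  have h1 := h.center_ne_facePoint hF
  have h2 : z ∉ e := fun hz => h.center_notMem (hFK (heF hz))
  have h3 : m F ∉ e := fun hm => h.facePoint_notMem hF (hFK (heF hm))
  by_cases hpz : p = z
  · subst hpz; simp [h1, h2]
  · by_cases hpm : p = m F
    · subst hpm; simp [h1.symm, h3]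
    · by_cases hpe : p ∈ e
      · simp [hpz, hpm, hpe]
      · simp only [hpz, hpm, hpe, if_false, add_zero]
        exact bary_of_notMem (by simp [hpz, hpm, hpe]) x

lemma LocalSplit.split_subset_hull {K : Finset E3} {z : E3} {m : Finset E3 → E3}
    (h : LocalSplit K z m) {F e : Finset E3} (hF : F ∈ K.powersetCard 3)
    (he : e ∈ F.powersetCard 2) : hull (insert z (insert (m F) e)) ⊆ hull K := by
  refine convexHull_min ?_ (convex_hull K)
  intro x hx
  simp only [Finset.coe_insert, Set.mem_insert_iff, Finset.mem_coe] at hx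
  rcases hx with rfl | rfl | hx
  · exact (mem_hull_iff_bary h.nondeg).2 fun v hv => (h.center_pos v hv).le
  · refine (mem_hull_iff_bary h.nondeg).2 fun v hv => ?_
    by_cases hvF : v ∈ F
    · exact (h.face_pos F hF v hvF).le
    · exact (h.face_zero F hF v hvF).ge
  · exact subset_hull ((Finset.mem_powersetCard.1 hF).1 ((Finset.mem_powersetCard.1 he).1 hx))

/-- Two numbers that are both the smallest ratio of the same quantities are equal. -/
lemma eq_of_min_ratio {s : Finset E3} {α β : E3 → ℝ} {t t' : ℝ} (hβ : ∀ v ∈ s, 0 < β v)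
    (h : ∀ v ∈ s, t * β v ≤ α v) (h' : ∀ v ∈ s, t' * β v ≤ α v)
    (he : ∃ v ∈ s, α v = t * β v) (he' : ∃ v ∈ s, α v = t' * β v) : t = t' := by
  obtain ⟨u, hu, hu'⟩ := he
  obtain ⟨u', hu1, hu1'⟩ := he'
  refine le_antisymm ?_ ?_
  · have := h u' hu1
    rw [hu1'] at this
    exact le_of_mul_le_mul_right this (hβ u' hu1)
  · have := h' u hu
    rw [hu'] at this
    exact le_of_mul_le_mul_right this (hβ u hu)

/-- The Worsey–Farin split of a conforming mesh is conforming. The coordinate of the interior point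
of `K` is the smallest ratio of the coordinates with respect to `K` of the given point and of the
interior point. After subtracting its contribution, the coordinate of a face point is found in the
same way, and the rest are the coordinates of the original vertices. Hence all coordinates are
determined by the point. -/
lemma WorseyFarin.conf_split {𝒯 : Finset (Finset E3)} (h𝒯 : IsTetMesh 𝒯) (W : WorseyFarin 𝒯) :
    Conf W.split where
  nondeg := W.nondeg_split h𝒯
  bary_eq := by
    intro T hT T' hT' x hx hx' p
    obtain ⟨K, hK, F, hF, e, he, rfl⟩ := WorseyFarin.mem_split.1 hT
    obtain ⟨K', hK', F', hF', e', he', rfl⟩ := WorseyFarin.mem_split.1 hT'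
    have hl := W.localSplit h𝒯 hK
    have hl' := W.localSplit h𝒯 hK'
    obtain ⟨hFK, hFc⟩ := Finset.mem_powersetCard.1 hF
    obtain ⟨hFK', hFc'⟩ := Finset.mem_powersetCard.1 hF'
    obtain ⟨heF, hec⟩ := Finset.mem_powersetCard.1 he
    obtain ⟨heF', hec'⟩ := Finset.mem_powersetCard.1 he'
    have hb := hl.bary_split hF he
    have hb' := hl'.bary_split hF' he'
    have hnn := bary_nonneg (hl.nondeg_split hF he) hx
    have hnn' := bary_nonneg (hl'.nondeg_split hF' he') hx'
    rw [hl.bary_split_apply hF he p x, hl'.bary_split_apply hF' he' p x]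
    set T := insert (W.center K) (insert (W.facePoint F) e) with hTdef
    set T' := insert (W.center K') (insert (W.facePoint F') e') with hTdef'
    have hxK := hl.split_subset_hull hF he hx
    have hxK' := hl'.split_subset_hull hF' he' hx'
    have hKK : ∀ v, bary K v x = bary K' v x := h𝒯.conf.bary_eq K hK K' hK' x hxK hxK'
    -- the coordinates of the interior points
    have hmf : ∀ v, 0 ≤ bary K v (W.facePoint F) := bary_nonneg hl.nondeg
      (hl.split_subset_hull hF he (subset_hull (by simp)))
    have hmf' : ∀ v, 0 ≤ bary K' v (W.facePoint F') := bary_nonneg hl'.nondeg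
      (hl'.split_subset_hull hF' he' (subset_hull (by simp)))
    have hge : ∀ v, bary T (W.center K) x * bary K v (W.center K) +
        bary T (W.facePoint F) x * bary K v (W.facePoint F) ≤ bary K v x := fun v => by
      rw [hb v x]
      have : 0 ≤ if v ∈ e then bary T v x else 0 := by split_ifs; exacts [hnn v, le_rfl]
      linarith
    have hge' : ∀ v, bary T' (W.center K') x * bary K' v (W.center K') +
        bary T' (W.facePoint F') x * bary K' v (W.facePoint F') ≤ bary K' v x := fun v => by
      rw [hb' v x]
      have : 0 ≤ if v ∈ e' then bary T' v x else 0 := by split_ifs; exacts [hnn' v, le_rfl]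
      linarith
    have hge1 : ∀ v, bary T (W.center K) x * bary K v (W.center K) ≤ bary K v x := fun v => by
      have := mul_nonneg (hnn (W.facePoint F)) (hmf v)
      linarith [hge v]
    have hge1' : ∀ v, bary T' (W.center K') x * bary K' v (W.center K') ≤ bary K' v x := fun v => by
      have := mul_nonneg (hnn' (W.facePoint F')) (hmf' v)
      linarith [hge' v]
    have hs : (K = K' ∧ bary T (W.center K) x = bary T' (W.center K') x) ∨
        (bary T (W.center K) x = 0 ∧ bary T' (W.center K') x = 0) := by
      by_cases hKeq : K = K'
      · left
        refine ⟨hKeq, ?_⟩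
        subst hKeq
        obtain ⟨u, hu, hKu⟩ := exists_eq_insert_of_card_succ hFK (by rw [hl.nondeg.1, hFc])
        obtain ⟨u', hu', hKu'⟩ := exists_eq_insert_of_card_succ hFK' (by rw [hl'.nondeg.1, hFc'])
        refine eq_of_min_ratio (s := K) (α := fun v => bary K v x)
          (β := fun v => bary K v (W.center K)) hl.center_pos (fun v _ => hge1 v) (fun v _ => ?_)
          ⟨u, by rw [hKu]; simp, ?_⟩ ⟨u', by rw [hKu']; simp, ?_⟩
        · exact hge1' v
        · rw [hb u x, hl.face_zero F hF u hu, if_neg fun h => hu (heF h)]; ring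
        · rw [hb' u' x, hl'.face_zero F' hF' u' hu', if_neg fun h => hu' (heF' h)]; ring
      · right
        have aux : ∀ K K' : Finset E3, K.card = 4 → K'.card = 4 → K ≠ K' → ∃ v ∈ K, v ∉ K' := by
          intro K K' h4 h4' hne
          by_contra! hcon
          exact hne (Finset.eq_of_subset_of_card_le hcon (by rw [h4, h4']))
        constructor
        · obtain ⟨v, hv, hv'⟩ := aux K K' hl.nondeg.1 hl'.nondeg.1 hKeq
          have := hge1 v
          rw [hKK, bary_of_notMem hv'] at this
          exact le_antisymm (by
            by_contra! hpos
            exact absurd (mul_pos hpos (hl.center_pos v hv)) (not_lt.2 this)) (hnn _)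
        · obtain ⟨v, hv, hv'⟩ := aux K' K hl'.nondeg.1 hl.nondeg.1 (Ne.symm hKeq)
          have := hge1' v
          rw [← hKK, bary_of_notMem hv'] at this
          exact le_antisymm (by
            by_contra! hpos
            exact absurd (mul_pos hpos (hl'.center_pos v hv)) (not_lt.2 this)) (hnn' _)
    -- what is left after subtracting the contribution of the interior points
    have hA : ∀ v, bary T (W.facePoint F) x * bary K v (W.facePoint F) +
        (if v ∈ e then bary T v x else 0) =
        bary T' (W.facePoint F') x * bary K' v (W.facePoint F') +
        if v ∈ e' then bary T' v x else 0 := by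
      intro v
      have h1 := hb v x
      have h2 := hb' v x
      have h3 := hKK v
      rcases hs with ⟨rfl, h4⟩ | ⟨h4, h5⟩
      · rw [h4] at h1; linarith
      · rw [h4] at h1; rw [h5] at h2; linarith
    have hFge : ∀ v, 0 ≤ if v ∈ e then bary T v x else 0 := fun v => by
      split_ifs; exacts [hnn v, le_rfl]
    have hFge' : ∀ v, 0 ≤ if v ∈ e' then bary T' v x else 0 := fun v => by
      split_ifs; exacts [hnn' v, le_rfl]
    -- the coordinates of the face points
    have ht : (F = F' ∧ bary T (W.facePoint F) x = bary T' (W.facePoint F') x) ∨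
        (bary T (W.facePoint F) x = 0 ∧ bary T' (W.facePoint F') x = 0) := by
      by_cases hFeq : F = F'
      · left
        refine ⟨hFeq, ?_⟩
        subst hFeq
        have hmm : ∀ v, bary K v (W.facePoint F) = bary K' v (W.facePoint F) :=
          h𝒯.conf.bary_eq K hK K' hK' _ (hl.split_subset_hull hF he (subset_hull (by simp)))
            (hl'.split_subset_hull hF' he' (subset_hull (by simp)))
        obtain ⟨r, hr, hFr⟩ := exists_eq_insert_of_card_succ heF (by rw [hFc, hec])
        obtain ⟨r', hr', hFr'⟩ := exists_eq_insert_of_card_succ heF' (by rw [hFc, hec'])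
        refine eq_of_min_ratio (s := F) (α := fun v => bary T (W.facePoint F) x *
            bary K v (W.facePoint F) + if v ∈ e then bary T v x else 0)
          (β := fun v => bary K v (W.facePoint F)) (hl.face_pos F hF)
          (fun v _ => by linarith [hFge v]) (fun v _ => ?_)
          ⟨r, by rw [hFr]; simp, by simp [hr]⟩ ⟨r', by rw [hFr']; simp, ?_⟩
        · rw [hA, hmm]; linarith [hFge' v]
        · rw [hA, hmm, if_neg hr', add_zero]
      · right
        have aux : ∀ F F' : Finset E3, F.card = 3 → F'.card = 3 → F ≠ F' → ∃ v ∈ F, v ∉ F' := by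
          intro K K' h4 h4' hne
          by_contra! hcon
          exact hne (Finset.eq_of_subset_of_card_le hcon (by rw [h4, h4']))
        constructor
        · obtain ⟨v, hv, hv'⟩ := aux F F' hFc hFc' hFeq
          have := hA v
          rw [hl'.face_zero F' hF' v hv', if_neg fun h => hv' (heF' h)] at this
          exact le_antisymm (by
            by_contra! hpos
            linarith [mul_pos hpos (hl.face_pos F hF v hv), hFge v]) (hnn _)
        · obtain ⟨v, hv, hv'⟩ := aux F' F hFc' hFc (Ne.symm hFeq)
          have := hA v
          rw [hl.face_zero F hF v hv', if_neg fun h => hv' (heF h)] at this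
          exact le_antisymm (by
            by_contra! hpos
            linarith [mul_pos hpos (hl'.face_pos F' hF' v hv), hFge' v]) (hnn' _)
    have he3 : (if p ∈ e then bary T p x else 0) = if p ∈ e' then bary T' p x else 0 := by
      have := hA p
      rcases ht with ⟨rfl, h4⟩ | ⟨h4, h5⟩
      · have hmm := h𝒯.conf.bary_eq K hK K' hK' (W.facePoint F)
          (hl.split_subset_hull hF he (subset_hull (by simp)))
          (hl'.split_subset_hull hF' he' (subset_hull (by simp))) p
        rw [h4, hmm] at this
        linarith
      · rw [h4, h5] at this; linarith
    rw [he3]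
    congr 2
    · rcases hs with ⟨rfl, h4⟩ | ⟨h4, h5⟩
      · rw [h4]
      · rw [h4, h5]; simp
    · rcases ht with ⟨rfl, h4⟩ | ⟨h4, h5⟩
      · rw [h4]
      · rw [h4, h5]; simp

end TetMesh

namespace TetMesh

open MvPolynomial (eval pderiv)

/-! ### Counting the vertices and edges of the split -/

section Count

variable {𝒯 : Finset (Finset E3)}

lemma carrier_center (h𝒯 : IsTetMesh 𝒯) (W : WorseyFarin 𝒯) {K : Finset E3} (hK : K ∈ 𝒯) :
    carrier 𝒯 (W.center K) = K := by
  have hl := W.localSplit h𝒯 hK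
  conv_lhs => rw [← sum_bary_smul hl.nondeg (W.center K)]
  exact h𝒯.conf.carrier_comb hK subset_rfl hl.center_pos (sum_bary hl.nondeg _)

lemma carrier_facePoint (h𝒯 : IsTetMesh 𝒯) (W : WorseyFarin 𝒯) {F : Finset E3}
    (hF : F ∈ faces 𝒯) : carrier 𝒯 (W.facePoint F) = F := by
  obtain ⟨K, hK, hFK⟩ := mem_simplices.1 hF
  have hl := W.localSplit h𝒯 hK
  conv_lhs => rw [← hl.sum_smul_face hFK]
  exact h𝒯.conf.carrier_comb hK (Finset.mem_powersetCard.1 hFK).1 (hl.face_pos F hFK)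
    (hl.sum_face hFK)

lemma card_of_mem_simplices {k : ℕ} {s : Finset E3} (hs : s ∈ simplices 𝒯 k) : s.card = k := by
  obtain ⟨K, -, hsK⟩ := mem_simplices.1 hs
  exact (Finset.mem_powersetCard.1 hsK).2

lemma mem_vertices_of_mem_simplex {k : ℕ} {s : Finset E3} (hs : s ∈ simplices 𝒯 k) {v : E3}
    (hv : v ∈ s) : v ∈ vertices 𝒯 := by
  obtain ⟨K, hK, hsK⟩ := mem_simplices.1 hs
  exact mem_vertices.2 ⟨K, hK, (Finset.mem_powersetCard.1 hsK).1 hv⟩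

lemma exists_pair_containing {F : Finset E3} (hF : F.card = 3) {v : E3} (hv : v ∈ F) :
    ∃ e ∈ F.powersetCard 2, v ∈ e := by
  obtain ⟨b, hb, hbv⟩ := Finset.exists_mem_ne (s := F) (by rw [hF]; norm_num) v
  exact ⟨{v, b}, pair_mem_powersetCard hv hb hbv, by simp⟩

lemma exists_face_containing {K : Finset E3} (hK : K.card = 4) {v : E3} (hv : v ∈ K) :
    ∃ F ∈ K.powersetCard 3, v ∈ F := by
  obtain ⟨b, hb, hbv⟩ := Finset.exists_mem_ne (s := K) (by rw [hK]; norm_num) v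
  obtain ⟨F, hF, hvF, -⟩ := exists_face_of_pair hK hv hb hbv.symm
  exact ⟨F, hF, hvF⟩

/-- The old vertices, the face points and the interior points are distinguished by the sizes of their
carriers. -/
lemma card_vertices_split (h𝒯 : IsTetMesh 𝒯) (W : WorseyFarin 𝒯) :
    (vertices 𝒯).card + (faces 𝒯).card + 𝒯.card ≤ (vertices W.split).card := by
  have hc := h𝒯.conf
  have c1 : ∀ v ∈ vertices 𝒯, (carrier 𝒯 v).card = 1 := fun v hv => by
    rw [hc.carrier_vertex hv, Finset.card_singleton]
  have c2 : ∀ v ∈ (faces 𝒯).image W.facePoint, (carrier 𝒯 v).card = 3 := fun v hv => by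
    obtain ⟨F, hF, rfl⟩ := Finset.mem_image.1 hv
    rw [carrier_facePoint h𝒯 W hF, card_of_mem_simplices hF]
  have c3 : ∀ v ∈ 𝒯.image W.center, (carrier 𝒯 v).card = 4 := fun v hv => by
    obtain ⟨K, hK, rfl⟩ := Finset.mem_image.1 hv
    rw [carrier_center h𝒯 W hK, h𝒯.card_eq K hK]
  have i2 : ((faces 𝒯).image W.facePoint).card = (faces 𝒯).card :=
    Finset.card_image_of_injOn fun F hF F' hF' h => by
      rw [← carrier_facePoint h𝒯 W hF, ← carrier_facePoint h𝒯 W hF', h]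
  have i3 : (𝒯.image W.center).card = 𝒯.card :=
    Finset.card_image_of_injOn fun K hK K' hK' h => by
      rw [← carrier_center h𝒯 W hK, ← carrier_center h𝒯 W hK', h]
  have d1 : Disjoint (vertices 𝒯) ((faces 𝒯).image W.facePoint) :=
    Finset.disjoint_left.2 fun v h1 h2 => by have := c1 v h1; have := c2 v h2; omega
  have d2 : Disjoint (vertices 𝒯 ∪ (faces 𝒯).image W.facePoint) (𝒯.image W.center) :=
    Finset.disjoint_left.2 fun v h1 h2 => by
      have h3 := c3 v h2
      rcases Finset.mem_union.1 h1 with h1 | h1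
      · have := c1 v h1; omega
      · have := c2 v h1; omega
  rw [← i2, ← i3, ← Finset.card_union_of_disjoint d1, ← Finset.card_union_of_disjoint d2]
  refine Finset.card_le_card ?_
  have hmem : ∀ K ∈ 𝒯, ∀ F ∈ K.powersetCard 3, ∀ e ∈ F.powersetCard 2,
      ∀ v ∈ insert (W.center K) (insert (W.facePoint F) e), v ∈ vertices W.split :=
    fun K hK F hF e he v hv =>
      mem_vertices.2 ⟨_, WorseyFarin.mem_split.2 ⟨K, hK, F, hF, e, he, rfl⟩, hv⟩
  have hne : ∀ F : Finset E3, F.card = 3 → ∃ e, e ∈ F.powersetCard 2 := fun F hF =>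
    Finset.powersetCard_nonempty.2 (by omega)
  intro v hv
  simp only [Finset.mem_union, Finset.mem_image] at hv
  rcases hv with (hv | ⟨F, hF, rfl⟩) | ⟨K, hK, rfl⟩
  · obtain ⟨K, hK, hvK⟩ := mem_vertices.1 hv
    obtain ⟨F, hF, hvF⟩ := exists_face_containing (h𝒯.card_eq K hK) hvK
    obtain ⟨e, he, hve⟩ := exists_pair_containing (Finset.mem_powersetCard.1 hF).2 hvF
    exact hmem K hK F hF e he v (by simp [hve])
  · obtain ⟨K, hK, hFK⟩ := mem_simplices.1 hF
    obtain ⟨e, he⟩ := hne F (card_of_mem_simplices hF)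
    exact hmem K hK F hFK e he _ (by simp)
  · obtain ⟨F, hF⟩ : (K.powersetCard 3).Nonempty :=
      Finset.powersetCard_nonempty.2 (by rw [h𝒯.card_eq K hK]; norm_num)
    obtain ⟨e, he⟩ := hne F (Finset.mem_powersetCard.1 hF).2
    exact hmem K hK F hF e he _ (by simp)

/-- The old edges, the edges from face points and from interior points to the old vertices, and the
edges from the interior points to the face points are distinguished by the sum of the sizes of the
carriers of their ends. -/
lemma card_edges_split (h𝒯 : IsTetMesh 𝒯) (W : WorseyFarin 𝒯) :
    (edges 𝒯).card + 3 * (faces 𝒯).card + 8 * 𝒯.card ≤ (edges W.split).card := by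
  have hc := h𝒯.conf
  let S2 := (faces 𝒯).sigma fun F => F
  let S3 := 𝒯.sigma fun K => K
  let S4 := 𝒯.sigma fun K => K.powersetCard 3
  let f2 : (Σ _ : Finset E3, E3) → Finset E3 := fun q => {W.facePoint q.1, q.2}
  let f3 : (Σ _ : Finset E3, E3) → Finset E3 := fun q => {W.center q.1, q.2}
  let f4 : (Σ _ : Finset E3, Finset E3) → Finset E3 := fun q => {W.center q.1, W.facePoint q.2}
  let ν : Finset E3 → ℕ := fun e => ∑ p ∈ e, (carrier 𝒯 p).card
  have k1 : ∀ v ∈ vertices 𝒯, (carrier 𝒯 v).card = 1 := fun v hv => by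
    rw [hc.carrier_vertex hv, Finset.card_singleton]
  have k2 : ∀ F ∈ faces 𝒯, (carrier 𝒯 (W.facePoint F)).card = 3 := fun F hF => by
    rw [carrier_facePoint h𝒯 W hF, card_of_mem_simplices hF]
  have k3 : ∀ K ∈ 𝒯, (carrier 𝒯 (W.center K)).card = 4 := fun K hK => by
    rw [carrier_center h𝒯 W hK, h𝒯.card_eq K hK]
  have hpair : ∀ p q i j, (carrier 𝒯 p).card = i → (carrier 𝒯 q).card = j → i ≠ j →
      ν {p, q} = i + j := fun p q i j hp hq hij => by
    simp only [ν]
    rw [Finset.sum_pair (by rintro rfl; exact hij (hp.symm.trans hq)), hp, hq]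
  have hinj : ∀ p q p' q' : E3, (carrier 𝒯 p).card ≠ (carrier 𝒯 q').card →
      ({p, q} : Finset E3) = {p', q'} → p = p' ∧ q = q' := by
    intro p q p' q' h1 h2
    have hp : p ∈ ({p', q'} : Finset E3) := h2 ▸ by simp
    have hpp : p = p' := by
      rcases Finset.mem_insert.1 hp with h | h
      · exact h
      · exact absurd (by rw [Finset.mem_singleton.1 h]) h1
    subst hpp
    have hq' : q' ∈ ({p, q} : Finset E3) := h2 ▸ by simp
    refine ⟨rfl, ?_⟩
    rcases Finset.mem_insert.1 hq' with h | h
    · exact absurd (by rw [h]) h1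
    · exact (Finset.mem_singleton.1 h).symm
  have hS2 : ∀ q ∈ S2, q.1 ∈ faces 𝒯 ∧ q.2 ∈ q.1 ∧ q.2 ∈ vertices 𝒯 := fun q hq => by
    obtain ⟨h1, h2⟩ := Finset.mem_sigma.1 hq
    exact ⟨h1, h2, mem_vertices_of_mem_simplex h1 h2⟩
  have hS3 : ∀ q ∈ S3, q.1 ∈ 𝒯 ∧ q.2 ∈ q.1 ∧ q.2 ∈ vertices 𝒯 := fun q hq => by
    obtain ⟨h1, h2⟩ := Finset.mem_sigma.1 hq
    exact ⟨h1, h2, mem_vertices.2 ⟨_, h1, h2⟩⟩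
  have hS4 : ∀ q ∈ S4, q.1 ∈ 𝒯 ∧ q.2 ∈ q.1.powersetCard 3 ∧ q.2 ∈ faces 𝒯 := fun q hq => by
    obtain ⟨h1, h2⟩ := Finset.mem_sigma.1 hq
    exact ⟨h1, h2, mem_simplices.2 ⟨_, h1, h2⟩⟩
  have n1 : ∀ e ∈ edges 𝒯, ν e = 2 := fun e he => by
    simp only [ν]
    rw [Finset.sum_congr rfl fun v hv => k1 v (mem_vertices_of_mem_simplex he hv)]
    simp [card_of_mem_simplices he]
  have n2 : ∀ e ∈ S2.image f2, ν e = 4 := fun e he => by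
    obtain ⟨q, hq, rfl⟩ := Finset.mem_image.1 he
    exact hpair _ _ 3 1 (k2 _ (hS2 q hq).1) (k1 _ (hS2 q hq).2.2) (by norm_num)
  have n3 : ∀ e ∈ S3.image f3, ν e = 5 := fun e he => by
    obtain ⟨q, hq, rfl⟩ := Finset.mem_image.1 he
    exact hpair _ _ 4 1 (k3 _ (hS3 q hq).1) (k1 _ (hS3 q hq).2.2) (by norm_num)
  have n4 : ∀ e ∈ S4.image f4, ν e = 7 := fun e he => by
    obtain ⟨q, hq, rfl⟩ := Finset.mem_image.1 he
    exact hpair _ _ 4 3 (k3 _ (hS4 q hq).1) (k2 _ (hS4 q hq).2.2) (by norm_num)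
  have i2 : (S2.image f2).card = 3 * (faces 𝒯).card := by
    rw [Finset.card_image_of_injOn, Finset.card_sigma,
      Finset.sum_congr rfl fun F (hF : F ∈ faces 𝒯) =>
        (card_of_mem_simplices hF : F.card = 3)]
    · simp [mul_comm]
    · rintro ⟨F, v⟩ hq ⟨F', v'⟩ hq' h
      have h1 := hS2 _ hq
      have h2 := hS2 _ hq'
      dsimp only at h1 h2
      obtain ⟨h3, h4⟩ := hinj _ _ _ _ (by rw [k2 _ h1.1, k1 _ h2.2.2]; norm_num) h
      obtain rfl : F = F' := by
        rw [← carrier_facePoint h𝒯 W h1.1, ← carrier_facePoint h𝒯 W h2.1]; exact congrArg _ h3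
      simp only at h4
      rw [h4]
  have i3 : (S3.image f3).card = 4 * 𝒯.card := by
    rw [Finset.card_image_of_injOn, Finset.card_sigma,
      Finset.sum_congr rfl fun K hK => h𝒯.card_eq K hK]
    · simp [mul_comm]
    · rintro ⟨F, v⟩ hq ⟨F', v'⟩ hq' h
      have h1 := hS3 _ hq
      have h2 := hS3 _ hq'
      dsimp only at h1 h2
      obtain ⟨h3, h4⟩ := hinj _ _ _ _ (by rw [k3 _ h1.1, k1 _ h2.2.2]; norm_num) h
      obtain rfl : F = F' := by
        rw [← carrier_center h𝒯 W h1.1, ← carrier_center h𝒯 W h2.1]; exact congrArg _ h3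
      simp only at h4
      rw [h4]
  have i4 : (S4.image f4).card = 4 * 𝒯.card := by
    rw [Finset.card_image_of_injOn, Finset.card_sigma,
      Finset.sum_congr rfl fun K hK => by rw [Finset.card_powersetCard, h𝒯.card_eq K hK]]
    · simp [mul_comm, Nat.choose]
    · rintro ⟨F, v⟩ hq ⟨F', v'⟩ hq' h
      have h1 := hS4 _ hq
      have h2 := hS4 _ hq'
      dsimp only at h1 h2
      obtain ⟨h3, h4⟩ := hinj _ _ _ _ (by rw [k3 _ h1.1, k2 _ h2.2.2]; norm_num) h
      obtain rfl : F = F' := by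
        rw [← carrier_center h𝒯 W h1.1, ← carrier_center h𝒯 W h2.1]; exact congrArg _ h3
      obtain rfl : v = v' := by
        rw [← carrier_facePoint h𝒯 W h1.2.2, ← carrier_facePoint h𝒯 W h2.2.2]
        exact congrArg _ h4
      rfl
  have hdisj : ∀ A B : Finset (Finset E3), (∀ e ∈ A, e ∉ B) → Disjoint A B :=
    fun A B h => Finset.disjoint_left.2 h
  have d1 : Disjoint (edges 𝒯) (S2.image f2) := hdisj _ _ fun e h1 h2 => by
    have := n1 e h1; have := n2 e h2; omega
  have d2 : Disjoint (edges 𝒯 ∪ S2.image f2) (S3.image f3) := hdisj _ _ fun e h1 h2 => by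
    have := n3 e h2
    rcases Finset.mem_union.1 h1 with h1 | h1
    · have := n1 e h1; omega
    · have := n2 e h1; omega
  have d3 : Disjoint (edges 𝒯 ∪ S2.image f2 ∪ S3.image f3) (S4.image f4) :=
    hdisj _ _ fun e h1 h2 => by
      have := n4 e h2
      rcases Finset.mem_union.1 h1 with h1 | h1
      · rcases Finset.mem_union.1 h1 with h1 | h1
        · have := n1 e h1; omega
        · have := n2 e h1; omega
      · have := n3 e h1; omega
  have hcard : (edges 𝒯 ∪ S2.image f2 ∪ S3.image f3 ∪ S4.image f4).card =
      (edges 𝒯).card + 3 * (faces 𝒯).card + 8 * 𝒯.card := by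
    rw [Finset.card_union_of_disjoint d3, Finset.card_union_of_disjoint d2,
      Finset.card_union_of_disjoint d1, i2, i3, i4]
    ring
  rw [← hcard]
  refine Finset.card_le_card ?_
  have hmem : ∀ K ∈ 𝒯, ∀ F ∈ K.powersetCard 3, ∀ e ∈ F.powersetCard 2, ∀ p q, p ≠ q →
      p ∈ insert (W.center K) (insert (W.facePoint F) e) →
      q ∈ insert (W.center K) (insert (W.facePoint F) e) → {p, q} ∈ edges W.split :=
    fun K hK F hF e he p q hpq hp hq =>
      mem_simplices.2 ⟨_, WorseyFarin.mem_split.2 ⟨K, hK, F, hF, e, he, rfl⟩,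
        pair_mem_powersetCard hp hq hpq.symm⟩
  intro e he
  simp only [Finset.mem_union, Finset.mem_image] at he
  rcases he with ((he | ⟨q, hq, rfl⟩) | ⟨q, hq, rfl⟩) | ⟨q, hq, rfl⟩
  · obtain ⟨K, hK, heK⟩ := mem_simplices.1 he
    obtain ⟨a, ha, b, hb, hba, rfl⟩ := exists_pair_of_mem_powersetCard heK
    obtain ⟨F, hF, haF, hbF⟩ := exists_face_of_pair (h𝒯.card_eq K hK) ha hb hba.symm
    exact hmem K hK F hF _ (pair_mem_powersetCard haF hbF hba) a b hba.symm (by simp) (by simp)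
  · obtain ⟨h1, h2, h3⟩ := hS2 q hq
    obtain ⟨K, hK, hFK⟩ := mem_simplices.1 h1
    obtain ⟨e, he, hve⟩ := exists_pair_containing (card_of_mem_simplices h1) h2
    refine hmem K hK _ hFK e he _ _ (fun h => ?_) (by simp) (by simp [hve])
    have := k2 _ h1
    rw [h, k1 _ h3] at this
    omega
  · obtain ⟨h1, h2, h3⟩ := hS3 q hq
    obtain ⟨F, hF, hvF⟩ := exists_face_containing (h𝒯.card_eq _ h1) h2
    obtain ⟨e, he, hve⟩ := exists_pair_containing (Finset.mem_powersetCard.1 hF).2 hvF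
    refine hmem _ h1 F hF e he _ _ (fun h => ?_) (by simp) (by simp [hve])
    have := k3 _ h1
    rw [h, k1 _ h3] at this
    omega
  · obtain ⟨h1, h2, h3⟩ := hS4 q hq
    obtain ⟨e, he⟩ : (q.2.powersetCard 2).Nonempty :=
      Finset.powersetCard_nonempty.2 (by rw [card_of_mem_simplices h3]; norm_num)
    exact hmem _ h1 _ h2 e he _ _ ((W.localSplit h𝒯 h1).center_ne_facePoint h2) (by simp) (by simp)

end Count

end TetMesh

namespace TetMesh

open MvPolynomial (eval pderiv)

/-! ### The divergence of a quadratic at the vertices of a tetrahedron -/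

/-- The derivative at `p` in the direction `q - p` of a quadratic on the segment `[p, q]`, expressed
by the values at the ends and at the midpoint. -/
noncomputable def dirD {A : Set E3} (p q : E3) (f : C(A, E3)) : E3 :=
  (-3 : ℝ) • ext f p + (4 : ℝ) • ext f (midpoint ℝ p q) - ext f q

/-- The divergence at the vertex `p` of the quadratic that interpolates `f` on the tetrahedron `T`:
the trace of the linear map that takes the values `dirD p q f` at the vectors `q - p`. -/
noncomputable def divAt {A : Set E3} (T : Finset E3) (p : E3) : C(A, E3) →ₗ[ℝ] ℝ where
  toFun f := ∑ q ∈ T, (bary T q).linear (dirD p q f)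
  map_add' f g := by
    rw [← Finset.sum_add_distrib]
    refine Finset.sum_congr rfl fun q _ => ?_
    rw [← map_add]
    congr 1
    simp only [dirD, ext_add, Pi.add_apply]
    module
  map_smul' c f := by
    rw [RingHom.id_apply, Finset.smul_sum]
    refine Finset.sum_congr rfl fun q _ => ?_
    rw [← map_smul]
    congr 1
    simp only [dirD, ext_smul, Pi.smul_apply]
    module

lemma dirD_eq {𝒮 : Finset (Finset E3)} {f : C(domain 𝒮, E3)} {T : Finset E3} (hT : T ∈ 𝒮)
    {P : Fin 3 → MvPolynomial (Fin 3) ℝ} (hP : ∀ i, (P i).totalDegree ≤ 2)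
    (hfP : ∀ i, ∀ x : domain 𝒮, x.1 ∈ hull T → f x i = eval x.1.ofLp (P i))
    {p q : E3} (hp : p ∈ T) (hq : q ∈ T) : dirD p q f = polyDV P p (q - p) := by
  have hval : ∀ x ∈ hull T, ∀ i, ext f x i = eval x.ofLp (P i) := fun x hx i => by
    rw [← hfP i ⟨x, hull_subset_domain hT hx⟩ hx, ← ext_apply f]
  have hm : p + (1 / 2 : ℝ) • (q - p) = midpoint ℝ p q := by
    rw [midpoint_eq_smul_add, invOf_eq_inv]; module
  ext i
  obtain ⟨a, b, c, h⟩ := quadratic_line (hP i) p (q - p)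
  have e0 := h 0
  have e1 := (h 1).1
  have e2 := (h (1 / 2)).1
  rw [zero_smul, add_zero, ← hval p (subset_hull hp)] at e0
  rw [one_smul, add_sub_cancel, ← hval q (subset_hull hq)] at e1
  rw [hm, ← hval _ ((convex_hull T).midpoint_mem (subset_hull hp) (subset_hull hq))] at e2
  rw [polyDV_apply, e0.2]
  simp only [dirD, PiLp.add_apply, PiLp.sub_apply, PiLp.smul_apply, smul_eq_mul]
  rw [e0.1, e1, e2]
  ring

/-- The trace of a linear map in terms of its values on the edges of a tetrahedron at a vertex. -/
lemma divOf_eq_sum {T : Finset E3} (h : Nondeg T) (p : E3) (L : E3 →L[ℝ] E3) :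
    divOf L = ∑ q ∈ T, (bary T q).linear (L (q - p)) := by
  have hlin : ∀ d : E3, ∑ q ∈ T, (bary T q).linear d • (q - p) = d := by
    intro d
    have h1 := sum_bary_smul h (d + p)
    have h2 := sum_bary_smul h p
    have h3 := sum_bary h (d + p)
    have h4 := sum_bary h p
    have hl : ∀ q, (bary T q).linear d = bary T q (d + p) - bary T q p := fun q => by
      rw [affine_apply_eq (bary T q) (d + p), affine_apply_eq (bary T q) p, map_add]; ring
    simp only [hl, smul_sub, sub_smul, Finset.sum_sub_distrib, ← Finset.sum_smul, h1, h2, h3, h4]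
    module
  have hexp : ∀ w : E3, w = ∑ i, w i • EuclideanSpace.single i (1 : ℝ) := fun w => by
    ext j; fin_cases j <;> simp [Fin.sum_univ_three]
  have h1 : divOf L = ∑ i, ∑ q ∈ T, (bary T q).linear (EuclideanSpace.single i 1) * L (q - p) i := by
    refine Finset.sum_congr rfl fun i _ => ?_
    conv_lhs => rw [← hlin (EuclideanSpace.single i 1), map_sum]
    simp
  rw [h1, Finset.sum_comm]
  refine Finset.sum_congr rfl fun q _ => ?_
  conv_rhs => rw [hexp (L (q - p)), map_sum]
  exact Finset.sum_congr rfl fun i _ => by rw [map_smul, smul_eq_mul, mul_comm]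

lemma divAt_eq {𝒮 : Finset (Finset E3)} {f : C(domain 𝒮, E3)} {T : Finset E3} (hT : T ∈ 𝒮)
    (h : Nondeg T) {P : Fin 3 → MvPolynomial (Fin 3) ℝ} (hP : ∀ i, (P i).totalDegree ≤ 2)
    (hfP : ∀ i, ∀ x : domain 𝒮, x.1 ∈ hull T → f x i = eval x.1.ofLp (P i))
    {p : E3} (hp : p ∈ T) : divAt T p f = divOf (polyDV P p) := by
  rw [divOf_eq_sum h p]
  exact Finset.sum_congr rfl fun q hq => by rw [dirD_eq hT hP hfP hp hq]

/-- A polynomial of degree at most one that vanishes at the vertices of a simplex vanishes on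
the simplex. -/
lemma eval_eq_zero_of_vertices {s : Finset E3} {p : MvPolynomial (Fin 3) ℝ}
    (hp : p.totalDegree ≤ 1) (h0 : ∀ v ∈ s, eval v.ofLp p = 0) :
    ∀ x ∈ hull s, eval x.ofLp p = 0 := by
  suffices h : hull s ⊆ {x : E3 | eval x.ofLp p = 0} from h
  refine convexHull_min (fun v hv => h0 v hv) ?_
  rw [convex_iff_segment_subset]
  intro x hx y hy u hu
  rw [segment_eq_image'] at hu
  obtain ⟨t, -, rfl⟩ := hu
  obtain ⟨q, hq, hl⟩ := exists_polynomial_line hp x (y - x)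
  have hl' : ∀ t : ℝ, eval (x + t • (y - x)).ofLp p = q.coeff 0 + q.coeff 1 * t := fun t => by
    rw [hl, Polynomial.eval_eq_sum_range' (n := 2) (by omega)]
    simp [Finset.sum_range_succ]
  have e0 := hl' 0
  have e1 := hl' 1
  rw [zero_smul, add_zero] at e0
  rw [one_smul, add_sub_cancel] at e1
  change eval x.ofLp p = 0 at hx
  change eval y.ofLp p = 0 at hy
  change eval (x + t • (y - x)).ofLp p = 0
  rw [hx] at e0
  rw [hy] at e1
  rw [hl']
  linear_combination (t - 1) * e0 - t * e1

/-- The divergence of a quadratic field is linear, so that it suffices that it vanishes at the vertices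
of the tetrahedra. -/
lemma mem_Z_of_divAt {𝒮 : Finset (Finset E3)} (h𝒮 : ∀ T ∈ 𝒮, Nondeg T) {f : C(domain 𝒮, E3)}
    (hf : f ∈ V 𝒮 2) (h0 : ∀ T ∈ 𝒮, ∀ p ∈ T, divAt T p f = 0) : f ∈ Z 𝒮 2 := by
  refine ⟨hf, fun T hT x hx => ?_⟩
  choose P hP hfP using hf T hT
  refine ⟨_, hasFDerivAt_ext hT hfP hx, ?_⟩
  have hD : ∀ y : E3, divOf (polyDV P y) = eval y.ofLp (∑ i, pderiv i (P i)) := fun y => by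
    rw [divOf_polyDV, map_sum]
  rw [hD]
  refine eval_eq_zero_of_vertices (s := T) ?_ (fun v hv => ?_) x (interior_subset hx)
  · exact MvPolynomial.totalDegree_finsetSum_le fun i _ => totalDegree_pderiv_le (hP i) i
  · rw [← hD, ← divAt_eq hT (h𝒮 T hT) hP hfP hv, h0 T hT v hv]

/-! ### The constraint at a singular edge -/

/-- Four tetrahedra around an edge `[x, o]` that lies in only two planes: the gradients of a
continuous piecewise polynomial field at `x` agree along the common faces, so that their alternating
sum vanishes. Here `g q` is the common derivative in the direction of the edge `[x, q]`. -/
lemma div_alternating {x o y y' z z' : E3} {g : E3 → E3} {L₁ L₂ L₃ L₄ : E3 →L[ℝ] E3}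
    {T : Finset E3} (hT : Nondeg T) (hxT : x ∈ T)
    (hTmem : ∀ q ∈ T, q = x ∨ q = o ∨ q = z ∨ q = y)
    (h1o : L₁ (o - x) = g o) (h1z : L₁ (z - x) = g z) (h1y : L₁ (y - x) = g y)
    (h2o : L₂ (o - x) = g o) (h2z : L₂ (z - x) = g z) (h2y : L₂ (y' - x) = g y')
    (h3o : L₃ (o - x) = g o) (h3z : L₃ (z' - x) = g z') (h3y : L₃ (y - x) = g y)
    (h4o : L₄ (o - x) = g o) (h4z : L₄ (z' - x) = g z') (h4y : L₄ (y' - x) = g y')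
    {c d : ℝ} (hz : z - x = c • (z' - x) + d • (o - x))
    {c' d' : ℝ} (hy : y - x = c' • (y' - x) + d' • (o - x)) :
    divOf L₁ - divOf L₂ = divOf L₃ - divOf L₄ := by
  have hA : L₁ + L₄ = L₂ + L₃ := by
    have hdir : ∀ q ∈ T, (L₁ + L₄ - (L₂ + L₃)) (q - x) = 0 := by
      intro q hq
      simp only [sub_apply, add_apply]
      rcases hTmem q hq with rfl | rfl | rfl | rfl
      · simp
      · rw [h1o, h2o, h3o, h4o]; module
      · rw [h1z, h2z, hz, map_add, map_add, map_smul, map_smul, map_smul, map_smul, h4z, h3z, h3o,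
          h4o]
        module
      · rw [h1y, h3y, hy, map_add, map_add, map_smul, map_smul, map_smul, map_smul, h4y, h2y, h4o,
          h2o]
        module
    rw [← sub_eq_zero]
    ext u i
    let ℓ : E3 →L[ℝ] ℝ := (EuclideanSpace.proj i : E3 →L[ℝ] ℝ).comp (L₁ + L₄ - (L₂ + L₃))
    have := functional_eq_zero hT ℓ.toLinearMap (ℓ x) fun q hq => by
      have h1 : ℓ (q - x) = 0 := by
        have := congrArg (fun w : E3 => w i) (hdir q hq)
        exact this
      rwa [map_sub, sub_eq_zero] at h1
    exact congrArg (fun L : E3 →ₗ[ℝ] ℝ => L u) this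
  have := congrArg divOf hA
  rw [divOf_add, divOf_add] at this
  linarith

lemma sum_powersetCard_two {M : Type*} [AddCommMonoid M] {a b c : E3} (hab : a ≠ b) (hac : a ≠ c)
    (hbc : b ≠ c) (φ : Finset E3 → M) :
    ∑ e ∈ ({a, b, c} : Finset E3).powersetCard 2, φ e = φ {a, b} + φ {a, c} + φ {b, c} := by
  have h : ({a, b, c} : Finset E3).powersetCard 2 = {{a, b}, {a, c}, {b, c}} := by
    refine (Finset.eq_of_subset_of_card_le ?_ ?_).symm
    · intro e he
      simp only [Finset.mem_insert, Finset.mem_singleton] at he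
      rcases he with rfl | rfl | rfl
      · exact pair_mem_powersetCard (by simp) (by simp) hab.symm
      · exact pair_mem_powersetCard (by simp) (by simp) hac.symm
      · exact pair_mem_powersetCard (by simp) (by simp) hbc.symm
    · have h3 : ({{a, b}, {a, c}, {b, c}} : Finset (Finset E3)).card = 3 := by
        refine Finset.card_eq_three.2 ⟨{a, b}, {a, c}, {b, c}, fun h => ?_, fun h => ?_,
          fun h => ?_, rfl⟩
        · have : b ∈ ({a, c} : Finset E3) := h ▸ by simp
          simp [hab.symm, hbc] at this
        · have : a ∈ ({b, c} : Finset E3) := h ▸ by simp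
          simp [hab, hac] at this
        · have : a ∈ ({b, c} : Finset E3) := h ▸ by simp
          simp [hab, hac] at this
      rw [Finset.card_powersetCard, Finset.card_eq_three.2 ⟨a, b, c, hab, hac, hbc, rfl⟩, h3]
      simp [Nat.choose]
  rw [h, Finset.sum_insert, Finset.sum_insert, Finset.sum_singleton, ← add_assoc]
  · rw [Finset.mem_singleton]
    intro h
    have : a ∈ ({b, c} : Finset E3) := h ▸ by simp
    simp [hab, hac] at this
  · rw [Finset.mem_insert, Finset.mem_singleton]
    rintro (h | h)
    · have : b ∈ ({a, c} : Finset E3) := h ▸ by simp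
      simp [hab.symm, hbc] at this
    · have : a ∈ ({b, c} : Finset E3) := h ▸ by simp
      simp [hab, hac] at this

namespace WorseyFarin

variable {𝒯 : Finset (Finset E3)} (W : WorseyFarin 𝒯)

/-- The divergence at the vertex `p` of the subtetrahedron given by the tetrahedron `K`, its face `F`
and the edge `e` of `F`. -/
noncomputable def subDiv (K F e : Finset E3) (p : E3) : C(domain W.split, E3) →ₗ[ℝ] ℝ :=
  divAt (insert (W.center K) (insert (W.facePoint F) e)) p

/-- The interior point of one of two tetrahedra with a common face lies on the line through the face
point and the other interior point. -/
lemma center_sub_facePoint (h𝒯 : IsTetMesh 𝒯) {K L F : Finset E3} (hK : K ∈ 𝒯) (hL : L ∈ 𝒯)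
    (hKL : K ≠ L) (hFK : F ∈ K.powersetCard 3) (hFL : F ∈ L.powersetCard 3) :
    ∃ c : ℝ, W.center K - W.facePoint F = c • (W.center L - W.facePoint F) := by
  have hline := W.facePoint_line F (mem_simplices.2 ⟨K, hK, hFK⟩) K hK L hL hKL
    (Finset.mem_powersetCard.1 hFK).1 (Finset.mem_powersetCard.1 hFL).1
  obtain ⟨t, ht⟩ := mem_affineSpan_pair_iff_exists_lineMap_eq.1 hline
  have hne := (W.localSplit h𝒯 hL).center_ne_facePoint hFL
  rw [AffineMap.lineMap_apply_module'] at ht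
  have ht1 : 1 - t ≠ 0 := fun h0 => hne (by
    have : t = 1 := by linarith
    rw [← ht, this]; module)
  refine ⟨-t / (1 - t), ?_⟩
  rw [← ht]
  have e1 : W.center L - (t • (W.center L - W.center K) + W.center K) =
      (1 - t) • (W.center L - W.center K) := by module
  rw [e1, smul_smul, div_mul_cancel₀ _ ht1]
  module

/-- The singular edges of the split: at both ends of the edge from a face point `m_F` to a vertex
`a` of `F = {a, b, c}`, the jump of the divergence across the edge is the same on both sides
of the face. -/
lemma subDiv_jump (h𝒯 : IsTetMesh 𝒯) {f : C(domain W.split, E3)} (hf : f ∈ V W.split 2)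
    {K L : Finset E3} (hK : K ∈ 𝒯) (hL : L ∈ 𝒯) (hKL : K ≠ L) {a b c : E3} (hab : a ≠ b)
    (hac : a ≠ c) (hbc : b ≠ c) (hFK : {a, b, c} ∈ K.powersetCard 3)
    (hFL : {a, b, c} ∈ L.powersetCard 3) :
    (W.subDiv K {a, b, c} {a, b} a f - W.subDiv K {a, b, c} {a, c} a f =
      W.subDiv L {a, b, c} {a, b} a f - W.subDiv L {a, b, c} {a, c} a f) ∧
    (W.subDiv K {a, b, c} {a, b} (W.facePoint {a, b, c}) f -
        W.subDiv K {a, b, c} {a, c} (W.facePoint {a, b, c}) f =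
      W.subDiv L {a, b, c} {a, b} (W.facePoint {a, b, c}) f -
        W.subDiv L {a, b, c} {a, c} (W.facePoint {a, b, c}) f) := by
  have hlK := W.localSplit h𝒯 hK
  have hlL := W.localSplit h𝒯 hL
  have heb : {a, b} ∈ ({a, b, c} : Finset E3).powersetCard 2 :=
    pair_mem_powersetCard (by simp) (by simp) hab.symm
  have hec : {a, c} ∈ ({a, b, c} : Finset E3).powersetCard 2 :=
    pair_mem_powersetCard (by simp) (by simp) hac.symm
  have t1 : insert (W.center K) (insert (W.facePoint {a, b, c}) {a, b}) ∈ W.split :=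
    mem_split.2 ⟨K, hK, _, hFK, _, heb, rfl⟩
  have t2 : insert (W.center K) (insert (W.facePoint {a, b, c}) {a, c}) ∈ W.split :=
    mem_split.2 ⟨K, hK, _, hFK, _, hec, rfl⟩
  have t3 : insert (W.center L) (insert (W.facePoint {a, b, c}) {a, b}) ∈ W.split :=
    mem_split.2 ⟨L, hL, _, hFL, _, heb, rfl⟩
  have t4 : insert (W.center L) (insert (W.facePoint {a, b, c}) {a, c}) ∈ W.split :=
    mem_split.2 ⟨L, hL, _, hFL, _, hec, rfl⟩
  have n1 := hlK.nondeg_split hFK heb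
  have n2 := hlK.nondeg_split hFK hec
  have n3 := hlL.nondeg_split hFL heb
  have n4 := hlL.nondeg_split hFL hec
  choose P1 hP1 hf1 using hf _ t1
  choose P2 hP2 hf2 using hf _ t2
  choose P3 hP3 hf3 using hf _ t3
  choose P4 hP4 hf4 using hf _ t4
  obtain ⟨κ, hκ⟩ := W.center_sub_facePoint h𝒯 hK hL hKL hFK hFL
  -- the face point as a convex combination
  have hsum := hlK.sum_face hFK
  have hcomb := hlK.sum_smul_face hFK
  have hβ := hlK.face_pos _ hFK b (by simp)
  rw [Finset.sum_insert (by simp [hab, hac]), Finset.sum_pair hbc] at hsum hcomb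
  set m := W.facePoint {a, b, c} with hm
  set zK := W.center K
  set zL := W.center L
  set α := bary K a m
  set β := bary K b m
  set γ := bary K c m
  have hα : α = 1 - β - γ := by linarith
  have hy : β • (b - a) = (m - a) - γ • (c - a) := by rw [← hcomb, hα]; module
  have hy' : β • (b - m) = -(γ • (c - m)) - α • (a - m) := by
    have : β • b = m - α • a - γ • c := by rw [← hcomb]; module
    rw [smul_sub, this, hα]; module
  constructor
  · simp only [subDiv]
    rw [divAt_eq t1 n1 hP1 hf1 (by simp), divAt_eq t2 n2 hP2 hf2 (by simp),
      divAt_eq t3 n3 hP3 hf3 (by simp), divAt_eq t4 n4 hP4 hf4 (by simp)]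
    refine div_alternating (x := a) (o := m) (y := b) (y' := c) (z := zK) (z' := zL)
      (g := fun q => dirD a q f) n1 (by simp) (fun q hq => ?_)
      (dirD_eq t1 hP1 hf1 (by simp) (by simp [hm])).symm
      (dirD_eq t1 hP1 hf1 (by simp) (by simp [zK])).symm
      (dirD_eq t1 hP1 hf1 (by simp) (by simp)).symm
      (dirD_eq t2 hP2 hf2 (by simp) (by simp [hm])).symm
      (dirD_eq t2 hP2 hf2 (by simp) (by simp [zK])).symm
      (dirD_eq t2 hP2 hf2 (by simp) (by simp)).symm
      (dirD_eq t3 hP3 hf3 (by simp) (by simp [hm])).symm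
      (dirD_eq t3 hP3 hf3 (by simp) (by simp [zL])).symm
      (dirD_eq t3 hP3 hf3 (by simp) (by simp)).symm
      (dirD_eq t4 hP4 hf4 (by simp) (by simp [hm])).symm
      (dirD_eq t4 hP4 hf4 (by simp) (by simp [zL])).symm
      (dirD_eq t4 hP4 hf4 (by simp) (by simp)).symm
      (c := κ) (d := 1 - κ) ?_ (c' := -(γ / β)) (d' := 1 / β) ?_
    · simp only [Finset.mem_insert, Finset.mem_singleton] at hq
      tauto
    · have : zK - a = (zK - m) + (m - a) := by module
      rw [this, hκ]; module
    · have : b - a = (1 / β) • (β • (b - a)) := by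
        rw [smul_smul, one_div, inv_mul_cancel₀ hβ.ne', one_smul]
      rw [this, hy]; module
  · simp only [subDiv]
    rw [divAt_eq t1 n1 hP1 hf1 (by simp [hm]), divAt_eq t2 n2 hP2 hf2 (by simp [hm]),
      divAt_eq t3 n3 hP3 hf3 (by simp [hm]), divAt_eq t4 n4 hP4 hf4 (by simp [hm])]
    refine div_alternating (x := m) (o := a) (y := b) (y' := c) (z := zK) (z' := zL)
      (g := fun q => dirD m q f) n1 (by simp [hm]) (fun q hq => ?_)
      (dirD_eq t1 hP1 hf1 (by simp [hm]) (by simp)).symm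
      (dirD_eq t1 hP1 hf1 (by simp [hm]) (by simp [zK])).symm
      (dirD_eq t1 hP1 hf1 (by simp [hm]) (by simp)).symm
      (dirD_eq t2 hP2 hf2 (by simp [hm]) (by simp)).symm
      (dirD_eq t2 hP2 hf2 (by simp [hm]) (by simp [zK])).symm
      (dirD_eq t2 hP2 hf2 (by simp [hm]) (by simp)).symm
      (dirD_eq t3 hP3 hf3 (by simp [hm]) (by simp)).symm
      (dirD_eq t3 hP3 hf3 (by simp [hm]) (by simp [zL])).symm
      (dirD_eq t3 hP3 hf3 (by simp [hm]) (by simp)).symm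
      (dirD_eq t4 hP4 hf4 (by simp [hm]) (by simp)).symm
      (dirD_eq t4 hP4 hf4 (by simp [hm]) (by simp [zL])).symm
      (dirD_eq t4 hP4 hf4 (by simp [hm]) (by simp)).symm
      (c := κ) (d := 0) ?_ (c' := -(γ / β)) (d' := -(α / β)) ?_
    · simp only [Finset.mem_insert, Finset.mem_singleton] at hq
      tauto
    · rw [hκ]; module
    · have : b - m = (1 / β) • (β • (b - m)) := by
        rw [smul_smul, one_div, inv_mul_cancel₀ hβ.ne', one_smul]
      rw [this, hy']; module

end WorseyFarin

end TetMesh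

namespace TetMesh

/-! ### The dimension of the space of divergence-free quadratics -/

/-- Imposing finitely many linear conditions lowers the dimension by at most their number. -/
lemma finrank_le_finrank_add_card {X : Type*} [AddCommGroup X] [Module ℝ X] {M N : Submodule ℝ X}
    [FiniteDimensional ℝ M] [FiniteDimensional ℝ N] (Φ : Finset (X →ₗ[ℝ] ℝ))
    (h : ∀ f ∈ M, (∀ φ ∈ Φ, φ f = 0) → f ∈ N) :
    Module.finrank ℝ M ≤ Module.finrank ℝ N + Φ.card := by
  let A : M →ₗ[ℝ] (Φ → ℝ) := LinearMap.pi fun φ => φ.1.domRestrict M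
  have h1 := A.finrank_range_add_finrank_ker
  have h2 : Module.finrank ℝ (LinearMap.range A) ≤ Φ.card := by
    refine (Submodule.finrank_le _).trans ?_
    simp
  have h3 : Module.finrank ℝ (LinearMap.ker A) ≤ Module.finrank ℝ N := by
    have hmem : ∀ f : LinearMap.ker A, (f.1 : X) ∈ N := fun f =>
      h _ f.1.2 fun φ hφ => congrFun (LinearMap.mem_ker.1 f.2) ⟨φ, hφ⟩
    refine LinearMap.finrank_le_finrank_of_injective
      (f := (M.subtype.comp (LinearMap.ker A).subtype).codRestrict N hmem) ?_
    intro f g hfg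
    exact Subtype.ext (Subtype.ext (congrArg (fun x : N => (x : X)) hfg))
  omega

namespace WorseyFarin

variable {𝒯 : Finset (Finset E3)} (W : WorseyFarin 𝒯)

/-- The seven conditions for a face `F` of a tetrahedron `K`: the divergence vanishes at the interior
point of `K` on each of the three subtetrahedra, and its sum over the subtetrahedra that contain a
given vertex of `F`, or the face point of `F`, vanishes. -/
noncomputable def tetConditions (K F : Finset E3) : Finset (C(domain W.split, E3) →ₗ[ℝ] ℝ) :=
  (F.powersetCard 2).image (fun e => W.subDiv K F e (W.center K)) ∪
    ({∑ e ∈ F.powersetCard 2, W.subDiv K F e (W.facePoint F)} ∪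
      F.image fun v => ∑ e ∈ F.powersetCard 2, if v ∈ e then W.subDiv K F e v else 0)

lemma card_tetConditions {K F : Finset E3} (hF : F.card = 3) :
    (W.tetConditions K F).card ≤ 7 := by
  refine (Finset.card_union_le _ _).trans ?_
  have h1 : ((F.powersetCard 2).image (fun e => W.subDiv K F e (W.center K))).card ≤ 3 :=
    Finset.card_image_le.trans (by rw [Finset.card_powersetCard, hF]; rfl)
  refine (add_le_add h1 ((Finset.card_union_le _ _).trans
    (add_le_add (Finset.card_singleton _).le (Finset.card_image_le.trans hF.le)))).trans ?_
  norm_num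

/-- For a face `F`, five conditions on one of the adjacent tetrahedra suffice for the divergence to
vanish at the points of `F` on both sides, because of `subDiv_jump`. -/
lemma exists_faceConditions (h𝒯 : IsTetMesh 𝒯) {F : Finset E3} (hF : F ∈ faces 𝒯) :
    ∃ Ψ : Finset (C(domain W.split, E3) →ₗ[ℝ] ℝ), Ψ.card ≤ 5 ∧ ∀ f ∈ V W.split 2,
      (∀ K ∈ 𝒯, F ∈ K.powersetCard 3 → ∀ φ ∈ W.tetConditions K F, φ f = 0) →
      (∀ φ ∈ Ψ, φ f = 0) → ∀ K ∈ 𝒯, F ∈ K.powersetCard 3 → ∀ e ∈ F.powersetCard 2,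
        ∀ p ∈ insert (W.facePoint F) e, W.subDiv K F e p f = 0 := by
  obtain ⟨K, hK, hFK⟩ := mem_simplices.1 hF
  obtain ⟨a, b, c, hab, hac, hbc, rfl⟩ := Finset.card_eq_three.1 (Finset.mem_powersetCard.1 hFK).2
  have hba : ({b, a, c} : Finset E3) = {a, b, c} := Finset.insert_comm _ _ _
  have hcb : ({c, a, b} : Finset E3) = {a, b, c} := by ext; simp; tauto
  refine ⟨{W.subDiv K {a, b, c} {b, c} (W.facePoint {a, b, c}),
    W.subDiv K {a, b, c} {a, c} (W.facePoint {a, b, c}), W.subDiv K {a, b, c} {a, c} a,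
    W.subDiv K {a, b, c} {a, b} b, W.subDiv K {a, b, c} {b, c} c}, Finset.card_le_five,
    fun f hf hT hΨ => ?_⟩
  simp only [Finset.mem_insert, Finset.mem_singleton, forall_eq_or_imp, forall_eq] at hΨ
  obtain ⟨k1, k2, k3, k4, k5⟩ := hΨ
  have hsum : ∀ L ∈ 𝒯, {a, b, c} ∈ L.powersetCard 3 →
      (W.subDiv L {a, b, c} {a, b} (W.facePoint {a, b, c}) f +
        W.subDiv L {a, b, c} {a, c} (W.facePoint {a, b, c}) f +
        W.subDiv L {a, b, c} {b, c} (W.facePoint {a, b, c}) f = 0) ∧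
      (W.subDiv L {a, b, c} {a, b} a f + W.subDiv L {a, b, c} {a, c} a f = 0) ∧
      (W.subDiv L {a, b, c} {a, b} b f + W.subDiv L {a, b, c} {b, c} b f = 0) ∧
      (W.subDiv L {a, b, c} {a, c} c f + W.subDiv L {a, b, c} {b, c} c f = 0) := by
    intro L hL hFL
    have hv : ∀ v ∈ ({a, b, c} : Finset E3), (∑ e ∈ ({a, b, c} : Finset E3).powersetCard 2,
        if v ∈ e then W.subDiv L {a, b, c} e v else 0) f = 0 := fun v hv =>
      hT L hL hFL _ (Finset.mem_union_right _ (Finset.mem_union_right _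
        (Finset.mem_image_of_mem _ hv)))
    have hm := hT L hL hFL _ (Finset.mem_union_right _ (Finset.mem_union_left _
        (Finset.mem_singleton_self _)))
    have ha := hv a (by simp)
    have hb := hv b (by simp)
    have hc := hv c (by simp)
    rw [sum_powersetCard_two hab hac hbc] at hm ha hb hc
    refine ⟨by simpa using hm, ?_, ?_, ?_⟩
    · simpa [hab, hac] using ha
    · simpa [hab.symm, hbc] using hb
    · simpa [hac.symm, hbc.symm] using hc
  obtain ⟨D, hD⟩ : ∃ D : Finset E3 → Finset E3 → E3 → ℝ,
      ∀ L e p, W.subDiv L {a, b, c} e p f = D L e p := ⟨_, fun _ _ _ => rfl⟩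
  have hall : ∀ L ∈ 𝒯, {a, b, c} ∈ L.powersetCard 3 →
      (W.subDiv L {a, b, c} {a, b} (W.facePoint {a, b, c}) f = 0 ∧
        W.subDiv L {a, b, c} {a, c} (W.facePoint {a, b, c}) f = 0 ∧
        W.subDiv L {a, b, c} {b, c} (W.facePoint {a, b, c}) f = 0) ∧
      (W.subDiv L {a, b, c} {a, b} a f = 0 ∧ W.subDiv L {a, b, c} {a, c} a f = 0) ∧
      (W.subDiv L {a, b, c} {a, b} b f = 0 ∧ W.subDiv L {a, b, c} {b, c} b f = 0) ∧
      (W.subDiv L {a, b, c} {a, c} c f = 0 ∧ W.subDiv L {a, b, c} {b, c} c f = 0) := by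
    obtain ⟨s1, s2, s3, s4⟩ := hsum K hK hFK
    intro L hL hFL
    obtain ⟨t1, t2, t3, t4⟩ := hsum L hL hFL
    by_cases hKL : K = L
    · subst hKL
      simp only [hD] at k1 k2 k3 k4 k5 s1 s2 s3 s4 ⊢
      refine ⟨⟨?_, ?_, ?_⟩, ⟨?_, ?_⟩, ⟨?_, ?_⟩, ⟨?_, ?_⟩⟩ <;> linarith
    · obtain ⟨ja, jam⟩ := W.subDiv_jump h𝒯 hf hK hL hKL hab hac hbc hFK hFL
      obtain ⟨jb, jbm⟩ := W.subDiv_jump h𝒯 hf hK hL hKL hab.symm hbc hac (hba ▸ hFK) (hba ▸ hFL)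
      obtain ⟨jc, -⟩ := W.subDiv_jump h𝒯 hf hK hL hKL hac.symm hbc.symm hab (hcb ▸ hFK)
        (hcb ▸ hFL)
      rw [hba, Finset.pair_comm b a] at jb jbm
      rw [hcb, Finset.pair_comm c a, Finset.pair_comm c b] at jc
      simp only [hD] at k1 k2 k3 k4 k5 s1 s2 s3 s4 t1 t2 t3 t4 ja jam jb jbm jc ⊢
      refine ⟨⟨?_, ?_, ?_⟩, ⟨?_, ?_⟩, ⟨?_, ?_⟩, ⟨?_, ?_⟩⟩ <;> linarith
  intro L hL hFL e he p hp
  obtain ⟨⟨m1, m2, m3⟩, ⟨a1, a2⟩, ⟨b1, b2⟩, ⟨c1, c2⟩⟩ := hall L hL hFL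
  have he' : e = {a, b} ∨ e = {a, c} ∨ e = {b, c} := by
    obtain ⟨x, y, hxy, rfl⟩ := Finset.card_eq_two.1 (Finset.mem_powersetCard.1 he).2
    have hsub := (Finset.mem_powersetCard.1 he).1
    have hx : x = a ∨ x = b ∨ x = c := by simpa using hsub (Finset.mem_insert_self x {y})
    have hy : y = a ∨ y = b ∨ y = c := by
      simpa using hsub (Finset.mem_insert_of_mem (Finset.mem_singleton_self y))
    rcases hx with rfl | rfl | rfl <;> rcases hy with rfl | rfl | rfl <;>
      simp_all [Finset.pair_comm]
  rcases he' with rfl | rfl | rfl <;>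
    simp only [Finset.mem_insert, Finset.mem_singleton] at hp <;> rcases hp with rfl | rfl | rfl
  exacts [m1, a1, b1, m2, a2, c1, m3, b2, c2]

/-- The lower bound for the dimension of `Z_2` on the split mesh: the dimension of `V_2`, less the
number of conditions. -/
theorem le_finrank_Z (h𝒯 : IsTetMesh 𝒯) :
    3 * ((vertices 𝒯).card + (edges 𝒯).card + 4 * (faces 𝒯).card + 9 * 𝒯.card) ≤
      Module.finrank ℝ (Z W.split 2) + (28 * 𝒯.card + 5 * (faces 𝒯).card) := by
  have hV := (W.conf_split h𝒯).le_finrank_V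
  have hv := card_vertices_split h𝒯 W
  have he := card_edges_split h𝒯 W
  have := finiteDimensional_V W.split 2
  have := finiteDimensional_Z W.split 2
  choose! Ψ hΨ hΨ' using fun F hF => W.exists_faceConditions h𝒯 (F := F) hF
  let Φ₁ := 𝒯.biUnion fun K => (K.powersetCard 3).biUnion fun F => W.tetConditions K F
  let Φ₂ := (faces 𝒯).biUnion Ψ
  have h1 : Φ₁.card ≤ 𝒯.card * 28 := by
    refine Finset.card_biUnion_le_card_mul _ _ _ fun K hK => ?_
    refine (Finset.card_biUnion_le_card_mul _ _ 7 fun F hF =>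
      W.card_tetConditions (Finset.mem_powersetCard.1 hF).2).trans ?_
    rw [Finset.card_powersetCard, h𝒯.card_eq K hK]
    decide
  have h2 : Φ₂.card ≤ (faces 𝒯).card * 5 :=
    Finset.card_biUnion_le_card_mul _ _ _ fun F hF => hΨ F hF
  have h3 := finrank_le_finrank_add_card (M := V W.split 2) (N := Z W.split 2) (Φ₁ ∪ Φ₂)
    fun f hf hΦ => by
      refine mem_Z_of_divAt (W.nondeg_split h𝒯) hf fun T hT p hp => ?_
      obtain ⟨K, hK, F, hF, e, he, rfl⟩ := mem_split.1 hT
      have hmem : ∀ L ∈ 𝒯, F ∈ L.powersetCard 3 → ∀ φ ∈ W.tetConditions L F, φ f = 0 :=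
        fun L hL hFL φ hφ => hΦ φ (Finset.mem_union_left _
          (Finset.mem_biUnion.2 ⟨L, hL, Finset.mem_biUnion.2 ⟨F, hFL, hφ⟩⟩))
      rcases Finset.mem_insert.1 hp with rfl | hp
      · exact hmem K hK hF _ (Finset.mem_union_left _ (Finset.mem_image_of_mem _ he))
      · have hF' : F ∈ faces 𝒯 := mem_simplices.2 ⟨K, hK, hF⟩
        exact hΨ' F hF' f hf hmem (fun φ hφ => hΦ φ (Finset.mem_union_right _
          (Finset.mem_biUnion.2 ⟨F, hF', hφ⟩))) K hK hF e he p hp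
  have h4 := Finset.card_union_le Φ₁ Φ₂
  omega

end WorseyFarin

end TetMesh

namespace TetMesh

variable {𝒯 : Finset (Finset E3)}

/-! ### The gap on an arbitrary mesh -/

namespace WorseyFarin

/-- The lower bound for the dimension gap of an arbitrary mesh in terms of the four counts. -/
theorem gap (h𝒯 : IsTetMesh 𝒯) (W : WorseyFarin 𝒯) :
    7 * ((faces 𝒯).card : ℝ) - 9 * (vertices 𝒯).card - 3 * (edges 𝒯).card - 𝒯.card ≤
      (Module.finrank ℝ (Z W.split 2) : ℝ) - Module.finrank ℝ (curlS W.split 3) := by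
  have h1 := W.le_finrank_Z h𝒯
  have h2 := finrank_curlS_le h𝒯 W
  have h1' : (3 * ((vertices 𝒯).card + (edges 𝒯).card + 4 * (faces 𝒯).card + 9 * 𝒯.card) : ℝ) ≤
      Module.finrank ℝ (Z W.split 2) + (28 * 𝒯.card + 5 * (faces 𝒯).card) := by exact_mod_cast h1
  have h2' : (Module.finrank ℝ (curlS W.split 3) : ℝ) ≤
      12 * (vertices 𝒯).card + 6 * (edges 𝒯).card := by exact_mod_cast h2
  linarith

lemma curlS_le (h𝒯 : IsTetMesh 𝒯) (W : WorseyFarin 𝒯) : curlS W.split 3 ≤ Z W.split 2 :=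
  curlS_le_Z (W.nondeg_split h𝒯) 2

lemma curlS_lt (h𝒯 : IsTetMesh 𝒯) (W : WorseyFarin 𝒯)
    (h : (0 : ℝ) < (Module.finrank ℝ (Z W.split 2) : ℝ) - Module.finrank ℝ (curlS W.split 3)) :
    curlS W.split 3 < Z W.split 2 := by
  refine lt_of_le_of_ne (W.curlS_le h𝒯) fun he => ?_
  rw [he, sub_self] at h
  exact lt_irrefl _ h

end WorseyFarin

/-! ### Double counting -/

/-- Two tetrahedra with a common face lie on different sides of it: otherwise they would share points
close to the centroid of the face that do not lie on the face. -/
lemma IsTetMesh.bary_neg (h𝒯 : IsTetMesh 𝒯) {K L F : Finset E3} (hK : K ∈ 𝒯) (hL : L ∈ 𝒯)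
    (hKL : K ≠ L) (hF : F.card = 3) {u w : E3} (hu : u ∉ F) (hKu : K = insert u F) (hw : w ∉ F)
    (hLw : L = insert w F) : bary K u w < 0 := by
  by_contra! h0
  have hnK := h𝒯.nondeg hK
  have hnL := h𝒯.nondeg hL
  have hFK : F ⊆ K := hKu ▸ Finset.subset_insert _ _
  have hFL : F ⊆ L := hLw ▸ Finset.subset_insert _ _
  have hinter : K ∩ L = F := by
    rw [hKu, hLw]
    ext q
    simp only [Finset.mem_inter, Finset.mem_insert]
    refine ⟨?_, fun h => ⟨Or.inr h, Or.inr h⟩⟩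
    rintro ⟨rfl | h, rfl | h'⟩
    exacts [(hKL (hKu.trans hLw.symm)).elim, h', h, h]
  -- a point close to the centroid of the face, on the side of `w`
  let m : E3 := ∑ q ∈ F, (1 / 3 : ℝ) • q
  have hwt : ∑ q ∈ F, (1 / 3 : ℝ) = 1 := by rw [Finset.sum_const, hF]; norm_num
  have hmK : ∀ v, bary K v m = if v ∈ F then 1 / 3 else 0 :=
    bary_comb hnK hFK (fun _ => 1 / 3) hwt
  have hmL : ∀ v, bary L v m = if v ∈ F then 1 / 3 else 0 :=
    bary_comb hnL hFL (fun _ => 1 / 3) hwt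
  let γ : ℝ → E3 := fun t => AffineMap.lineMap m w t
  have hγ : ∀ (A : E3 →ᵃ[ℝ] ℝ) t, A (γ t) = (1 - t) * A m + t * A w := fun A t => by
    rw [AffineMap.apply_lineMap, AffineMap.lineMap_apply_module, smul_eq_mul, smul_eq_mul]
  have hγL : ∀ t, bary L w (γ t) = t := fun t => by
    rw [hγ, hmL, if_neg hw, bary_vertex hnL w (hLw ▸ Finset.mem_insert_self w F), if_pos rfl]
    ring
  obtain ⟨t, ht, ht0, ht1⟩ : ∃ t : ℝ, (∀ v ∈ F, 0 < bary K v (γ t)) ∧ 0 < t ∧ t < 1 := by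
    have hev : ∀ᶠ t in nhdsWithin (0 : ℝ) (Set.Ioi 0), ∀ v ∈ F, 0 < bary K v (γ t) := by
      refine (Filter.eventually_all_finset F).2 fun v hv => ?_
      have hc : Continuous fun t => bary K v (γ t) := by
        simp only [hγ]; fun_prop
      refine nhdsWithin_le_nhds (hc.continuousAt.eventually_const_lt ?_)
      beta_reduce
      rw [hγ, hmK, if_pos hv]
      norm_num
    obtain ⟨t, ht, ht'⟩ := (hev.and (Ioo_mem_nhdsGT (zero_lt_one' ℝ))).exists
    exact ⟨t, ht, ht'.1, ht'.2⟩
  have hxK : γ t ∈ hull K := by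
    refine (mem_hull_iff_bary hnK).2 fun v hv => ?_
    rw [hKu] at hv
    rcases Finset.mem_insert.1 hv with rfl | hv
    · rw [hγ, hmK, if_neg hu]
      nlinarith
    · exact (ht v hv).le
  have hxL : γ t ∈ hull L := (convex_hull L).lineMap_mem (hull_mono hFL (mem_hull.2
    ⟨fun _ => 1 / 3, fun _ _ => by norm_num, hwt, rfl⟩))
    (subset_hull (hLw ▸ Finset.mem_insert_self w F)) ⟨ht0.le, ht1.le⟩
  have hxF : γ t ∈ hull F := hinter ▸ h𝒯.conforming K hK L hL ⟨hxK, hxL⟩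
  have := bary_eq_zero_of_mem_hull hnL hFL hxF hw
  rw [hγL] at this
  exact ht0.ne' this

/-- A face lies in at most two tetrahedra. -/
lemma IsTetMesh.card_tets_of_face (h𝒯 : IsTetMesh 𝒯) {F : Finset E3} (hF : F ∈ faces 𝒯) :
    (𝒯.filter fun K => F ⊆ K).card ≤ 2 := by
  by_contra! hc
  obtain ⟨K, L, M, hK, hL, hM, hKL, hKM, hLM⟩ := Finset.two_lt_card_iff.1 hc
  rw [Finset.mem_filter] at hK hL hM
  have hF3 : F.card = 3 := card_of_mem_simplices hF
  obtain ⟨u, hu, hKu⟩ := exists_eq_insert_of_card_succ hK.2 (by rw [h𝒯.card_eq K hK.1, hF3])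
  obtain ⟨v, hv, hLv⟩ := exists_eq_insert_of_card_succ hL.2 (by rw [h𝒯.card_eq L hL.1, hF3])
  obtain ⟨w, hw, hMw⟩ := exists_eq_insert_of_card_succ hM.2 (by rw [h𝒯.card_eq M hM.1, hF3])
  have h1 := h𝒯.bary_neg hK.1 hM.1 hKM hF3 hu hKu hw hMw
  have h2 := h𝒯.bary_neg hL.1 hM.1 hLM hF3 hv hLv hw hMw
  have h3 := h𝒯.bary_neg hL.1 hK.1 hKL.symm hF3 hv hLv hu hKu
  -- the coordinate of `v` is a multiple of that of `u`, since both vanish on `F`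
  have h4 := affine_eq_sum_bary (h𝒯.nondeg hK.1) (bary L v) w
  rw [Finset.sum_eq_single_of_mem u (hKu ▸ Finset.mem_insert_self u F) fun q hq hqu => ?_,
    smul_eq_mul] at h4
  · nlinarith
  · have hqF : q ∈ F := by
      rw [hKu] at hq
      exact (Finset.mem_insert.1 hq).resolve_left hqu
    rw [bary_vertex (h𝒯.nondeg hL.1) v (hL.2 hqF), if_neg (fun h : v = q => hv (h ▸ hqF)), smul_zero]

/-- The pairs of a tetrahedron and one of its faces are counted in two ways. -/
lemma IsTetMesh.two_mul_card_faces (h𝒯 : IsTetMesh 𝒯) :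
    2 * (faces 𝒯).card = 4 * 𝒯.card + (bdryFaces 𝒯).card := by
  have h1 := Finset.sum_card_bipartiteAbove_eq_sum_card_bipartiteBelow (s := faces 𝒯) (t := 𝒯)
    (fun F K => F ⊆ K)
  have h2 : ∑ K ∈ 𝒯, ((faces 𝒯).bipartiteBelow (fun F K => F ⊆ K) K).card = 4 * 𝒯.card := by
    rw [Finset.sum_const_nat (m := 4), mul_comm]
    intro K hK
    have : (faces 𝒯).bipartiteBelow (fun F K => F ⊆ K) K = K.powersetCard 3 := by
      ext F
      simp only [Finset.mem_bipartiteBelow, Finset.mem_powersetCard]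
      exact ⟨fun h => ⟨h.2, card_of_mem_simplices h.1⟩, fun h =>
        ⟨mem_simplices.2 ⟨K, hK, Finset.mem_powersetCard.2 h⟩, h.1⟩⟩
    rw [this, Finset.card_powersetCard, h𝒯.card_eq K hK]
    rfl
  have h3 : ∑ F ∈ faces 𝒯, ((𝒯.bipartiteAbove (fun F K => F ⊆ K) F).card +
      if (𝒯.filter fun K => F ⊆ K).card = 1 then 1 else 0) = (faces 𝒯).card * 2 := by
    refine Finset.sum_const_nat fun F hF => ?_
    have hle := h𝒯.card_tets_of_face hF
    have hpos : 0 < (𝒯.filter fun K => F ⊆ K).card := by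
      obtain ⟨K, hK, hFK⟩ := mem_simplices.1 hF
      exact Finset.card_pos.2 ⟨K, Finset.mem_filter.2 ⟨hK, (Finset.mem_powersetCard.1 hFK).1⟩⟩
    change (𝒯.filter fun K => F ⊆ K).card + _ = 2
    split_ifs <;> omega
  rw [Finset.sum_add_distrib, h1, h2, ← Finset.card_filter] at h3
  change 4 * 𝒯.card + (bdryFaces 𝒯).card = _ at h3
  omega

lemma IsTetMesh.vertices_nonempty (h𝒯 : IsTetMesh 𝒯) : (vertices 𝒯).Nonempty := by
  obtain ⟨K, hK⟩ := h𝒯.nonempty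
  obtain ⟨v, hv⟩ := Finset.card_pos.1 (by rw [h𝒯.card_eq K hK]; norm_num : 0 < K.card)
  exact ⟨v, mem_vertices.2 ⟨K, hK, hv⟩⟩

lemma IsTetMesh.avgEdges_mul_card (h𝒯 : IsTetMesh 𝒯) :
    avgEdges 𝒯 * (vertices 𝒯).card = 2 * (edges 𝒯).card := by
  have hV : ((vertices 𝒯).card : ℝ) ≠ 0 :=
    Nat.cast_ne_zero.2 (Finset.card_pos.2 h𝒯.vertices_nonempty).ne'
  have h1 := Finset.sum_card_bipartiteAbove_eq_sum_card_bipartiteBelow (s := vertices 𝒯)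
    (t := edges 𝒯) (fun v e => v ∈ e)
  have h2 : ∑ e ∈ edges 𝒯, ((vertices 𝒯).bipartiteBelow (fun v e => v ∈ e) e).card =
      (edges 𝒯).card * 2 := by
    refine Finset.sum_const_nat fun e he => ?_
    have : (vertices 𝒯).bipartiteBelow (fun v e => v ∈ e) e = e := by
      ext v
      simp only [Finset.mem_bipartiteBelow]
      exact ⟨fun h => h.2, fun h => ⟨mem_vertices_of_mem_simplex he h, h⟩⟩
    rw [this, card_of_mem_simplices he]
  rw [h2] at h1
  have h3 : ∑ v ∈ vertices 𝒯, (((edges 𝒯).filter fun e => v ∈ e).card : ℝ) =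
      (edges 𝒯).card * 2 := by exact_mod_cast h1
  rw [avgEdges, h3]
  field_simp

/-- The pairs of a boundary face and one of its edges are counted in two ways. -/
lemma HasClosedSurfaceBoundary.two_mul_card_edges (h : HasClosedSurfaceBoundary 𝒯) :
    2 * (bdryEdges 𝒯).card = 3 * (bdryFaces 𝒯).card := by
  have h1 := Finset.sum_card_bipartiteAbove_eq_sum_card_bipartiteBelow (s := bdryEdges 𝒯)
    (t := bdryFaces 𝒯) (fun e F => e ⊆ F)
  have h2 : ∑ F ∈ bdryFaces 𝒯, ((bdryEdges 𝒯).bipartiteBelow (fun e F => e ⊆ F) F).card =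
      (bdryFaces 𝒯).card * 3 := by
    refine Finset.sum_const_nat fun F hF => ?_
    have : (bdryEdges 𝒯).bipartiteBelow (fun e F => e ⊆ F) F = F.powersetCard 2 := by
      ext e
      simp only [Finset.mem_bipartiteBelow, Finset.mem_powersetCard]
      exact ⟨fun h => ⟨h.2, card_of_mem_simplices h.1⟩, fun h =>
        ⟨mem_simplices.2 ⟨F, hF, Finset.mem_powersetCard.2 h⟩, h.1⟩⟩
    rw [this, Finset.card_powersetCard, card_of_mem_simplices (Finset.mem_filter.1 hF).1]
    rfl
  have h3 : ∑ e ∈ bdryEdges 𝒯, ((bdryFaces 𝒯).bipartiteAbove (fun e F => e ⊆ F) e).card =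
      (bdryEdges 𝒯).card * 2 := Finset.sum_const_nat fun e he => h e he
  rw [h2, h3] at h1
  omega

/-- The bound for the gap in terms of the Euler characteristics. -/
theorem WorseyFarin.gap_of_closedSurface (h𝒯 : IsTetMesh 𝒯) (hb : HasClosedSurfaceBoundary 𝒯)
    (W : WorseyFarin 𝒯) :
    (5 * avgEdges 𝒯 - 22) * ((vertices 𝒯).card : ℝ) - 6 * ((bdryVertices 𝒯).card : ℝ)
        + 13 * (eulerChar 𝒯 : ℝ) + 6 * (bdryEulerChar 𝒯 : ℝ) ≤
      (Module.finrank ℝ (Z W.split 2) : ℝ) - Module.finrank ℝ (curlS W.split 3) := by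
  have h1 := W.gap h𝒯
  have h2 : (2 * (faces 𝒯).card : ℝ) = 4 * 𝒯.card + (bdryFaces 𝒯).card := by
    exact_mod_cast h𝒯.two_mul_card_faces
  have h3 := h𝒯.avgEdges_mul_card
  have h4 : (2 * (bdryEdges 𝒯).card : ℝ) = 3 * (bdryFaces 𝒯).card := by
    exact_mod_cast hb.two_mul_card_edges
  rw [eulerChar, bdryEulerChar]
  push_cast
  linarith

/-- The form of the bound that is used when the boundary terms are not controlled by Euler
characteristics. -/
lemma WorseyFarin.gap_of_le (h𝒯 : IsTetMesh 𝒯) (W : WorseyFarin 𝒯) {δ : ℝ}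
    (h : 0 ≤ 13 * ((vertices 𝒯).card : ℝ) - 13 * (edges 𝒯).card + 7 * (faces 𝒯).card - 𝒯.card +
      δ * (vertices 𝒯).card) :
    (5 * avgEdges 𝒯 - 22 - δ) * ((vertices 𝒯).card : ℝ) ≤
      (Module.finrank ℝ (Z W.split 2) : ℝ) - Module.finrank ℝ (curlS W.split 3) := by
  have h1 := W.gap h𝒯
  have h3 := h𝒯.avgEdges_mul_card
  linarith

end TetMesh

namespace TetMesh

/-! ### Freudenthal meshes -/

/-- The grid point with integer coordinates `g`. -/
noncomputable def gridPoint (o : E3) (h : Fin 3 → ℝ) (g : Fin 3 → ℤ) : E3 :=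
  o + WithLp.toLp 2 fun i => h i * (g i : ℝ)

lemma gridPoint_apply (o : E3) (h : Fin 3 → ℝ) (g : Fin 3 → ℤ) (i : Fin 3) :
    gridPoint o h g i = o i + h i * g i := rfl

lemma gridPoint_injective (o : E3) {h : Fin 3 → ℝ} (hh : ∀ i, 0 < h i) :
    Function.Injective (gridPoint o h) := by
  intro g g' hg
  funext i
  have := congrArg (fun p : E3 => p i) hg
  simp only [gridPoint_apply, add_right_inj] at this
  exact_mod_cast mul_left_cancel₀ (hh i).ne' this

lemma kuhnVertex_apply (o : E3) (h : Fin 3 → ℝ) (c : Fin 3 → ℕ) (σ : Equiv.Perm (Fin 3)) (j : ℕ)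
    (i : Fin 3) : kuhnVertex o h c σ j i = o i + h i * ((c i : ℝ) + if (σ i : ℕ) < j then 1 else 0) :=
  rfl

lemma kuhnVertex_eq_gridPoint (o : E3) (h : Fin 3 → ℝ) (c : Fin 3 → ℕ) (σ : Equiv.Perm (Fin 3))
    (j : ℕ) : kuhnVertex o h c σ j =
      gridPoint o h fun i => (c i : ℤ) + if (σ i : ℕ) < j then 1 else 0 := by
  ext i
  rw [kuhnVertex_apply, gridPoint_apply]
  push_cast
  rfl

/-- The Kuhn simplex of the permutation `σ` in the cell `c`. -/
noncomputable def kuhn (o : E3) (h : Fin 3 → ℝ) (c : Fin 3 → ℕ) (σ : Equiv.Perm (Fin 3)) :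
    Finset E3 := (Finset.range 4).image (kuhnVertex o h c σ)

lemma mem_freudenthal {o : E3} {h : Fin 3 → ℝ} {N : Fin 3 → ℕ} {K : Finset E3} :
    K ∈ freudenthal o h N ↔ ∃ c : Fin 3 → ℕ, (∀ i, c i < N i) ∧ ∃ σ, kuhn o h c σ = K := by
  simp [freudenthal, kuhn, Fintype.mem_piFinset]

section

variable {o : E3} {h : Fin 3 → ℝ} {N : Fin 3 → ℕ}

lemma kuhnVertex_injOn (hh : ∀ i, 0 < h i) (c : Fin 3 → ℕ) (σ : Equiv.Perm (Fin 3)) :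
    Set.InjOn (kuhnVertex o h c σ) (Finset.range 4 : Finset ℕ) := by
  have key : ∀ j k : ℕ, j < k → k < 4 → kuhnVertex o h c σ j ≠ kuhnVertex o h c σ k := by
    intro j k hjk hk he
    have := congrArg (fun p : E3 => p (σ.symm ⟨j, by omega⟩)) he
    simp only [kuhnVertex_apply, Equiv.apply_symm_apply, lt_irrefl, if_false, hjk, if_true,
      add_right_inj, add_zero] at this
    have := mul_left_cancel₀ (hh _).ne' this
    linarith
  intro j hj k hk he
  rw [Finset.mem_coe, Finset.mem_range] at hj hk
  rcases lt_trichotomy j k with hjk | hjk | hjk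
  · exact (key j k hjk hk he).elim
  · exact hjk
  · exact (key k j hjk hj he.symm).elim

lemma kuhn_nondeg (hh : ∀ i, 0 < h i) (c : Fin 3 → ℕ) (σ : Equiv.Perm (Fin 3)) :
    Nondeg (kuhn o h c σ) := by
  refine nondeg_of_functional ?_ fun L hL => ?_
  · rw [kuhn, Finset.card_image_of_injOn (kuhnVertex_injOn hh c σ), Finset.card_range]
  · -- consecutive vertices differ by a multiple of a unit vector
    have hstep : ∀ i, L (EuclideanSpace.single i 1) = 0 := by
      intro i
      have hmem : ∀ j : ℕ, j < 4 → kuhnVertex o h c σ j ∈ kuhn o h c σ := fun j hj =>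
        Finset.mem_image_of_mem _ (Finset.mem_range.2 hj)
      have hd : kuhnVertex o h c σ (σ i + 1) - kuhnVertex o h c σ (σ i) =
          h i • EuclideanSpace.single i (1 : ℝ) := by
        ext k
        rw [PiLp.sub_apply, kuhnVertex_apply, kuhnVertex_apply, PiLp.smul_apply,
          PiLp.single_apply]
        by_cases hk : k = i
        · subst hk; simp; ring
        · have hne : (σ k : ℕ) ≠ σ i := fun he => hk (σ.injective (Fin.ext he))
          have hiff : (σ k : ℕ) < σ i + 1 ↔ (σ k : ℕ) < σ i := by omega
          simp [hk, hiff]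
      have h1 := hL _ (hmem (σ i + 1) (by omega)) _ (hmem (σ i) (by omega))
      rw [← sub_eq_zero, ← map_sub, hd, map_smul, smul_eq_mul] at h1
      exact (mul_eq_zero.1 h1).resolve_left (hh i).ne'
    refine (EuclideanSpace.basisFun (Fin 3) ℝ).toBasis.ext fun i => ?_
    simpa using hstep i

/-- The part of the unit mass `w` on the vertices of a Kuhn simplex that lies beyond the step `k`. -/
noncomputable def tailMass (w : ℕ → ℝ) (k : ℕ) : ℝ := ∑ j ∈ Finset.range 4, if k < j then w j else 0

/-- A point of a Kuhn simplex in grid coordinates. -/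
lemma exists_of_mem_hull_kuhn (hh : ∀ i, 0 < h i) {c : Fin 3 → ℕ} {σ : Equiv.Perm (Fin 3)} {x : E3}
    (hx : x ∈ hull (kuhn o h c σ)) :
    ∃ w : ℕ → ℝ, (∀ j ∈ Finset.range 4, 0 ≤ w j) ∧ ∑ j ∈ Finset.range 4, w j = 1 ∧
      ∑ j ∈ Finset.range 4, w j • kuhnVertex o h c σ j = x ∧
      ∀ i, (x i - o i) / h i = c i + tailMass w (σ i) := by
  obtain ⟨w, h0, h1, h2⟩ := mem_hull.1 hx
  rw [kuhn, Finset.sum_image (kuhnVertex_injOn hh c σ)] at h1 h2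
  refine ⟨fun j => w (kuhnVertex o h c σ j), fun j hj => h0 _ (Finset.mem_image_of_mem _ hj), h1,
    h2, fun i => ?_⟩
  rw [div_eq_iff (hh i).ne', ← h2]
  simp only [WithLp.ofLp_sum, Finset.sum_apply, PiLp.smul_apply, kuhnVertex_apply, smul_eq_mul,
    tailMass]
  have : ∀ j ∈ Finset.range 4, w (kuhnVertex o h c σ j) *
      (o i + h i * ((c i : ℝ) + if (σ i : ℕ) < j then 1 else 0)) =
      w (kuhnVertex o h c σ j) * (o i + h i * c i) +
        h i * if (σ i : ℕ) < j then w (kuhnVertex o h c σ j) else 0 := fun j _ => by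
    split_ifs <;> ring
  rw [Finset.sum_congr rfl this, Finset.sum_add_distrib, ← Finset.sum_mul, h1, ← Finset.mul_sum]
  ring

lemma tailMass_antitone {w : ℕ → ℝ} (h0 : ∀ j ∈ Finset.range 4, 0 ≤ w j) {k l : ℕ} (hkl : k ≤ l) :
    tailMass w l ≤ tailMass w k := by
  refine Finset.sum_le_sum fun j hj => ?_
  have := h0 j hj
  split_ifs <;> first | omega | linarith

lemma tailMass_nonneg {w : ℕ → ℝ} (h0 : ∀ j ∈ Finset.range 4, 0 ≤ w j) (k : ℕ) :
    0 ≤ tailMass w k :=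
  Finset.sum_nonneg fun j hj => by
    have := h0 j hj
    split_ifs <;> first | exact le_rfl | exact this

lemma tailMass_add_le {w : ℕ → ℝ} (h0 : ∀ j ∈ Finset.range 4, 0 ≤ w j) {j : ℕ}
    (hj : j ∈ Finset.range 4) :
    tailMass w j + w j ≤ ∑ l ∈ Finset.range 4, w l ∧ ∀ k < j, tailMass w j + w j ≤ tailMass w k := by
  have hs : tailMass w j + w j =
      ∑ l ∈ Finset.range 4, ((if j < l then w l else 0) + if l = j then w l else 0) := by
    rw [Finset.sum_add_distrib, Finset.sum_ite_eq' _ j, if_pos hj, tailMass]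
  rw [hs]
  refine ⟨Finset.sum_le_sum fun l hl => ?_, fun k hk => Finset.sum_le_sum fun l hl => ?_⟩ <;>
  · have := h0 l hl
    split_ifs <;> first | omega | linarith

lemma ceil_nat_add_sub (n : ℕ) {s θ : ℝ} (hs : 0 ≤ s) (hs' : s ≤ 1) (hθ : 0 ≤ θ) (hθ' : θ < 1) :
    ⌈(n : ℝ) + s - θ⌉ = (n : ℤ) + if θ < s then 1 else 0 := by
  rw [Int.ceil_eq_iff]
  split_ifs <;> push_cast <;> constructor <;> linarith

/-- Conformity of the Kuhn simplices. In grid coordinates `y`, a point `x` lies in the relative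
interior of the simplex whose vertices are the points `⌈y - θ⌉` with `0 ≤ θ < 1`, and these do not
depend on the Kuhn simplex that contains `x`. -/
lemma kuhn_conforming (hh : ∀ i, 0 < h i) (c c' : Fin 3 → ℕ) (σ σ' : Equiv.Perm (Fin 3)) :
    hull (kuhn o h c σ) ∩ hull (kuhn o h c' σ') ⊆ hull (kuhn o h c σ ∩ kuhn o h c' σ') := by
  rintro x ⟨hx, hx'⟩
  obtain ⟨w, h0, h1, h2, hy⟩ := exists_of_mem_hull_kuhn hh hx
  obtain ⟨w', h0', h1', -, hy'⟩ := exists_of_mem_hull_kuhn hh hx'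
  have hle : ∀ {w : ℕ → ℝ}, (∀ j ∈ Finset.range 4, 0 ≤ w j) → ∑ j ∈ Finset.range 4, w j = 1 →
      ∀ k, tailMass w k ≤ 1 := fun {w} h0 h1 k => by
    rw [← h1]
    refine Finset.sum_le_sum fun j hj => ?_
    have := h0 j hj
    split_ifs <;> first | exact le_rfl | exact this
  have hmem : ∀ j ∈ Finset.range 4, w j ≠ 0 → kuhnVertex o h c σ j ∈ kuhn o h c' σ' := by
    intro j hj hwj
    have hwj' : 0 < w j := lt_of_le_of_ne (h0 j hj) hwj.symm
    obtain ⟨hs1, hs2⟩ := tailMass_add_le h0 hj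
    set θ := tailMass w j with hθ
    have hθ0 : 0 ≤ θ := tailMass_nonneg h0 j
    have hθ1 : θ < 1 := by linarith
    have e1 : ∀ i, ⌈(x i - o i) / h i - θ⌉ = (c i : ℤ) + if (σ i : ℕ) < j then 1 else 0 := by
      intro i
      rw [hy i, ceil_nat_add_sub _ (tailMass_nonneg h0 _) (hle h0 h1 _) hθ0 hθ1]
      have : θ < tailMass w (σ i) ↔ (σ i : ℕ) < j := by
        refine ⟨fun hlt => ?_, fun hlt => by linarith [hs2 _ hlt]⟩
        by_contra! hge
        exact hlt.not_ge (tailMass_antitone h0 hge)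
      simp only [this]
    -- the step of the second simplex at which the tail mass drops to `θ`
    obtain ⟨k, hk, hk'⟩ : ∃ k ∈ Finset.range 4, ∀ i : Fin 3, θ < tailMass w' (i : ℕ) ↔ (i : ℕ) < k := by
      have a1 := tailMass_antitone h0' (zero_le_one (α := ℕ))
      have a2 := tailMass_antitone h0' (one_le_two (α := ℕ))
      by_cases t0 : θ < tailMass w' 0
      · by_cases t1 : θ < tailMass w' 1
        · by_cases t2 : θ < tailMass w' 2
          · exact ⟨3, by simp, fun i => by fin_cases i <;> simp [t0, t1, t2]⟩
          · exact ⟨2, by simp, fun i => by fin_cases i <;> simp [t0, t1, t2]⟩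
        · have t2 : ¬ θ < tailMass w' 2 := by linarith
          exact ⟨1, by simp, fun i => by fin_cases i <;> simp_all⟩
      · have t1 : ¬ θ < tailMass w' 1 := by linarith
        have t2 : ¬ θ < tailMass w' 2 := by linarith
        exact ⟨0, by simp, fun i => by fin_cases i <;> simp_all⟩
    have e2 : ∀ i, ⌈(x i - o i) / h i - θ⌉ = (c' i : ℤ) + if (σ' i : ℕ) < k then 1 else 0 := by
      intro i
      rw [hy' i, ceil_nat_add_sub _ (tailMass_nonneg h0' _) (hle h0' h1' _) hθ0 hθ1]
      simp only [hk' (σ' i)]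
    have : kuhnVertex o h c σ j = kuhnVertex o h c' σ' k := by
      rw [kuhnVertex_eq_gridPoint, kuhnVertex_eq_gridPoint]
      congr 1
      funext i
      rw [← e1, e2]
    rw [this]
    exact Finset.mem_image_of_mem _ hk
  rw [← Finset.sum_filter_of_ne (p := fun j => w j ≠ 0) fun j _ hj hw => hj (by rw [hw, zero_smul])]
    at h2
  rw [← Finset.sum_filter_of_ne (p := fun j => w j ≠ 0) fun j _ hj => hj] at h1
  rw [← h2]
  refine (convex_hull _).sum_mem (fun j hj => h0 j (Finset.mem_filter.1 hj).1) h1 fun j hj => ?_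
  obtain ⟨hj, hwj⟩ := Finset.mem_filter.1 hj
  exact subset_hull (Finset.mem_inter.2 ⟨Finset.mem_image_of_mem _ hj, hmem j hj hwj⟩)

lemma isTetMesh_freudenthal (hh : ∀ i, 0 < h i) (hN : ∀ i, 0 < N i) :
    IsTetMesh (freudenthal o h N) where
  nonempty := ⟨_, mem_freudenthal.2 ⟨0, hN, 1, rfl⟩⟩
  card_eq K hK := by
    obtain ⟨c, -, σ, rfl⟩ := mem_freudenthal.1 hK
    exact (kuhn_nondeg hh c σ).1
  indep K hK := by
    obtain ⟨c, -, σ, rfl⟩ := mem_freudenthal.1 hK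
    exact (kuhn_nondeg hh c σ).2
  conforming K hK L hL := by
    obtain ⟨c, -, σ, rfl⟩ := mem_freudenthal.1 hK
    obtain ⟨c', -, σ', rfl⟩ := mem_freudenthal.1 hL
    exact kuhn_conforming hh c c' σ σ'

/-- A Kuhn simplex determines its cell and its permutation, which can be read off the coordinates
of its centroid. -/
lemma kuhn_injective (hh : ∀ i, 0 < h i) {c c' : Fin 3 → ℕ} {σ σ' : Equiv.Perm (Fin 3)}
    (he : kuhn o h c σ = kuhn o h c' σ') : c = c' ∧ σ = σ' := by
  have hsum : ∀ (c : Fin 3 → ℕ) (σ : Equiv.Perm (Fin 3)) (i : Fin 3),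
      ∑ q ∈ kuhn o h c σ, q i = 4 * o i + h i * ((4 * (c i : ℤ) + (3 - (σ i : ℕ) : ℤ) : ℤ) : ℝ) := by
    intro c σ i
    rw [kuhn, Finset.sum_image (kuhnVertex_injOn hh c σ)]
    simp only [Finset.sum_range_succ, Finset.sum_range_zero, kuhnVertex_apply]
    generalize σ i = k
    fin_cases k <;> norm_num <;> ring
  have key : ∀ i, 4 * (c i : ℤ) + (3 - (σ i : ℕ) : ℤ) = 4 * (c' i : ℤ) + (3 - (σ' i : ℕ) : ℤ) := by
    intro i
    have h1 := hsum c σ i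
    rw [he, hsum c' σ' i, add_right_inj] at h1
    exact_mod_cast (mul_left_cancel₀ (hh i).ne' h1).symm
  refine ⟨funext fun i => ?_, Equiv.ext fun i => Fin.ext ?_⟩ <;>
  · have := key i
    have h3 := (σ i).2
    have h3' := (σ' i).2
    omega

lemma card_freudenthal (hh : ∀ i, 0 < h i) : (freudenthal o h N).card = 6 * ∏ i, N i := by
  have : freudenthal o h N = ((Fintype.piFinset fun i => Finset.range (N i)) ×ˢ
      (Finset.univ : Finset (Equiv.Perm (Fin 3)))).image fun q => kuhn o h q.1 q.2 := by
    ext K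
    simp [mem_freudenthal, Fintype.mem_piFinset]
  rw [this, Finset.card_image_of_injective, Finset.card_product, Fintype.card_piFinset,
    Finset.card_univ, Fintype.card_perm]
  · simp [mul_comm, Nat.factorial]
  · rintro ⟨c, σ⟩ ⟨c', σ'⟩ he
    obtain ⟨rfl, rfl⟩ := kuhn_injective hh he
    rfl

lemma le_card_vertices_freudenthal (hh : ∀ i, 0 < h i) :
    ∏ i, N i ≤ (vertices (freudenthal o h N)).card := by
  have hinj : Function.Injective fun c : Fin 3 → ℕ => gridPoint o h fun i => (c i : ℤ) := by
    intro c c' he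
    have := gridPoint_injective o hh he
    funext i
    exact_mod_cast congrFun this i
  have hc : (Fintype.piFinset fun i => Finset.range (N i)).card = ∏ i, N i := by
    simp [Fintype.card_piFinset]
  rw [← hc, ← Finset.card_image_of_injective _ hinj]
  refine Finset.card_le_card fun p hp => ?_
  obtain ⟨c, hcN, rfl⟩ := Finset.mem_image.1 hp
  simp only [Fintype.mem_piFinset, Finset.mem_range] at hcN
  refine mem_vertices.2 ⟨_, mem_freudenthal.2 ⟨c, hcN, 1, rfl⟩, Finset.mem_image.2 ⟨0, by simp, ?_⟩⟩
  rw [kuhnVertex_eq_gridPoint]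
  simp

lemma card_vertices_freudenthal_le :
    (vertices (freudenthal o h N)).card ≤ ∏ i, (N i + 1) := by
  have hc : (Fintype.piFinset fun i => Finset.range (N i + 1)).card = ∏ i, (N i + 1) := by
    simp [Fintype.card_piFinset]
  rw [← hc]
  refine (Finset.card_le_card (t := (Fintype.piFinset fun i => Finset.range (N i + 1)).image
    fun c : Fin 3 → ℕ => gridPoint o h fun i => (c i : ℤ)) fun p hp => ?_).trans
    Finset.card_image_le
  obtain ⟨K, hK, hpK⟩ := mem_vertices.1 hp
  obtain ⟨c, hcN, σ, rfl⟩ := mem_freudenthal.1 hK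
  obtain ⟨j, -, rfl⟩ := Finset.mem_image.1 hpK
  refine Finset.mem_image.2 ⟨fun i => c i + if (σ i : ℕ) < j then 1 else 0, ?_, ?_⟩
  · rw [Fintype.mem_piFinset]
    intro i
    have := hcN i
    rw [Finset.mem_range]
    split_ifs <;> omega
  · rw [kuhnVertex_eq_gridPoint]
    push_cast
    rfl

/-- The edges of a Freudenthal mesh have only seven directions. -/
lemma card_edges_freudenthal_le :
    (edges (freudenthal o h N)).card ≤ 7 * (vertices (freudenthal o h N)).card := by
  let D : Finset (Fin 3 → Bool) := Finset.univ.erase fun _ => false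
  have hD : D.card = 7 := by
    rw [Finset.card_erase_of_mem (Finset.mem_univ _), Finset.card_univ]
    simp
  let f : E3 × (Fin 3 → Bool) → Finset E3 := fun q =>
    {q.1, q.1 + WithLp.toLp 2 fun i => h i * if q.2 i then 1 else 0}
  rw [← hD, mul_comm, ← Finset.card_product]
  refine (Finset.card_le_card (t := ((vertices (freudenthal o h N)) ×ˢ D).image f)
    fun e he => ?_).trans Finset.card_image_le
  obtain ⟨K, hK, heK⟩ := mem_simplices.1 he
  obtain ⟨a, ha, b, hb, hba, rfl⟩ := exists_pair_of_mem_powersetCard heK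
  obtain ⟨c, hcN, σ, rfl⟩ := mem_freudenthal.1 hK
  have key : ∀ j k : ℕ, j ∈ Finset.range 4 → j ≤ k →
      kuhnVertex o h c σ k ≠ kuhnVertex o h c σ j →
      {kuhnVertex o h c σ j, kuhnVertex o h c σ k} ∈
        ((vertices (freudenthal o h N)) ×ˢ D).image f := by
    intro j k hj hjk hne
    let d : Fin 3 → Bool := fun i => decide (j ≤ (σ i : ℕ) ∧ (σ i : ℕ) < k)
    have hk : kuhnVertex o h c σ k = kuhnVertex o h c σ j +
        WithLp.toLp 2 fun i => h i * if d i then 1 else 0 := by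
      ext i
      rw [PiLp.add_apply, kuhnVertex_apply, kuhnVertex_apply]
      simp only [d, decide_eq_true_eq]
      split_ifs <;> first | omega | ring
    refine Finset.mem_image.2 ⟨(kuhnVertex o h c σ j, d), Finset.mem_product.2
      ⟨mem_vertices.2 ⟨_, hK, Finset.mem_image_of_mem _ hj⟩, ?_⟩, ?_⟩
    · refine Finset.mem_erase.2 ⟨fun hd => hne ?_, Finset.mem_univ _⟩
      have hd' : d = fun _ => false := hd
      rw [hk, hd']
      ext i
      simp
    · simp only [f]
      rw [← hk]
  obtain ⟨j, hj, rfl⟩ := Finset.mem_image.1 ha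
  obtain ⟨k, hk, rfl⟩ := Finset.mem_image.1 hb
  rcases le_total j k with hjk | hjk
  · exact key j k hj hjk hba
  · rw [Finset.pair_comm]
    exact key k j hk hjk hba.symm

end

/-- For large boxes the numbers of cells and of grid points have ratio close to one. -/
lemma prod_succ_le {n : ℕ} (hn : 0 < n) {N : Fin 3 → ℕ} (hN : ∀ i, n ≤ N i) :
    ((∏ i, (N i + 1) : ℕ) : ℝ) ≤ (1 + 7 / n) * ((∏ i, N i : ℕ) : ℝ) := by
  have hn' : (1 : ℝ) ≤ n := by exact_mod_cast hn
  have hi : ∀ i, ((N i : ℝ) + 1) ≤ (1 + 1 / n) * N i := fun i => by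
    have : (n : ℝ) ≤ N i := by exact_mod_cast hN i
    have h1 : (1 : ℝ) ≤ 1 / n * N i := by
      rw [div_mul_eq_mul_div, one_mul, le_div_iff₀ (by linarith), one_mul]; exact this
    linarith
  push_cast
  calc ∏ i, ((N i : ℝ) + 1) ≤ ∏ i, ((1 + 1 / (n : ℝ)) * N i) :=
        Finset.prod_le_prod (fun i _ => by positivity) fun i _ => hi i
    _ = (1 + 1 / (n : ℝ)) ^ 3 * ∏ i, (N i : ℝ) := by
        rw [Finset.prod_mul_distrib, Finset.prod_const]; rfl
    _ ≤ (1 + 7 / n) * ∏ i, (N i : ℝ) := by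
        refine mul_le_mul_of_nonneg_right ?_ (Finset.prod_nonneg fun i _ => by positivity)
        have h0 : 0 ≤ 1 / (n : ℝ) := by positivity
        have h1 : 1 / (n : ℝ) ≤ 1 := by rw [div_le_one (by linarith)]; exact hn'
        have h7 : 7 / (n : ℝ) = 7 * (1 / n) := by ring
        rw [h7]
        generalize 1 / (n : ℝ) = t at h0 h1
        nlinarith [mul_nonneg h0 h0, mul_nonneg h0 (sub_nonneg.2 h1),
          mul_nonneg (mul_nonneg h0 h0) (sub_nonneg.2 h1)]

/-- On large Freudenthal meshes there are about six tetrahedra and at most seven edges for each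
vertex. -/
theorem gap_freudenthal {δ : ℝ} (hδ : 0 < δ) : ∃ n₀ : ℕ, ∀ (o : E3) (h : Fin 3 → ℝ)
    (N : Fin 3 → ℕ), (∀ i, 0 < h i) → (∀ i, n₀ ≤ N i) → ∀ W : WorseyFarin (freudenthal o h N),
      curlS W.split 3 < Z W.split 2 ∧
      (5 * avgEdges (freudenthal o h N) - 22 - δ) * ((vertices (freudenthal o h N)).card : ℝ) ≤
        (Module.finrank ℝ (Z W.split 2) : ℝ) - Module.finrank ℝ (curlS W.split 3) := by
  obtain ⟨n, hn⟩ := exists_nat_gt (max 7 (546 / δ))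
  have hn7 : (7 : ℝ) < n := (le_max_left _ _).trans_lt hn
  have hnδ : 546 / δ < n := (le_max_right _ _).trans_lt hn
  have hn0 : 0 < n := by exact_mod_cast (by linarith : (0 : ℝ) < n)
  refine ⟨n, fun o h N hh hN W => ?_⟩
  have h𝒯 := isTetMesh_freudenthal (o := o) hh fun i => hn0.trans_le (hN i)
  have hF : (2 * (faces (freudenthal o h N)).card : ℝ) = 4 * (freudenthal o h N).card +
      (bdryFaces (freudenthal o h N)).card := by exact_mod_cast h𝒯.two_mul_card_faces
  have hT : ((freudenthal o h N).card : ℝ) = 6 * ((∏ i, N i : ℕ) : ℝ) := by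
    rw [card_freudenthal hh]; push_cast; ring
  have hE : ((edges (freudenthal o h N)).card : ℝ) ≤ 7 * (vertices (freudenthal o h N)).card := by
    exact_mod_cast card_edges_freudenthal_le
  have hV : ((vertices (freudenthal o h N)).card : ℝ) ≤ ((∏ i, (N i + 1) : ℕ) : ℝ) := by
    exact_mod_cast card_vertices_freudenthal_le
  have hV' : ((∏ i, N i : ℕ) : ℝ) ≤ (vertices (freudenthal o h N)).card := by
    exact_mod_cast le_card_vertices_freudenthal hh
  have hprod := prod_succ_le hn0 hN
  have hB : (0 : ℝ) ≤ (bdryFaces (freudenthal o h N)).card := by positivity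
  have hP : (0 : ℝ) < ((∏ i, N i : ℕ) : ℝ) := by
    exact_mod_cast Finset.prod_pos fun i _ => hn0.trans_le (hN i)
  set P : ℝ := ((∏ i, N i : ℕ) : ℝ)
  have ht1 : 7 / (n : ℝ) < 1 := by rw [div_lt_one (by linarith)]; exact hn7
  have ht2 : 78 * (7 / (n : ℝ)) ≤ δ := by
    rw [div_lt_iff₀ hδ] at hnδ
    rw [← mul_div_assoc, div_le_iff₀ (by linarith)]
    linarith
  refine ⟨W.curlS_lt h𝒯 (lt_of_lt_of_le ?_ (W.gap h𝒯)), W.gap_of_le h𝒯 ?_⟩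
  · nlinarith
  · nlinarith [mul_le_mul_of_nonneg_right ht2 hP.le, mul_le_mul_of_nonneg_left hV' hδ.le]

end TetMesh

namespace TetMesh

/-! ### Uniform refinement: counting simplices -/

/-- The vertex mean of a simplex. -/
noncomputable def mean (s : Finset E3) : E3 := ∑ q ∈ s, (s.card : ℝ)⁻¹ • q

lemma sum_inv_card {s : Finset E3} (hs : s.Nonempty) : ∑ _q ∈ s, (s.card : ℝ)⁻¹ = 1 := by
  rw [Finset.sum_const, nsmul_eq_mul, mul_inv_cancel₀]
  exact Nat.cast_ne_zero.2 (Finset.card_pos.2 hs).ne'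

lemma mean_pair {a b : E3} (hab : a ≠ b) : mean {a, b} = midpoint ℝ a b := by
  rw [mean, Finset.sum_pair hab, Finset.card_pair hab, midpoint_eq_smul_add, invOf_eq_inv, smul_add]
  norm_num

lemma mean_mem_hull {s : Finset E3} (hs : s.Nonempty) : mean s ∈ hull s :=
  mem_hull.2 ⟨fun _ => (s.card : ℝ)⁻¹, fun _ _ => by positivity, sum_inv_card hs, rfl⟩

namespace Conf

variable {𝒮 : Finset (Finset E3)}

lemma carrier_mean (h : Conf 𝒮) {T s : Finset E3} (hT : T ∈ 𝒮) (hs : s ⊆ T) (hne : s.Nonempty) :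
    carrier 𝒮 (mean s) = s := by
  have hc : (0 : ℝ) < s.card := Nat.cast_pos.2 (Finset.card_pos.2 hne)
  exact h.carrier_comb hT hs (fun _ _ => inv_pos.2 hc) (sum_inv_card hne)

lemma carrier_mean_simplex (h : Conf 𝒮) {k : ℕ} {s : Finset E3} (hs : s ∈ simplices 𝒮 (k + 1)) :
    carrier 𝒮 (mean s) = s := by
  obtain ⟨T, hT, hsT⟩ := mem_simplices.1 hs
  have := Finset.mem_powersetCard.1 hsT
  exact h.carrier_mean hT this.1 (Finset.card_pos.1 (by omega))

lemma subset_of_mean_mem_hull (h : Conf 𝒮) {T T' s : Finset E3} (hT : T ∈ 𝒮) (hT' : T' ∈ 𝒮)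
    (hs : s ⊆ T) (hne : s.Nonempty) (hx : mean s ∈ hull T') : s ⊆ T' := by
  have hc : (0 : ℝ) < s.card := Nat.cast_pos.2 (Finset.card_pos.2 hne)
  exact h.subset_of_comb_mem_hull hT hT' hs (fun _ _ => inv_pos.2 hc) (sum_inv_card hne) hx

lemma carrier_midpoint (h : Conf 𝒮) {T : Finset E3} (hT : T ∈ 𝒮) {p q : E3} (hp : p ∈ hull T)
    (hq : q ∈ hull T) : carrier 𝒮 (midpoint ℝ p q) = carrier 𝒮 p ∪ carrier 𝒮 q := by
  have hm := (convex_hull T).midpoint_mem hp hq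
  ext v
  rw [Finset.mem_union, h.mem_carrier hT hm, h.mem_carrier hT hp, h.mem_carrier hT hq,
    ← and_or_left, AffineMap.map_midpoint, midpoint_eq_smul_add, invOf_eq_inv, smul_eq_mul]
  have h1 := bary_nonneg (h.nondeg T hT) hp v
  have h2 := bary_nonneg (h.nondeg T hT) hq v
  refine and_congr_right fun _ => ⟨fun h3 => ?_, ?_⟩
  · by_contra! hcon
    linarith
  · rintro (h3 | h3) <;> linarith

end Conf

/-- Affinely independent points in the hull of `s` are at most as many as the points of `s`. -/
lemma card_le_of_subset_hull {K s t : Finset E3} (hK : Nondeg K) (ht : t ⊆ K)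
    (hts : ∀ p ∈ t, p ∈ hull s) : t.card ≤ s.card := by
  have hi : AffineIndependent ℝ ((↑) : t → E3) := hK.2.mono (by exact_mod_cast ht)
  exact hi.card_le_card_of_subset_affineSpan fun p hp =>
    convexHull_subset_affineSpan _ (hts p hp)

namespace IsUniformRefinement

variable {𝒯 𝒯' : Finset (Finset E3)}

/-- The midpoints of the edges of the coarse mesh are distinct, and distinct from its vertices, because
their carriers are the edges. -/
lemma card_vertices (h𝒯 : IsTetMesh 𝒯) (h : IsUniformRefinement 𝒯 𝒯') :
    (vertices 𝒯').card = (vertices 𝒯).card + (edges 𝒯).card := by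
  have hc := h𝒯.conf
  have hinj : Set.InjOn mean (edges 𝒯 : Set (Finset E3)) := fun e he e' he' hee => by
    rw [← hc.carrier_mean_simplex he, ← hc.carrier_mean_simplex he', hee]
  have heq : vertices 𝒯' = vertices 𝒯 ∪ (edges 𝒯).image mean := by
    ext x
    rw [h.mem_vertices, Finset.mem_union, Finset.mem_image]
    refine or_congr_right ⟨?_, ?_⟩
    · rintro ⟨a, b, hab, he, rfl⟩
      exact ⟨_, he, mean_pair hab⟩
    · rintro ⟨e, he, rfl⟩
      obtain ⟨a, b, hab, rfl⟩ := Finset.card_eq_two.1 (card_of_mem_simplices he)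
      exact ⟨a, b, hab, he, mean_pair hab⟩
  rw [heq, Finset.card_union_of_disjoint, Finset.card_image_of_injOn hinj]
  refine Finset.disjoint_left.2 fun x hx hx' => ?_
  obtain ⟨e, he, rfl⟩ := Finset.mem_image.1 hx'
  have h1 := hc.carrier_vertex hx
  rw [hc.carrier_mean_simplex he] at h1
  have := card_of_mem_simplices he
  rw [h1, Finset.card_singleton] at this
  omega

/-- A new tetrahedron lies in only one old tetrahedron, since it is not contained in a common face. -/
lemma le_card (h𝒯 : IsTetMesh 𝒯) (h𝒯' : IsTetMesh 𝒯') (h : IsUniformRefinement 𝒯 𝒯') :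
    8 * 𝒯.card ≤ 𝒯'.card := by
  have h1 : (𝒯.biUnion fun K => 𝒯'.filter fun L => hull L ⊆ hull K).card = 𝒯.card * 8 := by
    rw [Finset.card_biUnion, Finset.sum_const_nat fun K hK => (h.tets_split K hK).1]
    intro K hK L hL hKL
    refine Finset.disjoint_left.2 fun M hM hM' => ?_
    rw [Finset.mem_filter] at hM hM'
    have hle := card_le_of_subset_hull (h𝒯'.nondeg hM.1) (subset_refl M) (s := K ∩ L) fun p hp =>
      h𝒯.conforming K hK L hL ⟨hM.2 (subset_hull hp), hM'.2 (subset_hull hp)⟩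
    rw [h𝒯'.card_eq M hM.1, ← h𝒯.card_eq K hK] at hle
    have e1 := Finset.eq_of_subset_of_card_le Finset.inter_subset_left hle
    refine hKL (Finset.eq_of_subset_of_card_le (Finset.inter_eq_left.1 e1) ?_)
    rw [h𝒯.card_eq K hK, h𝒯.card_eq L hL]
  rw [mul_comm, ← h1]
  refine Finset.card_le_card (Finset.biUnion_subset.2 fun K _ => Finset.filter_subset _ _)

/-- A vertex of the refined mesh in a tetrahedron `K` of the coarse mesh is the midpoint of two,
possibly equal, vertices of `K`. -/
lemma exists_midpoint (h𝒯 : IsTetMesh 𝒯) (h : IsUniformRefinement 𝒯 𝒯') {p : E3}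
    (hp : p ∈ vertices 𝒯') {K : Finset E3} (hK : K ∈ 𝒯) (hpK : p ∈ hull K) :
    ∃ a ∈ K, ∃ b ∈ K, p = midpoint ℝ a b := by
  rcases (h.mem_vertices p).1 hp with hp | ⟨a, b, hab, he, rfl⟩
  · have h1 := h𝒯.conf.carrier_subset hK hpK
    rw [h𝒯.conf.carrier_vertex hp, Finset.singleton_subset_iff] at h1
    exact ⟨p, h1, p, h1, (midpoint_self ℝ p).symm⟩
  · have h1 := h𝒯.conf.carrier_subset hK hpK
    rw [← mean_pair hab, h𝒯.conf.carrier_mean_simplex he] at h1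
    exact ⟨a, h1 (by simp), b, h1 (by simp), rfl⟩

/-- The midpoints of the new edges have barycentric coordinates `(3/4, 1/4)` on an edge,
`(1/2, 1/4, 1/4)` on a face, or `(1/4, 1/4, 1/4, 1/4)` on a tetrahedron of the coarse mesh. -/
lemma card_edges_le (h𝒯 : IsTetMesh 𝒯) (h𝒯' : IsTetMesh 𝒯') (h : IsUniformRefinement 𝒯 𝒯') :
    (edges 𝒯').card ≤ 2 * (edges 𝒯).card + 3 * (faces 𝒯).card + 𝒯.card := by
  have hc' := h𝒯'.conf
  have hinj : Set.InjOn mean (edges 𝒯' : Set (Finset E3)) := fun e he e' he' hee => by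
    rw [← hc'.carrier_mean_simplex he, ← hc'.carrier_mean_simplex he', hee]
  let X₂ : Finset E3 := (edges 𝒯).biUnion fun e =>
    e.image fun v => (1 / 4 : ℝ) • ∑ q ∈ e, q + (1 / 2 : ℝ) • v
  let X₃ : Finset E3 := (faces 𝒯).biUnion fun F =>
    F.image fun v => (1 / 4 : ℝ) • ∑ q ∈ F, q + (1 / 4 : ℝ) • v
  let X₄ : Finset E3 := 𝒯.image fun K => (1 / 4 : ℝ) • ∑ q ∈ K, q
  have c2 : X₂.card ≤ (edges 𝒯).card * 2 := Finset.card_biUnion_le_card_mul _ _ _ fun e he =>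
    Finset.card_image_le.trans (card_of_mem_simplices he).le
  have c3 : X₃.card ≤ (faces 𝒯).card * 3 := Finset.card_biUnion_le_card_mul _ _ _ fun e he =>
    Finset.card_image_le.trans (card_of_mem_simplices he).le
  have c4 : X₄.card ≤ 𝒯.card := Finset.card_image_le
  have hsub : (edges 𝒯').image mean ⊆ X₂ ∪ X₃ ∪ X₄ := by
    intro x hx
    obtain ⟨e, he, rfl⟩ := Finset.mem_image.1 hx
    obtain ⟨K', hK', heK'⟩ := mem_simplices.1 he
    obtain ⟨K, hK, hKK⟩ := h.parent K' hK'
    obtain ⟨p, hp, q, hq, hqp, rfl⟩ := exists_pair_of_mem_powersetCard heK'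
    obtain ⟨a, ha, b, hb, hpab⟩ := h.exists_midpoint h𝒯 (TetMesh.mem_vertices.2 ⟨K', hK', hp⟩) hK
      (hKK (subset_hull hp))
    obtain ⟨c, hcK, d, hd, hqcd⟩ := h.exists_midpoint h𝒯 (TetMesh.mem_vertices.2 ⟨K', hK', hq⟩) hK
      (hKK (subset_hull hq))
    have m2 : ∀ a ∈ K, ∀ b ∈ K, a ≠ b → (3 / 4 : ℝ) • a + (1 / 4 : ℝ) • b ∈ X₂ ∪ X₃ ∪ X₄ := by
      intro a ha b hb hab
      refine Finset.mem_union_left _ (Finset.mem_union_left _ (Finset.mem_biUnion.2 ⟨{a, b},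
        mem_simplices.2 ⟨K, hK, pair_mem_powersetCard ha hb hab.symm⟩,
        Finset.mem_image.2 ⟨a, by simp, ?_⟩⟩))
      rw [Finset.sum_pair hab]
      module
    have m3 : ∀ a ∈ K, ∀ b ∈ K, ∀ c ∈ K, a ≠ b → a ≠ c → b ≠ c →
        (1 / 2 : ℝ) • a + (1 / 4 : ℝ) • b + (1 / 4 : ℝ) • c ∈ X₂ ∪ X₃ ∪ X₄ := by
      intro a ha b hb c hc hab hac hbc
      refine Finset.mem_union_left _ (Finset.mem_union_right _ (Finset.mem_biUnion.2 ⟨{a, b, c},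
        mem_simplices.2 ⟨K, hK, Finset.mem_powersetCard.2 ⟨?_, Finset.card_eq_three.2
          ⟨a, b, c, hab, hac, hbc, rfl⟩⟩⟩, Finset.mem_image.2 ⟨a, by simp, ?_⟩⟩))
      · intro v hv
        simp only [Finset.mem_insert, Finset.mem_singleton] at hv
        rcases hv with rfl | rfl | rfl <;> assumption
      · rw [Finset.sum_insert (by simp [hab, hac]), Finset.sum_pair hbc]
        module
    have hx4 : mean {p, q} = (1 / 4 : ℝ) • (a + b + c + d) := by
      rw [mean_pair hqp.symm, hpab, hqcd]
      simp only [midpoint_eq_smul_add, invOf_eq_inv]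
      module
    rw [hx4]
    by_cases hab : a = b
    · subst hab
      rw [midpoint_self] at hpab
      by_cases hcd : c = d
      · -- the midpoint of a coarse edge is a vertex and not the midpoint of an edge
        subst hcd
        rw [midpoint_self] at hqcd
        have hpq : ({p, q} : Finset E3) ∈ edges 𝒯 :=
          mem_simplices.2 ⟨K, hK, pair_mem_powersetCard (hpab ▸ ha) (hqcd ▸ hcK) hqp⟩
        have hv := hc'.carrier_vertex ((h.mem_vertices _).2
          (Or.inr ⟨p, q, hqp.symm, hpq, mean_pair hqp.symm⟩))
        rw [hc'.carrier_mean_simplex he] at hv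
        have := card_of_mem_simplices he
        rw [hv, Finset.card_singleton] at this
        omega
      · by_cases hac : a = c
        · subst hac
          convert! m2 a ha d hd hcd using 1
          module
        · by_cases had : a = d
          · subst had
            convert! m2 a ha c hcK hac using 1
            module
          · convert! m3 a ha c hcK d hd hac had hcd using 1
            module
    · by_cases hcd : c = d
      · subst hcd
        by_cases hca : c = a
        · subst hca
          convert! m2 c hcK b hb hab using 1
          module
        · by_cases hcb : c = b
          · subst hcb
            convert! m2 c hcK a ha hca using 1
            module
          · convert! m3 c hcK a ha b hb hca hcb hab using 1
            module
      · have hne : ¬ (a = c ∧ b = d) ∧ ¬ (a = d ∧ b = c) := by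
          refine ⟨?_, ?_⟩
          · rintro ⟨rfl, rfl⟩
            exact hqp (hqcd.trans hpab.symm)
          · rintro ⟨rfl, rfl⟩
            exact hqp (hqcd.trans ((midpoint_comm ..).trans hpab.symm))
        by_cases hac : a = c
        · subst hac
          convert! m3 a ha b hb d hd hab hcd (fun hbd => hne.1 ⟨rfl, hbd⟩) using 1
          module
        by_cases had : a = d
        · subst had
          convert! m3 a ha b hb c hcK hab (Ne.symm hcd) (fun hbc => hne.2 ⟨rfl, hbc⟩) using 1
          module
        by_cases hbc : b = c
        · subst hbc
          convert! m3 b hb a ha d hd (Ne.symm hab) hcd had using 1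
          module
        by_cases hbd : b = d
        · subst hbd
          convert! m3 b hb a ha c hcK (Ne.symm hab) (Ne.symm hcd) hac using 1
          module
        · refine Finset.mem_union_right _ (Finset.mem_image.2 ⟨K, hK, ?_⟩)
          have hsum : ∑ q ∈ ({a, b, c, d} : Finset E3), q = a + b + c + d := by
            rw [Finset.sum_insert (by simp [hab, hac, had]), Finset.sum_insert (by simp [hbc, hbd]),
              Finset.sum_pair hcd]
            module
          have hKe : ({a, b, c, d} : Finset E3) = K := by
            refine Finset.eq_of_subset_of_card_le ?_ ?_
            · intro v hv
              simp only [Finset.mem_insert, Finset.mem_singleton] at hv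
              rcases hv with rfl | rfl | rfl | rfl <;> assumption
            · rw [h𝒯.card_eq K hK, Finset.card_insert_of_notMem (by simp [hab, hac, had]),
                Finset.card_insert_of_notMem (by simp [hbc, hbd]), Finset.card_pair hcd]
          rw [← hsum, hKe]
  have h1 := Finset.card_le_card hsub
  rw [Finset.card_image_of_injOn hinj] at h1
  have h2 := Finset.card_union_le (X₂ ∪ X₃) X₄
  have h3 := Finset.card_union_le X₂ X₃
  omega

/-- Every coarse face contains a new edge in its relative interior. -/
lemma card_faces_le (h𝒯 : IsTetMesh 𝒯) (h𝒯' : IsTetMesh 𝒯') (h : IsUniformRefinement 𝒯 𝒯') :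
    (faces 𝒯).card ≤ (edges 𝒯').card := by
  have hc := h𝒯.conf
  have key : ∀ F ∈ faces 𝒯, ∃ e ∈ edges 𝒯', carrier 𝒯 (mean e) = F := by
    intro F hF
    obtain ⟨K, hK, hFK⟩ := mem_simplices.1 hF
    have hFK' := (Finset.mem_powersetCard.1 hFK).1
    have hF3 : F.card = 3 := card_of_mem_simplices hF
    obtain ⟨F', hF', hne⟩ := Finset.exists_mem_ne
      (s := (faces 𝒯').filter fun t => hull t ⊆ hull F) (by rw [(h.faces_split F hF).1]; norm_num) F
    obtain ⟨hF', hsub⟩ := Finset.mem_filter.1 hF'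
    obtain ⟨K', hK', hFK1⟩ := mem_simplices.1 hF'
    have hF3' : F'.card = 3 := card_of_mem_simplices hF'
    have hFK1' := (Finset.mem_powersetCard.1 hFK1).1
    have hcar : ∀ q ∈ F', carrier 𝒯 q ⊆ F := fun q hq v hv => by
      have hqF := hsub (subset_hull hq)
      by_contra hvF
      have := ((hc.mem_carrier hK (hull_mono hFK' hqF)).1 hv).2
      rw [bary_eq_zero_of_mem_hull (hc.nondeg K hK) hFK' hqF hvF] at this
      exact lt_irrefl _ this
    have hhull : ∀ q ∈ F', q ∈ hull K := fun q hq => hull_mono hFK' (hsub (subset_hull hq))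
    -- a vertex of the new face that is the midpoint of an edge
    obtain ⟨p, hp, hpF⟩ : ∃ p ∈ F', p ∉ F := by
      by_contra! hcon
      exact hne (Finset.eq_of_subset_of_card_le hcon (by rw [hF3, hF3']))
    have hp2 : (carrier 𝒯 p).card = 2 := by
      rcases (h.mem_vertices p).1 (TetMesh.mem_vertices.2 ⟨K', hK', hFK1' hp⟩) with hv | ⟨a, b, hab, he, rfl⟩
      · have := hcar p hp
        rw [hc.carrier_vertex hv, Finset.singleton_subset_iff] at this
        exact (hpF this).elim
      · rw [← mean_pair hab, hc.carrier_mean_simplex he, Finset.card_pair hab]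
    obtain ⟨q, hq, hqp⟩ : ∃ q ∈ F', ¬ carrier 𝒯 q ⊆ carrier 𝒯 p := by
      by_contra! hcon
      have := card_le_of_subset_hull (h𝒯'.nondeg hK') hFK1' (s := carrier 𝒯 p) fun q hq =>
        hull_mono (hcon q hq) (hc.mem_hull_carrier hK (hhull q hq))
      omega
    have hpq : p ≠ q := by
      rintro rfl
      exact hqp subset_rfl
    refine ⟨{p, q}, mem_simplices.2 ⟨K', hK', pair_mem_powersetCard (hFK1' hp) (hFK1' hq) hpq.symm⟩, ?_⟩
    rw [mean_pair hpq, hc.carrier_midpoint hK (hhull p hp) (hhull q hq)]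
    refine Finset.eq_of_subset_of_card_le (Finset.union_subset (hcar p hp) (hcar q hq)) ?_
    rw [hF3]
    have : carrier 𝒯 p ⊂ carrier 𝒯 p ∪ carrier 𝒯 q :=
      Finset.ssubset_iff_subset_ne.2 ⟨Finset.subset_union_left, fun he =>
        hqp (he ▸ Finset.subset_union_right)⟩
    have := Finset.card_lt_card this
    omega
  choose! e he he' using key
  exact Finset.card_le_card_of_injOn e he fun F hF G hG hFG => by
    rw [← he' F hF, ← he' G hG, hFG]

end IsUniformRefinement

end TetMesh

namespace TetMesh

/-! ### Uniform refinement: the boundary -/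

variable {𝒯 𝒯' : Finset (Finset E3)}

/-- The relative interior of a face of two tetrahedra lies in the interior of the domain. -/
lemma IsTetMesh.mem_interior_of_two (h𝒯 : IsTetMesh 𝒯) {K L F : Finset E3} (hK : K ∈ 𝒯)
    (hL : L ∈ 𝒯) (hKL : K ≠ L) (hF : F.card = 3) (hFK : F ⊆ K) (hFL : F ⊆ L) {x : E3}
    (hxK : x ∈ hull K) (hxL : x ∈ hull L) (hpos : ∀ v ∈ F, 0 < bary K v x) :
    x ∈ interior (domain 𝒯) := by
  have hnK := h𝒯.nondeg hK
  have hnL := h𝒯.nondeg hL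
  obtain ⟨u, hu, hKu⟩ := exists_eq_insert_of_card_succ hFK (by rw [hnK.1, hF])
  obtain ⟨w, hw, hLw⟩ := exists_eq_insert_of_card_succ hFL (by rw [hnL.1, hF])
  have hneg := h𝒯.bary_neg hL hK hKL.symm hF hw hLw hu hKu
  have hev : ∀ᶠ y in nhds x, (∀ v ∈ F, 0 < bary K v y) ∧ ∀ v ∈ F, 0 < bary L v y := by
    refine ((Filter.eventually_all_finset F).2 fun v hv => ?_).and
      ((Filter.eventually_all_finset F).2 fun v hv => ?_)
    · exact (continuous_bary K v).continuousAt.eventually_const_lt (hpos v hv)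
    · refine (continuous_bary L v).continuousAt.eventually_const_lt ?_
      rw [← h𝒯.conf.bary_eq K hK L hL x hxK hxL v]
      exact hpos v hv
  refine mem_interior_iff_mem_nhds.2 (hev.mono fun y hy => ?_)
  -- the coordinate of `w` is a negative multiple of that of `u`, since both vanish on the face
  have hprop : bary L w y = bary K u y * bary L w u := by
    rw [affine_eq_sum_bary hnK (bary L w) y,
      Finset.sum_eq_single_of_mem u (hKu ▸ Finset.mem_insert_self u F) fun q hq hqu => ?_,
      smul_eq_mul]
    have hqF : q ∈ F := by
      rw [hKu] at hq
      exact (Finset.mem_insert.1 hq).resolve_left hqu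
    rw [bary_vertex hnL w (hFL hqF), if_neg (fun h : w = q => hw (h ▸ hqF)), smul_zero]
  by_cases hsgn : 0 ≤ bary K u y
  · refine hull_subset_domain hK ((mem_hull_iff_bary hnK).2 fun v hv => ?_)
    rw [hKu] at hv
    rcases Finset.mem_insert.1 hv with rfl | hv
    exacts [hsgn, (hy.1 v hv).le]
  · refine hull_subset_domain hL ((mem_hull_iff_bary hnL).2 fun v hv => ?_)
    rw [hLw] at hv
    rcases Finset.mem_insert.1 hv with rfl | hv
    · rw [hprop]
      nlinarith
    · exact (hy.2 v hv).le

/-- The mean of a boundary face is not an interior point of the domain: points beyond the face would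
lie in another tetrahedron that contains the mean and hence the face. -/
lemma IsTetMesh.mean_notMem_interior (h𝒯 : IsTetMesh 𝒯) {F : Finset E3} (hF : F ∈ bdryFaces 𝒯) :
    mean F ∉ interior (domain 𝒯) := by
  intro hx
  obtain ⟨hFf, hc⟩ := Finset.mem_filter.1 hF
  have hF3 : F.card = 3 := card_of_mem_simplices hFf
  have hne : F.Nonempty := Finset.card_pos.1 (by omega)
  obtain ⟨K, hKe⟩ := Finset.card_eq_one.1 hc
  obtain ⟨hK, hFK⟩ := Finset.mem_filter.1 (hKe ▸ Finset.mem_singleton_self K :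
    K ∈ 𝒯.filter fun K => F ⊆ K)
  have hnK := h𝒯.nondeg hK
  obtain ⟨u, hu, hKu⟩ := exists_eq_insert_of_card_succ hFK (by rw [hnK.1, hF3])
  have huK : u ∈ K := hKu ▸ Finset.mem_insert_self u F
  let γ : ℝ → E3 := fun t => AffineMap.lineMap (mean F) u t
  have hγ0 : γ 0 = mean F := AffineMap.lineMap_apply_zero _ _
  have hγc : Continuous γ := AffineMap.lineMap_continuous
  have hu0 : bary K u (mean F) = 0 := bary_eq_zero_of_mem_hull hnK hFK (mean_mem_hull hne) hu
  have hγu : ∀ t, bary K u (γ t) = t := fun t => by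
    rw [AffineMap.apply_lineMap, hu0, bary_vertex hnK u huK, if_pos rfl, AffineMap.lineMap_apply]
    simp
  let A : Set E3 := ⋃ L ∈ 𝒯.erase K, hull L
  have hA : IsClosed A := (𝒯.erase K).finite_toSet.isClosed_biUnion fun L _ => isClosed_hull L
  have hmem : mean F ∈ A := by
    rw [← hγ0]
    have htend : Filter.Tendsto γ (nhdsWithin 0 (Set.Iio 0)) (nhds (γ 0)) :=
      hγc.continuousAt.mono_left nhdsWithin_le_nhds
    refine hA.mem_of_tendsto htend ?_
    have h1 : ∀ᶠ t in nhdsWithin (0 : ℝ) (Set.Iio 0), γ t ∈ interior (domain 𝒯) :=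
      htend.eventually (isOpen_interior.mem_nhds (hγ0 ▸ hx))
    filter_upwards [h1, self_mem_nhdsWithin] with t ht ht0
    obtain ⟨L, hL, htL⟩ := Set.mem_iUnion₂.1 (interior_subset ht)
    refine Set.mem_iUnion₂.2 ⟨L, Finset.mem_erase.2 ⟨?_, hL⟩, htL⟩
    rintro rfl
    have := bary_nonneg hnK htL u
    rw [hγu] at this
    exact this.not_gt ht0
  obtain ⟨L, hL, hxL⟩ := Set.mem_iUnion₂.1 hmem
  obtain ⟨hLK, hL⟩ := Finset.mem_erase.1 hL
  have hFL := h𝒯.conf.subset_of_mean_mem_hull hK hL hFK hne hxL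
  have : L ∈ 𝒯.filter fun K => F ⊆ K := Finset.mem_filter.2 ⟨hL, hFL⟩
  rw [hKe, Finset.mem_singleton] at this
  exact hLK this

namespace IsUniformRefinement

/-- Every boundary face of the refined mesh lies in a boundary face of the coarse mesh. -/
lemma card_bdryFaces_le (h𝒯 : IsTetMesh 𝒯) (h𝒯' : IsTetMesh 𝒯') (h : IsUniformRefinement 𝒯 𝒯') :
    (bdryFaces 𝒯').card ≤ 4 * (bdryFaces 𝒯).card := by
  have hc := h𝒯.conf
  have hsub : bdryFaces 𝒯' ⊆
      (bdryFaces 𝒯).biUnion fun F => (faces 𝒯').filter fun t => hull t ⊆ hull F := by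
    intro F' hF'
    have hx := h𝒯'.mean_notMem_interior hF'
    rw [h.domain_eq] at hx
    have hFf' := (Finset.mem_filter.1 hF').1
    have hF3' : F'.card = 3 := card_of_mem_simplices hFf'
    have hne' : F'.Nonempty := Finset.card_pos.1 (by omega)
    obtain ⟨K', hK', hFK'⟩ := mem_simplices.1 hFf'
    have hFK1' := (Finset.mem_powersetCard.1 hFK').1
    obtain ⟨K, hK, hKK⟩ := h.parent K' hK'
    have hnK := h𝒯.nondeg hK
    have hpK : ∀ p ∈ F', p ∈ hull K := fun p hp => hKK (subset_hull (hFK1' hp))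
    have hxK : mean F' ∈ hull K := hKK (hull_mono hFK1' (mean_mem_hull hne'))
    set s := carrier 𝒯 (mean F') with hs
    have hsK : s ⊆ K := hc.carrier_subset hK hxK
    have hsx : mean F' ∈ hull s := hc.mem_hull_carrier hK hxK
    -- a coordinate that vanishes at the mean vanishes on the whole face
    have hps : ∀ p ∈ F', p ∈ hull s := by
      intro p hp
      refine mem_hull_of_bary_pos hnK hsK (fun v _ => bary_nonneg hnK (hpK p hp) v) fun v hv hvs => ?_
      have h0 := bary_eq_zero_of_mem_hull hnK hsK hsx hvs
      rw [mean, affine_comb _ _ _ (sum_inv_card hne'), Finset.sum_eq_zero_iff_of_nonneg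
        fun q hq => smul_nonneg (by positivity) (bary_nonneg hnK (hpK q hq) v)] at h0
      refine (smul_eq_zero.1 (h0 p hp)).resolve_left (inv_ne_zero ?_)
      exact Nat.cast_ne_zero.2 (Finset.card_pos.2 hne').ne'
    have hs3 : 3 ≤ s.card := hF3' ▸ card_le_of_subset_hull (h𝒯'.nondeg hK') hFK1' hps
    have hs4 : s.card ≠ 4 := fun hs4 => by
      have hsK' : s = K := Finset.eq_of_subset_of_card_le hsK (by rw [hs4, hnK.1])
      refine hx (interior_mono (hull_subset_domain hK) ((mem_interior_hull_iff hnK).2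
        fun v hv => ((hc.mem_carrier hK hxK).1 (hs ▸ hsK' ▸ hv)).2))
    have hs3' : s.card = 3 := by
      have := Finset.card_le_card hsK
      rw [hnK.1] at this
      omega
    have hsF : s ∈ faces 𝒯 := mem_simplices.2 ⟨K, hK, Finset.mem_powersetCard.2 ⟨hsK, hs3'⟩⟩
    refine Finset.mem_biUnion.2 ⟨s, Finset.mem_filter.2 ⟨hsF, Finset.card_eq_one.2 ⟨K, ?_⟩⟩,
      Finset.mem_filter.2 ⟨hFf', convexHull_min hps (convex_hull s)⟩⟩
    refine Finset.eq_singleton_iff_unique_mem.2 ⟨Finset.mem_filter.2 ⟨hK, hsK⟩, fun L hL => ?_⟩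
    obtain ⟨hL, hsL⟩ := Finset.mem_filter.1 hL
    by_contra hLK
    exact hx (h𝒯.mem_interior_of_two hK hL (Ne.symm hLK) hs3' hsK hsL hxK (hull_mono hsL hsx)
      fun v hv => ((hc.mem_carrier hK hxK).1 hv).2)
  rw [mul_comm]
  exact (Finset.card_le_card hsub).trans (Finset.card_biUnion_le_card_mul _ _ _ fun F hF =>
    (h.faces_split F (Finset.mem_filter.1 hF).1).1.le)

end IsUniformRefinement

/-! ### Uniform refinement: growth of the counts -/

/-- The counts of repeatedly refined meshes: `v - e + t` decreases by at most the order `4 ^ n` of the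
boundary, so that `v` is at most `t / 6` up to this order, while `v` grows like `8 ^ n`. -/
lemma growth {v e f t b : ℕ → ℝ} (hv0 : ∀ n, 0 ≤ v n) (hb0 : ∀ n, 0 ≤ b n) (ht0 : 1 ≤ t 0)
    (hv : ∀ n, v (n + 1) = v n + e n) (ht : ∀ n, 8 * t n ≤ t (n + 1))
    (he : ∀ n, e (n + 1) ≤ 2 * e n + 3 * f n + t n) (hf : ∀ n, 2 * f n = 4 * t n + b n)
    (hb : ∀ n, b (n + 1) ≤ 4 * b n) (hfe : ∀ n, f n ≤ e (n + 1)) {δ : ℝ} (hδ : 0 < δ) :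
    ∃ n₀ : ℕ, ∀ n, n₀ ≤ n → 0 < 7 * f n - 9 * v n - 3 * e n - t n ∧
      0 ≤ 13 * v n - 13 * e n + 7 * f n - t n + δ * v n := by
  have hb4 : ∀ n, b n ≤ b 0 * 4 ^ n := fun n => by
    induction n with
    | zero => simp
    | succ n ih => rw [pow_succ]; linarith [hb n]
  have ht8 : ∀ n, (8 : ℝ) ^ n ≤ t n := fun n => by
    induction n with
    | zero => simpa using ht0
    | succ n ih => rw [pow_succ]; linarith [ht n]
  obtain ⟨C, hC0, hCb, hC⟩ : ∃ C : ℝ, 0 ≤ C ∧ b 0 ≤ C ∧ -C ≤ v 0 - e 0 + t 0 :=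
    ⟨|v 0 - e 0 + t 0| + b 0, add_nonneg (abs_nonneg _) (hb0 0), by
      linarith [abs_nonneg (v 0 - e 0 + t 0)], by
      linarith [neg_abs_le (v 0 - e 0 + t 0), hb0 0]⟩
  have hD : ∀ n, -(C * 4 ^ n) ≤ v n - e n + t n := fun n => by
    induction n with
    | zero => simpa using hC
    | succ n ih =>
      have h1 : b n ≤ C * 4 ^ n := (hb4 n).trans (mul_le_mul_of_nonneg_right hCb (by positivity))
      rw [pow_succ]
      linarith [hv n, ht n, he n, hf n, hb0 n]
  obtain ⟨C', hC'0, hC'C, hC'⟩ : ∃ C' : ℝ, 0 ≤ C' ∧ C ≤ C' ∧ v 0 - t 0 / 6 ≤ C' :=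
    ⟨|v 0 - t 0 / 6| + C, add_nonneg (abs_nonneg _) hC0, by
      linarith [abs_nonneg (v 0 - t 0 / 6)], by linarith [le_abs_self (v 0 - t 0 / 6)]⟩
  have hU : ∀ n, v n - t n / 6 ≤ C' * 4 ^ n := fun n => by
    induction n with
    | zero => simpa using hC'
    | succ n ih =>
      have h1 : C * 4 ^ n ≤ C' * 4 ^ n := mul_le_mul_of_nonneg_right hC'C (by positivity)
      have h2 : 0 ≤ C' * 4 ^ n := by positivity
      rw [pow_succ]
      linarith [hv n, ht n, hD n]
  obtain ⟨k₀, hk₀⟩ := pow_unbounded_of_one_lt (104 * C / δ + 12 * C' + 3 * C) (one_lt_two (α := ℝ))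
  refine ⟨k₀ + 2, fun n hn => ?_⟩
  obtain ⟨k, rfl⟩ : ∃ k, n = k + 2 := ⟨n - 2, by omega⟩
  have hk : 104 * C / δ + 12 * C' + 3 * C < 2 ^ k :=
    hk₀.trans_le (pow_le_pow_right₀ one_le_two (by omega))
  have h84 : (8 : ℝ) ^ k = 2 ^ k * 4 ^ k := by rw [← mul_pow]; norm_num
  have h4 : (0 : ℝ) < 4 ^ k := by positivity
  have hn4 : (4 : ℝ) ^ (k + 2) = 16 * 4 ^ k := by ring
  have hn8 : (8 : ℝ) ^ (k + 2) = 64 * (2 ^ k * 4 ^ k) := by rw [← h84]; ring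
  have hDn := hD (k + 2)
  have hUn := hU (k + 2)
  have htn := ht8 (k + 2)
  have hfn := hf (k + 2)
  have hbn := hb0 (k + 2)
  rw [hn4] at hDn hUn
  rw [hn8] at htn
  have hpos : 0 ≤ 104 * C / δ := by positivity
  constructor
  · have h1 : (12 * C' + 3 * C) * 4 ^ k ≤ 2 ^ k * 4 ^ k :=
      mul_le_mul_of_nonneg_right (by linarith) h4.le
    have h2 : (0 : ℝ) < 2 ^ k * 4 ^ k := by positivity
    linarith
  · have hvn : 2 * (2 ^ k * 4 ^ k) ≤ v (k + 2) := by
      have h1 := hv (k + 1)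
      have h2 := hfe k
      have h3 := ht8 k
      rw [h84] at h3
      change v (k + 2) = _ at h1
      linarith [hv0 (k + 1), hf k, hb0 k]
    have h1 : 104 * C ≤ δ * 2 ^ k := by
      have : 104 * C / δ ≤ 2 ^ k := by linarith
      rw [div_le_iff₀ hδ] at this
      linarith
    have h2 := mul_le_mul_of_nonneg_right h1 h4.le
    have h3 := mul_le_mul_of_nonneg_left hvn hδ.le
    linarith

/-- After sufficiently many refinements the boundary terms in `growth` are negligible. -/
theorem gap_refinement {𝒯 : ℕ → Finset (Finset E3)} (h𝒯 : ∀ n, IsTetMesh (𝒯 n))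
    (hr : ∀ n, IsUniformRefinement (𝒯 n) (𝒯 (n + 1))) {δ : ℝ} (hδ : 0 < δ) :
    ∃ n₀ : ℕ, ∀ n, n₀ ≤ n → ∀ W : WorseyFarin (𝒯 n), curlS W.split 3 < Z W.split 2 ∧
      (5 * avgEdges (𝒯 n) - 22 - δ) * ((vertices (𝒯 n)).card : ℝ) ≤
        (Module.finrank ℝ (Z W.split 2) : ℝ) - Module.finrank ℝ (curlS W.split 3) := by
  obtain ⟨n₀, hn₀⟩ := growth (v := fun n => (vertices (𝒯 n)).card) (e := fun n => (edges (𝒯 n)).card)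
    (f := fun n => (faces (𝒯 n)).card) (t := fun n => (𝒯 n).card)
    (b := fun n => (bdryFaces (𝒯 n)).card) (fun n => by positivity) (fun n => by positivity)
    (by exact_mod_cast Finset.card_pos.2 (h𝒯 0).nonempty)
    (fun n => by exact_mod_cast (hr n).card_vertices (h𝒯 n))
    (fun n => by exact_mod_cast (hr n).le_card (h𝒯 n) (h𝒯 (n + 1)))
    (fun n => by exact_mod_cast (hr n).card_edges_le (h𝒯 n) (h𝒯 (n + 1)))
    (fun n => by exact_mod_cast (h𝒯 n).two_mul_card_faces)
    (fun n => by exact_mod_cast (hr n).card_bdryFaces_le (h𝒯 n) (h𝒯 (n + 1)))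
    (fun n => by exact_mod_cast (hr n).card_faces_le (h𝒯 n) (h𝒯 (n + 1))) hδ
  refine ⟨n₀, fun n hn W => ?_⟩
  obtain ⟨h1, h2⟩ := hn₀ n hn
  exact ⟨W.curlS_lt (h𝒯 n) (h1.trans_le (W.gap (h𝒯 n))), W.gap_of_le (h𝒯 n) h2⟩

end TetMesh

theorem mainTheorem2 :
    -- the gap on an arbitrary mesh, with the lower order terms
    (∀ 𝒯 : Finset (Finset E3), TetMesh.IsTetMesh 𝒯 → TetMesh.HasClosedSurfaceBoundary 𝒯 →
      ∀ W : TetMesh.WorseyFarin 𝒯,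
        FiniteDimensional ℝ (TetMesh.Z W.split 2) ∧
        TetMesh.curlS W.split 3 ≤ TetMesh.Z W.split 2 ∧
        (5 * TetMesh.avgEdges 𝒯 - 22) * ((TetMesh.vertices 𝒯).card : ℝ)
            - 6 * ((TetMesh.bdryVertices 𝒯).card : ℝ)
            + 13 * (TetMesh.eulerChar 𝒯 : ℝ) + 6 * (TetMesh.bdryEulerChar 𝒯 : ℝ)
          ≤ (Module.finrank ℝ (TetMesh.Z W.split 2) : ℝ)
            - (Module.finrank ℝ (TetMesh.curlS W.split 3) : ℝ)) ∧
    -- meshes for which `V_b`, `χ` and `χ_b` are negligible compared with `V`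
    (∀ δ : ℝ, 0 < δ → ∃ η : ℝ, 0 < η ∧
      ∀ 𝒯 : Finset (Finset E3), TetMesh.IsTetMesh 𝒯 → TetMesh.HasClosedSurfaceBoundary 𝒯 →
        ((TetMesh.bdryVertices 𝒯).card : ℝ) ≤ η * ((TetMesh.vertices 𝒯).card : ℝ) →
        |(TetMesh.eulerChar 𝒯 : ℝ)| ≤ η * ((TetMesh.vertices 𝒯).card : ℝ) →
        |(TetMesh.bdryEulerChar 𝒯 : ℝ)| ≤ η * ((TetMesh.vertices 𝒯).card : ℝ) →
        ∀ W : TetMesh.WorseyFarin 𝒯,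
          (5 * TetMesh.avgEdges 𝒯 - 22 - δ) * ((TetMesh.vertices 𝒯).card : ℝ)
            ≤ (Module.finrank ℝ (TetMesh.Z W.split 2) : ℝ)
              - (Module.finrank ℝ (TetMesh.curlS W.split 3) : ℝ) ∧
          (4.4 + δ ≤ TetMesh.avgEdges 𝒯 → TetMesh.curlS W.split 3 < TetMesh.Z W.split 2)) ∧
    -- large Freudenthal meshes
    (∀ δ : ℝ, 0 < δ → ∃ n₀ : ℕ,
      ∀ (o : E3) (h : Fin 3 → ℝ) (N : Fin 3 → ℕ), (∀ i, 0 < h i) → (∀ i, n₀ ≤ N i) →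
        ∀ W : TetMesh.WorseyFarin (TetMesh.freudenthal o h N),
          TetMesh.curlS W.split 3 < TetMesh.Z W.split 2 ∧
          (5 * TetMesh.avgEdges (TetMesh.freudenthal o h N) - 22 - δ) * ((TetMesh.vertices (TetMesh.freudenthal o h N)).card : ℝ)
            ≤ (Module.finrank ℝ (TetMesh.Z W.split 2) : ℝ)
              - (Module.finrank ℝ (TetMesh.curlS W.split 3) : ℝ)) ∧
    -- meshes obtained by sufficiently many uniform refinements
    (∀ 𝒯 : ℕ → Finset (Finset E3), (∀ n, TetMesh.IsTetMesh (𝒯 n)) →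
      (∀ n, TetMesh.IsUniformRefinement (𝒯 n) (𝒯 (n + 1))) →
      ∀ δ : ℝ, 0 < δ → ∃ n₀ : ℕ, ∀ n, n₀ ≤ n → ∀ W : TetMesh.WorseyFarin (𝒯 n),
        TetMesh.curlS W.split 3 < TetMesh.Z W.split 2 ∧
          (5 * TetMesh.avgEdges (𝒯 n) - 22 - δ) * ((TetMesh.vertices (𝒯 n)).card : ℝ)
            ≤ (Module.finrank ℝ (TetMesh.Z W.split 2) : ℝ)
              - (Module.finrank ℝ (TetMesh.curlS W.split 3) : ℝ)) := by
  refine ⟨fun 𝒯 h𝒯 hb W => ⟨TetMesh.finiteDimensional_Z W.split 2, W.curlS_le h𝒯,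
    W.gap_of_closedSurface h𝒯 hb⟩, fun δ hδ => ?_, fun δ hδ => TetMesh.gap_freudenthal hδ,
    fun 𝒯 h𝒯 hr δ hδ => TetMesh.gap_refinement h𝒯 hr hδ⟩
  -- the lower order terms have total weight `6 + 13 + 6 = 25`
  refine ⟨δ / 25, by positivity, fun 𝒯 h𝒯 hb h1 h2 h3 W => ?_⟩
  have h4 := W.gap_of_closedSurface h𝒯 hb
  have h5 := neg_le_of_abs_le h2
  have h6 := neg_le_of_abs_le h3
  have hV : (0 : ℝ) < ((TetMesh.vertices 𝒯).card : ℝ) :=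
    Nat.cast_pos.2 (Finset.card_pos.2 h𝒯.vertices_nonempty)
  have h7 : (5 * TetMesh.avgEdges 𝒯 - 22 - δ) * ((TetMesh.vertices 𝒯).card : ℝ)
      ≤ (Module.finrank ℝ (TetMesh.Z W.split 2) : ℝ)
        - (Module.finrank ℝ (TetMesh.curlS W.split 3) : ℝ) := by linarith
  refine ⟨h7, fun he => W.curlS_lt h𝒯 (lt_of_lt_of_le (mul_pos ?_ hV) h7)⟩
  norm_num at he
  linarith
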